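/- **Setting.** Let $|x|_1=\sum_i|x_i|$ on $\mathbb R^d$. Let $w:\mathbb R^d\to(0,\infty)$ be locally integrable and let $c_w>0$ be such that, for some $C_0>0$, $w(x)\le C_0\,w(x-y)e^{c_w|y|_1}$ for all $x,y\in\mathbb R^d$. For $1\le p<\infty$ let $\|g\|_{L^p_w}=(\int|g|^p w\,dx)^{1/p}$, and let $\|g\|_{L^\infty_w}$ be the essential supremum of $|g|$. For $b>0$ and $\bar s\in\mathbb N_0^d$ let $X_b^{\bar s}(\mathbb R^d)$ be the space of all $\varphi:\mathbb R^d\to\mathbb C$ whose weak derivatives $D^{\bar\alpha}\varphi$, $0\le\bar\alpha\le\bar s$, exist and satisfy $$\sum_{0\le\bar\alpha\le\bar s}\ \sum_{0\le\bar\beta\le\bar s}\Big(\int_{\mathbb R^d}\big|e^{b|x|_1}x^{\bar\beta}D^{\bar\alpha}\varphi(x)\big|^2dx\Big)^{1/2}<\infty,$$ normed by this sum, and let $X_b^{\bar s}(\mathbb R^d)'$ be its topological dual. For $f$ in the dual and a test function $\Phi$ put $\Phi*f(x)=\langle f,\Phi(x-\cdot)\rangle$. **Theorem.** Let $1\le p,q\le\infty$,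 let $\delta$ be a norm on $\mathbb R^d$, and let $L\in\mathbb N_0$ satisfy $\delta(\bar j)<L|\bar j|_1$ for all $\bar j\in\mathbb N_0^d\setminus\{0\}$. Let $0<b'<b$ with $c_w/p<b'$ (where $c_w/\infty=0$). For $i=1,\dots,d$ let $\varphi_0^i\in X_b^{L+1}(\mathbb R)$, put $\varphi^i(t)=\varphi_0^i(t)-2^{-1}\varphi_0^i(2^{-1}t)$, and assume $\int_{\mathbb R}\varphi_0^i*\varphi_0^i(t)\,dt=1$ and $(D^s\widehat{\varphi^i})(0)=0$ for $s=0,1,\dots,L$. For $j\ge1$ put $\varphi^i_j(t)=2^j\varphi^i(2^jt)$ (for $j=0$ the function is $\varphi_0^i$ itself), and for $\bar j\in\mathbb N_0^d$ put $\boldsymbol\varphi_{\bar j}(x)=\prod_{i=1}^d\varphi^i_{j_i}(x_i)$. For $f\in X_b^{(L+1,\dots,L+1)}(\mathbb R^d)'$ define $$\boldsymbol\varphi^*_{\bar j,b',L+1}f(x)=\sup_{y\in\mathbb R^d}\frac{|\boldsymbol\varphi_{\bar j}*f(x-y)|}{\prod_{i=1}^d e^{2^{j_i}b'|y_i|}(1+|2^{j_i}y_i|)^{L+1}}.$$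 Then there are constants $c,C>0$, independent of $f$, such that for every $f\in X_b^{(L+1,\dots,L+1)}(\mathbb R^d)'$, with values in $[0,\infty]$ (and the $\ell^\infty$-modification for $q=\infty$), $$c\,\Big(\sum_{\bar j\in\mathbb N_0^d}2^{q\delta(\bar j)}\|\boldsymbol\varphi_{\bar j}*f\|_{L^p_w}^q\Big)^{1/q}\le\Big(\sum_{\bar j\in\mathbb N_0^d}2^{q\delta(\bar j)}\|\boldsymbol\varphi^*_{\bar j,b',L+1}f\|_{L^p_w}^q\Big)^{1/q}\le C\,\Big(\sum_{\bar j\in\mathbb N_0^d}2^{q\delta(\bar j)}\|\boldsymbol\varphi_{\bar j}*f\|_{L^p_w}^q\Big)^{1/q}.$$ The left-hand sum is the quasinorm of $f$ in $VB^{\delta,w}_{p,q}(\mathbb R^d)$ built with the system $(\boldsymbol\varphi_{\bar j})$; in particular the equivalence holds for all $f\in VB^{\delta,w}_{p,q}(\mathbb R^d)$. -/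

import Mathlib

open MeasureTheory
open scoped ENNReal ContDiff FourierTransform

noncomputable section

namespace ExpBesov

/-- The `ℓ¹`-norm `|x|₁` on `ℝ^d`. -/
def l1 {d : ℕ} (x : Fin d → ℝ) : ℝ := ∑ i, |x i|

/-! ### Weak derivatives -/

/-- The classical partial derivative `∂_i η`. -/
def partialD {d : ℕ} (i : Fin d) (η : (Fin d → ℝ) → ℝ) : (Fin d → ℝ) → ℝ :=
  fun x => fderiv ℝ η x (Pi.single i 1)

/-- The classical derivative `D^α η` for a multi-index `α`. -/
def multiD {d : ℕ} (α : Fin d → ℕ) (η : (Fin d → ℝ) → ℝ) : (Fin d → ℝ) → ℝ :=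
  (List.finRange d).foldr (fun i g => (partialD i)^[α i] g) η

/-- `g` is a weak (distributional) derivative `D^α φ` of `φ`. -/
def HasWeakDeriv {d : ℕ} (α : Fin d → ℕ) (φ g : (Fin d → ℝ) → ℂ) : Prop :=
  LocallyIntegrable φ ∧ LocallyIntegrable g ∧
    ∀ η : (Fin d → ℝ) → ℝ, ContDiff ℝ ∞ η → HasCompactSupport η →
      ∫ x, multiD α η x • φ x = (-1 : ℂ) ^ (∑ i, α i) * ∫ x, η x • g x

open Classical in
/-- A chosen weak derivative `D^α φ` (unique up to a null set), and `0` if there is none. -/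
def weakDeriv {d : ℕ} (α : Fin d → ℕ) (φ : (Fin d → ℝ) → ℂ) : (Fin d → ℝ) → ℂ :=
  if h : ∃ g, HasWeakDeriv α φ g then h.choose else 0

/-! ### The test function spaces `X_b^s(ℝ^d)` and their duals -/

/-- The function `e^{b|x|₁} x^β g(x)`. -/
def weighted {d : ℕ} (b : ℝ) (β : Fin d → ℕ) (g : (Fin d → ℝ) → ℂ) : (Fin d → ℝ) → ℂ :=
  fun x => (Real.exp (b * l1 x) * ∏ i, x i ^ β i) • g x

lemma HasWeakDeriv.add {d : ℕ} {α : Fin d → ℕ} {φ ψ g h : (Fin d → ℝ) → ℂ}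
    (hφ : HasWeakDeriv α φ g) (hψ : HasWeakDeriv α ψ h)
    (hD : ∀ η : (Fin d → ℝ) → ℝ, ContDiff ℝ ∞ η → HasCompactSupport η →
      Continuous (multiD α η) ∧ HasCompactSupport (multiD α η)) :
    HasWeakDeriv α (φ + ψ) (g + h) := by
  refine ⟨hφ.1.add hψ.1, hφ.2.1.add hψ.2.1, fun η h1 h2 => ?_⟩
  obtain ⟨c1, c2⟩ := hD η h1 h2
  have e1 := hφ.2.2 η h1 h2
  have e2 := hψ.2.2 η h1 h2
  simp only [Pi.add_apply, smul_add]
  rw [integral_add (hφ.1.integrable_smul_left_of_hasCompactSupport c1 c2)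
      (hψ.1.integrable_smul_left_of_hasCompactSupport c1 c2),
    integral_add (hφ.2.1.integrable_smul_left_of_hasCompactSupport h1.continuous h2)
      (hψ.2.1.integrable_smul_left_of_hasCompactSupport h1.continuous h2), e1, e2]
  ring

lemma partialD_regular {d : ℕ} (i : Fin d) (η : (Fin d → ℝ) → ℝ)
    (h : ContDiff ℝ ∞ η ∧ HasCompactSupport η) :
    ContDiff ℝ ∞ (partialD i η) ∧ HasCompactSupport (partialD i η) := by
  refine ⟨?_, h.2.fderiv_apply ℝ _⟩
  exact (h.1.fderiv_right (m := ∞) (by simp)).clm_apply contDiff_const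

lemma multiD_regular {d : ℕ} (α : Fin d → ℕ) (η : (Fin d → ℝ) → ℝ)
    (h : ContDiff ℝ ∞ η ∧ HasCompactSupport η) :
    ContDiff ℝ ∞ (multiD α η) ∧ HasCompactSupport (multiD α η) := by
  unfold multiD
  induction List.finRange d with
  | nil => exact h
  | cons i l ih =>
    simp only [List.foldr_cons]
    induction α i with
    | zero => exact ih
    | succ n ihn =>
      rw [Function.iterate_succ_apply']
      exact partialD_regular i _ ihn

/-- The space `X_b^s(ℝ^d)`, `s ∈ ℕ₀^d`: all `φ` whose weak derivatives `D^α φ`, `0 ≤ α ≤ s`, exist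
and satisfy `e^{b|x|₁} x^β D^α φ ∈ L²` for all `0 ≤ β ≤ s`. For `b ≥ 0` every such `φ` has all its
mixed derivatives `D^α φ`, `α ≤ s`, in `L²`, that is, `φ` lies in the Sobolev space of dominating
mixed smoothness `MB^s_{2,2}(ℝ^d)`. Functions are not identified almost everywhere here, which
makes no difference for bounded linear functionals. -/
def X {d : ℕ} (b : ℝ) (s : Fin d → ℕ) : Submodule ℂ ((Fin d → ℝ) → ℂ) where
  carrier := {φ | ∀ α ≤ s, ∃ g, HasWeakDeriv α φ g ∧ ∀ β ≤ s, MemLp (weighted b β g) 2}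
  add_mem' := by
    intro φ ψ hφ hψ α hα
    obtain ⟨g, hg, hg'⟩ := hφ α hα
    obtain ⟨h, hh, hh'⟩ := hψ α hα
    refine ⟨g + h, hg.add hh fun η h1 h2 => ?_, fun β hβ => ?_⟩
    · exact ⟨(multiD_regular α η ⟨h1, h2⟩).1.continuous, (multiD_regular α η ⟨h1, h2⟩).2⟩
    · have : weighted b β (g + h) = weighted b β g + weighted b β h := by
        ext x; simp [weighted]
      rw [this]
      exact (hg' β hβ).add (hh' β hβ)
  zero_mem' := by
    intro α _
    refine ⟨0, ⟨locallyIntegrable_zero, locallyIntegrable_zero, fun η _ _ => by simp⟩,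
      fun β _ => ?_⟩
    have : weighted b β (0 : (Fin d → ℝ) → ℂ) = 0 := by ext x; simp [weighted]
    rw [this]
    exact MemLp.zero
  smul_mem' := by
    intro c φ hφ α hα
    obtain ⟨g, hg, hg'⟩ := hφ α hα
    refine ⟨c • g, ⟨hg.1.smul c, hg.2.1.smul c, fun η h1 h2 => ?_⟩, fun β hβ => ?_⟩
    · simp only [Pi.smul_apply, smul_comm _ c, integral_smul]
      rw [hg.2.2 η h1 h2]
      simp only [smul_eq_mul]
      ring
    · have : weighted b β (c • g) = c • weighted b β g := by
        ext x; simp [weighted]; ring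
      rw [this]
      exact (hg' β hβ).const_smul c

/-- The norm `∑_{α ≤ s} ∑_{β ≤ s} ‖e^{b|x|₁} x^β D^α φ‖_{L²}` of `X_b^s(ℝ^d)`. -/
def xNorm {d : ℕ} (b : ℝ) (s : Fin d → ℕ) (φ : (Fin d → ℝ) → ℂ) : ℝ :=
  ∑ α ∈ Finset.Iic s, ∑ β ∈ Finset.Iic s,
    (eLpNorm (weighted b β (weakDeriv α φ)) 2 volume).toReal

/-- The topological dual `X_b^s(ℝ^d)'`: the bounded linear functionals on `X_b^s(ℝ^d)`. -/
structure XDual {d : ℕ} (b : ℝ) (s : Fin d → ℕ) where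
  toLin : X b s →ₗ[ℂ] ℂ
  bounded : ∃ C : ℝ, ∀ φ : X b s, ‖toLin φ‖ ≤ C * xNorm b s (φ : (Fin d → ℝ) → ℂ)

open Classical in
/-- The convolution `(Φ * f)(x) = f(Φ(x - ·))` of `f ∈ X_b^s(ℝ^d)'` with a test function `Φ`
(all translates of the reflection of `Φ ∈ X_b^s(ℝ^d)` lie in `X_b^s(ℝ^d)` when `b ≥ 0`). -/
def conv {d : ℕ} {b : ℝ} {s : Fin d → ℕ} (Φ : (Fin d → ℝ) → ℂ) (f : XDual b s)
    (x : Fin d → ℝ) : ℂ :=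
  if h : (fun y => Φ (x - y)) ∈ X b s then f.toLin ⟨_, h⟩ else 0

/-- The one-dimensional space `X_b^n(ℝ)`, for functions of a real variable. -/
def MemX1 (b : ℝ) (n : ℕ) (φ : ℝ → ℂ) : Prop :=
  (fun x : Fin 1 → ℝ => φ (x 0)) ∈ X b (fun _ : Fin 1 => n)

/-! ### Dyadic systems -/

/-- `φ(x) = φ₀(x) - 2⁻¹ φ₀(2⁻¹ x)`. -/
def diffFun (φ₀ : ℝ → ℂ) : ℝ → ℂ := fun x => φ₀ x - (2 : ℂ)⁻¹ * φ₀ (2⁻¹ * x)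

/-- The system `φ_0 = φ₀` and `φ_j(x) = 2^j φ(2^j x)` for `j ≥ 1`, where
`φ(x) = φ₀(x) - 2⁻¹ φ₀(2⁻¹ x)`. -/
def dyadic (φ₀ : ℝ → ℂ) (j : ℕ) : ℝ → ℂ :=
  if j = 0 then φ₀ else fun x => (2 : ℂ) ^ j * diffFun φ₀ (2 ^ j * x)

/-- The tensor product `∏_i φ^i_{j_i}(x_i)`. -/
def tensor {d : ℕ} (φ₀ : Fin d → ℝ → ℂ) (j : Fin d → ℕ) : (Fin d → ℝ) → ℂ :=
  fun x => ∏ i, dyadic (φ₀ i) (j i) (x i)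

/-- The weighted Peetre maximal function: the supremum over `y ∈ ℝ^d` of `|F(x - y)|` divided by
`∏_i e^{2^{j_i} a |y_i|} (1 + |2^{j_i} y_i|)^n`. -/
def peetre {d : ℕ} (j : Fin d → ℕ) (a : ℝ) (n : ℕ) (F : (Fin d → ℝ) → ℂ) (x : Fin d → ℝ) :
    ℝ≥0∞ :=
  ⨆ y : Fin d → ℝ, ‖F (x - y)‖ₑ /
    ENNReal.ofReal (∏ i, Real.exp (2 ^ j i * a * |y i|) * (1 + |2 ^ j i * y i|) ^ n)

/-! ### Weights and quasinorms -/

/-- `w` is a locally integrable weight with `0 < w(x) ≤ C w(x - y) e^{c_w |y|₁}`. -/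
structure IsExpWeight {d : ℕ} (w : (Fin d → ℝ) → ℝ) (cw : ℝ) : Prop where
  locallyIntegrable : LocallyIntegrable w
  pos : ∀ x, 0 < w x
  cw_pos : 0 < cw
  bound : ∃ C : ℝ, 0 < C ∧ ∀ x y, w x ≤ C * (w (x - y) * Real.exp (cw * l1 y))

/-- The measure `w(x) dx`; its `L^p`-norm is the norm of `L^p_w`. -/
def weightMeasure {d : ℕ} (w : (Fin d → ℝ) → ℝ) : Measure (Fin d → ℝ) :=
  volume.withDensity (fun x => ENNReal.ofReal (w x))

/-- The `ℓ^q`-norm of a family in `[0, ∞]`: the supremum if `q = ∞`. -/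
def lqNorm {ι : Type*} (q : ℝ≥0∞) (a : ι → ℝ≥0∞) : ℝ≥0∞ :=
  if q = ⊤ then ⨆ j, a j else (∑' j, a j ^ q.toReal) ^ (1 / q.toReal)

/-- The quasinorm `(∑_{j ∈ ℕ₀^d} 2^{q δ(j)} ‖φ_j * f‖_{L^p_w}^q)^{1/q}` of `f` in `VB^{δ,w}_{p,q}`,
built with the system generated by `φ₀`. -/
def vbNorm {d : ℕ} {b : ℝ} {s : Fin d → ℕ} (p q : ℝ≥0∞) (w : (Fin d → ℝ) → ℝ)
    (δ : (Fin d → ℝ) → ℝ) (φ₀ : Fin d → ℝ → ℂ) (f : XDual b s) : ℝ≥0∞ :=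
  lqNorm q fun j : Fin d → ℕ => ENNReal.ofReal ((2 : ℝ) ^ δ (fun i => (j i : ℝ))) *
    eLpNorm (conv (tensor φ₀ j) f) p (weightMeasure w)

/-- The same quasinorm with `φ_j * f` replaced by its Peetre maximal function with
parameters `a` and `n`. -/
def vbPeetreNorm {d : ℕ} {b : ℝ} {s : Fin d → ℕ} (p q : ℝ≥0∞) (w : (Fin d → ℝ) → ℝ)
    (δ : (Fin d → ℝ) → ℝ) (φ₀ : Fin d → ℝ → ℂ) (a : ℝ) (n : ℕ) (f : XDual b s) : ℝ≥0∞ :=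
  lqNorm q fun j : Fin d → ℕ => ENNReal.ofReal ((2 : ℝ) ^ δ (fun i => (j i : ℝ))) *
    eLpNorm (peetre j a n (conv (tensor φ₀ j) f)) p (weightMeasure w)

end ExpBesov

end

/-! The left inequality is the choice y = 0 in the supremum. The right one rests on a Calderón
reproducing formula whose dual functions also have vanishing moments.

Fix a coordinate, let g be its φ₀ and σ = ∫ g, so that σ² = 1. The moment of order s of φ is (1 -
2^s) times that of g, so the moments of g of orders 1, …, L vanish: up to order L, g looks like σ
times the Dirac measure. In the convolution algebra put P(t) = 3t² - 2σt³. Since P(σ) = 1, the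
dilations of P(g) form an approximate identity. Since t² divides P, the algebra needs no unit to
factor P(g) and its increments. With s = 2g(2·) and t = g, the increment P(s) - P(t) is s - t, which
generates the levels j ≥ 1, times a divided difference whose moments up to order L are those of
P'(σ) = 0 times the Dirac measure (`AlgA.hasMom_dual`).

Telescoping over dilations (`AlgA.sum_Psi_mul_Phi`), taking tensor products and letting N → ∞ bounds
|φ_j * f| by a sum over κ of convolutions of |Phi_j * Psi_κ| with |φ_κ * f|
(`enorm_conv_tens_Phi_le`). The manipulations with f are justified by Hahn-Banach and Riesz, which
express f through L² functions paired with weighted derivatives (`XDual.exists_conv_eq`).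

Smoothness of the factor at the coarser scale and moments of the finer one make Phi_j * Psi_k of
size 2^(-L|j - k|), with exponential decay at the coarser scale (`AlgA.exists_norm_Phi_mul_Psi_le`).
Shifting such a kernel costs no more than the denominator of the Peetre function, which therefore
obeys the same bound (`peetre_le`). A weighted Young inequality, which needs c_w/p < b', and Schur's
test, which needs δ(e_i) < L, conclude in `exists_lqNorm_peetre_le`. -/

noncomputable section

namespace ExpBesov

open Filter Topology

/-! ### Weighted L² on the line is closed under convolution. -/

section

/-! ### Exponential-polynomial weights on the line -/

/-- The weight `e^{b|t|} (1 + |t|)^n` on the line. -/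
def wt (b : ℝ) (n : ℕ) (t : ℝ) : ℝ := Real.exp (b * |t|) * (1 + |t|) ^ n

lemma wt_pos (b : ℝ) (n : ℕ) (t : ℝ) : 0 < wt b n t := by
  unfold wt; positivity

lemma continuous_wt (b : ℝ) (n : ℕ) : Continuous (wt b n) := by
  unfold wt; fun_prop

lemma wt_add_le {b : ℝ} (hb : 0 ≤ b) (n : ℕ) (s t : ℝ) :
    wt b n (s + t) ≤ wt b n s * wt b n t := by
  unfold wt
  have h1 : Real.exp (b * |s + t|) ≤ Real.exp (b * |s|) * Real.exp (b * |t|) := by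
    rw [← Real.exp_add]
    apply Real.exp_le_exp.2
    nlinarith [abs_add_le s t]
  have h2 : (1 + |s + t|) ^ n ≤ (1 + |s|) ^ n * (1 + |t|) ^ n := by
    rw [← mul_pow]
    gcongr
    nlinarith [abs_add_le s t, abs_nonneg s, abs_nonneg t, mul_nonneg (abs_nonneg s) (abs_nonneg t)]
  calc _ ≤ (Real.exp (b * |s|) * Real.exp (b * |t|)) * ((1 + |s|) ^ n * (1 + |t|) ^ n) := by gcongr
    _ = _ := by ring

lemma wt_neg (b : ℝ) (n : ℕ) (t : ℝ) : wt b n (-t) = wt b n t := by simp [wt]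

lemma wt_sub_le {b : ℝ} (hb : 0 ≤ b) (n : ℕ) (s t : ℝ) :
    wt b n (s - t) ≤ wt b n s * wt b n t := by
  simpa [sub_eq_add_neg, wt_neg] using wt_add_le hb n s (-t)

lemma wt_le_mul_sub {b : ℝ} (hb : 0 ≤ b) (n : ℕ) (x t : ℝ) :
    wt b n x ≤ wt b n t * wt b n (x - t) := by
  simpa using wt_add_le hb n t (x - t)

lemma wt_mono_abs {b : ℝ} (hb : 0 ≤ b) (n : ℕ) {s t : ℝ} (h : |s| ≤ |t|) : wt b n s ≤ wt b n t := by
  unfold wt; gcongr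

/-- The functions `u` with `e^{b|t|} (1 + |t|)^n u ∈ L²(ℝ)`. -/
def InA (b : ℝ) (n : ℕ) (u : ℝ → ℂ) : Prop := MemLp (fun t => wt b n t • u t) 2 volume

lemma InA.aestronglyMeasurable {b : ℝ} {n : ℕ} {u : ℝ → ℂ} (hu : InA b n u) :
    AEStronglyMeasurable u volume := by
  have h := ((continuous_wt b n).inv₀ fun t => (wt_pos b n t).ne').aestronglyMeasurable
    (μ := volume) |>.smul hu.1
  refine h.congr (Filter.Eventually.of_forall fun t => ?_)
  simp [(wt_pos b n t).ne']

lemma inA_iff {b : ℝ} {n : ℕ} {u : ℝ → ℂ} : InA b n u ↔ AEStronglyMeasurable u volume ∧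
    ∫⁻ t, (ENNReal.ofReal (wt b n t) * ‖u t‖ₑ) ^ 2 < ⊤ := by
  have key : ∀ t, ‖wt b n t • u t‖ₑ ^ (2 : ℝ) = (ENNReal.ofReal (wt b n t) * ‖u t‖ₑ) ^ 2 := by
    intro t
    rw [enorm_smul, Real.enorm_of_nonneg (wt_pos b n t).le]
    norm_cast
  constructor
  · intro h
    refine ⟨h.aestronglyMeasurable, ?_⟩
    have := h.2
    rw [eLpNorm_lt_top_iff_lintegral_rpow_enorm_lt_top (by simp) (by simp)] at this
    simpa only [ENNReal.toReal_ofNat, key] using this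
  · rintro ⟨h1, h2⟩
    refine ⟨(continuous_wt b n).aestronglyMeasurable.smul h1, ?_⟩
    rw [eLpNorm_lt_top_iff_lintegral_rpow_enorm_lt_top (by simp) (by simp)]
    simpa only [ENNReal.toReal_ofNat, key] using h2

lemma InA.congr {b : ℝ} {n : ℕ} {u v : ℝ → ℂ} (hu : InA b n u) (h : u =ᵐ[volume] v) : InA b n v :=
  MemLp.ae_eq (h.mono fun t ht => by simp [ht]) hu

lemma InA.norm {b : ℝ} {n : ℕ} {u : ℝ → ℂ} (hu : InA b n u) : InA b n (fun t => (‖u t‖ : ℂ)) :=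
  inA_iff.2 ⟨Complex.continuous_ofReal.comp_aestronglyMeasurable hu.aestronglyMeasurable.norm,
    by
      have h : ∀ t, ‖(‖u t‖ : ℂ)‖ₑ = ‖u t‖ₑ := fun t => by
        rw [← ofReal_norm, ← ofReal_norm, Complex.norm_real, norm_norm]
      simpa only [h] using (inA_iff.1 hu).2⟩

lemma InA.add {b : ℝ} {n : ℕ} {u v : ℝ → ℂ} (hu : InA b n u) (hv : InA b n v) :
    InA b n (u + v) := by
  have := MemLp.add hu hv
  refine MemLp.ae_eq (Filter.Eventually.of_forall fun t => ?_) this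
  simp

lemma InA.const_smul {b : ℝ} {n : ℕ} {u : ℝ → ℂ} (hu : InA b n u) (c : ℂ) : InA b n (c • u) := by
  have := MemLp.const_smul hu c
  refine MemLp.ae_eq (Filter.Eventually.of_forall fun t => ?_) this
  simp only [Pi.smul_apply]
  rw [smul_comm]

lemma inA_zero (b : ℝ) (n : ℕ) : InA b n 0 := by
  unfold InA; simp

lemma InA.mono {a b : ℝ} {m n : ℕ} {u : ℝ → ℂ} {C : ℝ} (hu : InA b n u)
    (h : ∀ t, wt a m t ≤ C * wt b n t) : InA a m u := by
  refine MemLp.of_le_mul (c := C) hu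
    ((continuous_wt a m).aestronglyMeasurable.smul hu.aestronglyMeasurable)
    (Filter.Eventually.of_forall fun t => ?_)
  rw [norm_smul, norm_smul, Real.norm_of_nonneg (wt_pos _ _ _).le,
    Real.norm_of_nonneg (wt_pos _ _ _).le, ← mul_assoc]
  gcongr
  exact h t

lemma InA.of_le {b : ℝ} {n : ℕ} {u : ℝ → ℂ} (hu : InA b n u) {a : ℝ} (hab : a ≤ b) {m : ℕ}
    (hm : m ≤ n) : InA a m u := by
  refine hu.mono (C := 1) fun t => ?_
  unfold wt
  rw [one_mul]
  gcongr
  linarith [abs_nonneg t]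

lemma InA.memLp {b : ℝ} (hb : 0 ≤ b) {n : ℕ} {u : ℝ → ℂ} (hu : InA b n u) : MemLp u 2 volume := by
  have : InA 0 0 u := hu.of_le hb (Nat.zero_le _)
  simpa [InA, wt] using this

/-! ### Convolution of complex functions -/

/-- The convolution of two complex-valued functions. -/
def cv {G : Type*} [Sub G] [MeasureSpace G] (u v : G → ℂ) (x : G) : ℂ := ∫ t, u t * v (x - t)

lemma cv_eq_convolution {G : Type*} [Sub G] [MeasureSpace G] (u v : G → ℂ) :
    cv u v = convolution u v (ContinuousLinearMap.mul ℝ ℂ) volume := rfl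

lemma cv_comm (u v : ℝ → ℂ) : cv u v = cv v u := by
  ext x
  unfold cv
  rw [← integral_sub_left_eq_self _ volume x]
  simp [mul_comm]

lemma cv_congr {u u' v v' : ℝ → ℂ} (hu : u =ᵐ[volume] u') (hv : v =ᵐ[volume] v') :
    cv u v = cv u' v' := by
  ext x
  unfold cv
  apply integral_congr_ae
  have h2 := (Measure.measurePreserving_sub_left (volume : Measure ℝ) x).quasiMeasurePreserving.ae_eq_comp hv
  filter_upwards [hu, h2] with t h1 h2
  simp only [Function.comp] at h2
  rw [h1, h2]

lemma MemLp.comp_sub_left {E : Type*} [NormedAddCommGroup E] {u : ℝ → E} {p : ℝ≥0∞}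
    (hu : MemLp u p volume) (x : ℝ) : MemLp (fun t => u (x - t)) p volume :=
  hu.comp_measurePreserving (Measure.measurePreserving_sub_left (volume : Measure ℝ) x)

lemma integrable_mul_sub {u v : ℝ → ℂ} (hu : MemLp u 2 volume) (hv : MemLp v 2 volume) (x : ℝ) :
    Integrable (fun t => u t * v (x - t)) volume :=
  hu.integrable_mul (MemLp.comp_sub_left hv x)

/-! ### A Cauchy-Schwarz inequality -/

lemma lintegral_mul_sq_le {α : Type*} [MeasurableSpace α] {μ : Measure α} {f g : α → ℝ≥0∞}
    (hf : AEMeasurable f μ) (hg : AEMeasurable g μ) :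
    (∫⁻ a, f a * g a ∂μ) ^ 2 ≤ (∫⁻ a, f a ^ 2 ∂μ) * ∫⁻ a, g a ^ 2 ∂μ := by
  have h := ENNReal.lintegral_mul_le_Lp_mul_Lq μ
    (Real.HolderConjugate.two_two) hf hg
  have h2 : (∫⁻ a, f a * g a ∂μ) ^ 2 ≤
      ((∫⁻ a, f a ^ (2 : ℝ) ∂μ) ^ (1 / 2 : ℝ) * (∫⁻ a, g a ^ (2 : ℝ) ∂μ) ^ (1 / 2 : ℝ)) ^ 2 := by
    gcongr
    exact h
  refine h2.trans (le_of_eq ?_)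
  rw [mul_pow, ← ENNReal.rpow_natCast, ← ENNReal.rpow_natCast, ← ENNReal.rpow_mul,
    ← ENNReal.rpow_mul]
  norm_num

/-! ### The weighted `L²`-space is a convolution algebra -/

/-- The constant in the convolution inequality of `InA b n`. -/
def wtConst (n : ℕ) : ℝ≥0∞ :=
  ENNReal.ofReal (2 * 4 ^ n) * ∫⁻ t : ℝ, ENNReal.ofReal (((1 + |t|) ^ (2 * n))⁻¹)

/-- Integrability on the line needs 2n > 1; this is the only role of the polynomial factor of the
weight. -/
lemma wtConst_lt_top {n : ℕ} (hn : 1 ≤ n) : wtConst n < ⊤ := by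
  unfold wtConst
  refine ENNReal.mul_lt_top ENNReal.ofReal_lt_top ?_
  have h := integrable_one_add_norm (E := ℝ) (μ := volume) (r := ((2 * n : ℕ) : ℝ)) (by
    rw [Module.finrank_self]; norm_cast; omega)
  have h2 : Integrable (fun t : ℝ => ((1 + |t|) ^ (2 * n))⁻¹) := by
    refine h.congr (Filter.Eventually.of_forall fun t => ?_)
    simp only [Real.norm_eq_abs]
    rw [Real.rpow_neg (by positivity), Real.rpow_natCast]
  have h3 := h2.2
  rw [hasFiniteIntegral_iff_ofReal (Filter.Eventually.of_forall fun t => by positivity)] at h3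
  exact h3

/-- The exponentials cancel by the triangle inequality. Moreover 1 + |x| is at most twice the larger
of 1 + |t| and 1 + |x - t|, so that factor is absorbed at the cost 2^(2n) and only the inverse of
the smaller one remains. -/
lemma wt_subconvolutive {b : ℝ} (hb : 0 ≤ b) (n : ℕ) (x t : ℝ) :
    (wt b n x * ((wt b n t)⁻¹ * (wt b n (x - t))⁻¹)) ^ 2 ≤
      4 ^ n * (((1 + |t|) ^ (2 * n))⁻¹ + ((1 + |x - t|) ^ (2 * n))⁻¹) := by
  have hx : |x| ≤ |t| + |x - t| := by simpa using abs_add_le t (x - t)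
  have h1 : wt b n x * ((wt b n t)⁻¹ * (wt b n (x - t))⁻¹) ≤
      (1 + |x|) ^ n * (((1 + |t|) ^ n)⁻¹ * ((1 + |x - t|) ^ n)⁻¹) := by
    unfold wt
    have e : Real.exp (b * |x|) ≤ Real.exp (b * |t|) * Real.exp (b * |x - t|) := by
      rw [← Real.exp_add]
      apply Real.exp_le_exp.2
      nlinarith
    have : Real.exp (b * |x|) * (1 + |x|) ^ n ≤
      Real.exp (b * |t|) * Real.exp (b * |x - t|) * (1 + |x|) ^ n := by gcongr
    rw [← mul_inv, ← mul_inv, ← div_eq_mul_inv, ← div_eq_mul_inv,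
      div_le_div_iff₀ (by positivity) (by positivity)]
    calc _ ≤ Real.exp (b * |t|) * Real.exp (b * |x - t|) * (1 + |x|) ^ n *
          ((1 + |t|) ^ n * (1 + |x - t|) ^ n) := by gcongr
      _ = _ := by ring
  have h0 : 0 ≤ wt b n x * ((wt b n t)⁻¹ * (wt b n (x - t))⁻¹) := by
    have := wt_pos b n x; have := wt_pos b n t; have := wt_pos b n (x - t)
    positivity
  refine (pow_le_pow_left₀ h0 h1 2).trans ?_
  set A := 1 + |t| with hA
  set B := 1 + |x - t| with hB
  have hA0 : 0 < A := by positivity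
  have hB0 : 0 < B := by positivity
  have e : ((1 + |x|) ^ n * ((A ^ n)⁻¹ * (B ^ n)⁻¹)) ^ 2 =
      (1 + |x|) ^ (2 * n) * ((A ^ (2 * n))⁻¹ * (B ^ (2 * n))⁻¹) := by
    rw [mul_pow, mul_pow, inv_pow, inv_pow, ← pow_mul, ← pow_mul, ← pow_mul]
    ring_nf
  rw [e]
  have e2 : (4 : ℝ) ^ n = 2 ^ (2 * n) := by rw [pow_mul]; norm_num
  rw [e2]
  rcases le_total A B with h | h
  · have : (1 + |x|) ^ (2 * n) ≤ 2 ^ (2 * n) * B ^ (2 * n) := by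
      rw [← mul_pow]; gcongr; linarith
    calc _ ≤ 2 ^ (2 * n) * B ^ (2 * n) * ((A ^ (2 * n))⁻¹ * (B ^ (2 * n))⁻¹) := by gcongr
      _ = 2 ^ (2 * n) * ((A ^ (2 * n))⁻¹) := by field_simp
      _ ≤ _ := by gcongr; simp; positivity
  · have : (1 + |x|) ^ (2 * n) ≤ 2 ^ (2 * n) * A ^ (2 * n) := by
      rw [← mul_pow]; gcongr; linarith
    calc _ ≤ 2 ^ (2 * n) * A ^ (2 * n) * ((A ^ (2 * n))⁻¹ * (B ^ (2 * n))⁻¹) := by gcongr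
      _ = 2 ^ (2 * n) * ((B ^ (2 * n))⁻¹) := by field_simp
      _ ≤ _ := by gcongr; simp; positivity

lemma lintegral_wt_subconvolutive {b : ℝ} (hb : 0 ≤ b) (n : ℕ) (x : ℝ) :
    ∫⁻ t, ENNReal.ofReal (wt b n x * ((wt b n t)⁻¹ * (wt b n (x - t))⁻¹)) ^ 2 ≤ wtConst n := by
  have hm : Measurable fun t : ℝ => ENNReal.ofReal (((1 + |t|) ^ (2 * n))⁻¹) := by fun_prop
  calc _ ≤ ∫⁻ t, ENNReal.ofReal (4 ^ n) * (ENNReal.ofReal (((1 + |t|) ^ (2 * n))⁻¹) +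
        ENNReal.ofReal (((1 + |x - t|) ^ (2 * n))⁻¹)) := by
        refine lintegral_mono fun t => ?_
        rw [← ENNReal.ofReal_pow, ← ENNReal.ofReal_add, ← ENNReal.ofReal_mul]
        · exact ENNReal.ofReal_le_ofReal (wt_subconvolutive hb n x t)
        · positivity
        · positivity
        · positivity
        · have := wt_pos b n x; have := wt_pos b n t; have := wt_pos b n (x - t)
          positivity
    _ = wtConst n := by
        rw [lintegral_const_mul _ (by fun_prop), lintegral_add_left hm,
          lintegral_sub_left_eq_self (fun t : ℝ => ENNReal.ofReal (((1 + |t|) ^ (2 * n))⁻¹)) x,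
          wtConst, ENNReal.ofReal_mul (by norm_num), ← two_mul, ← mul_assoc,
          mul_comm (ENNReal.ofReal 2)]
        simp

lemma aemeasurable_comp_sub {f : ℝ → ℝ≥0∞} (hf : AEMeasurable f volume) (x : ℝ) :
    AEMeasurable (fun t => f (x - t)) volume :=
  hf.comp_quasiMeasurePreserving
    (Measure.measurePreserving_sub_left (volume : Measure ℝ) x).quasiMeasurePreserving

lemma lintegral_conv_mul_right {f g : ℝ → ℝ≥0∞} (hf : AEMeasurable f volume)
    (hg : AEMeasurable g volume) :
    ∫⁻ x, ∫⁻ t, f t * g (x - t) = (∫⁻ t, f t) * ∫⁻ t, g t := by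
  rw [lintegral_lintegral_swap]
  · calc _ = ∫⁻ t, f t * ∫⁻ x, g x := by
          refine lintegral_congr fun t => ?_
          rw [lintegral_const_mul'', lintegral_sub_right_eq_self g t]
          exact hg.comp_quasiMeasurePreserving
            (measurePreserving_sub_right (volume : Measure ℝ) t).quasiMeasurePreserving
      _ = _ := lintegral_mul_const'' _ hf
  · have h1 : AEMeasurable (fun p : ℝ × ℝ => f p.2) (volume.prod volume) := hf.comp_snd
    have h2 : AEMeasurable (fun p : ℝ × ℝ => g (p.1 - p.2)) (volume.prod volume) :=
      hg.comp_quasiMeasurePreserving (quasiMeasurePreserving_sub _ _)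
    exact h1.mul h2

/-- Cauchy-Schwarz in t, with the quotient of the weights as one factor, followed by Tonelli for the
convolution of the two squared functions. -/
lemma lintegral_wt_conv_le {b : ℝ} (hb : 0 ≤ b) (n : ℕ) {f g : ℝ → ℝ≥0∞}
    (hf : AEMeasurable f volume) (hg : AEMeasurable g volume) :
    ∫⁻ x, (ENNReal.ofReal (wt b n x) * ∫⁻ t, f t * g (x - t)) ^ 2 ≤
      wtConst n * ((∫⁻ t, (ENNReal.ofReal (wt b n t) * f t) ^ 2) *
        ∫⁻ t, (ENNReal.ofReal (wt b n t) * g t) ^ 2) := by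
  have hW : Measurable fun t => ENNReal.ofReal (wt b n t) :=
    (continuous_wt b n).measurable.ennreal_ofReal
  have hF : AEMeasurable (fun t => (ENNReal.ofReal (wt b n t) * f t) ^ 2) volume :=
    (hW.aemeasurable.mul hf).pow_const 2
  have hG : AEMeasurable (fun t => (ENNReal.ofReal (wt b n t) * g t) ^ 2) volume :=
    (hW.aemeasurable.mul hg).pow_const 2
  calc _ ≤ ∫⁻ x, wtConst n * ∫⁻ t, (ENNReal.ofReal (wt b n t) * f t) ^ 2 *
        (ENNReal.ofReal (wt b n (x - t)) * g (x - t)) ^ 2 := by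
        refine lintegral_mono fun x => ?_
        rw [← lintegral_const_mul' _ _ ENNReal.ofReal_ne_top]
        have e : ∀ t, ENNReal.ofReal (wt b n x) * (f t * g (x - t)) =
            ENNReal.ofReal (wt b n x * ((wt b n t)⁻¹ * (wt b n (x - t))⁻¹)) *
            ((ENNReal.ofReal (wt b n t) * f t) * (ENNReal.ofReal (wt b n (x - t)) * g (x - t))) := by
          intro t
          have h1 := wt_pos b n x
          have h2 := wt_pos b n t
          have h3 := wt_pos b n (x - t)
          have : ENNReal.ofReal (wt b n x * ((wt b n t)⁻¹ * (wt b n (x - t))⁻¹)) *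
            (ENNReal.ofReal (wt b n t) * ENNReal.ofReal (wt b n (x - t))) =
              ENNReal.ofReal (wt b n x) := by
            rw [← ENNReal.ofReal_mul h2.le, ← ENNReal.ofReal_mul (by positivity)]
            congr 1
            field_simp
          rw [← this]
          ring
        simp_rw [e]
        refine (lintegral_mul_sq_le ?_ ?_).trans ?_
        · have := continuous_wt b n
          have : Measurable (wt b n) := this.measurable
          have : Measurable (fun t => wt b n x * ((wt b n t)⁻¹ * (wt b n (x - t))⁻¹)) := by
            fun_prop
          exact this.ennreal_ofReal.aemeasurable
        · exact (hW.aemeasurable.mul hf).mul (aemeasurable_comp_sub (hW.aemeasurable.mul hg) x)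
        · gcongr
          · exact lintegral_wt_subconvolutive hb n x
          · rw [mul_pow]
    _ ≤ wtConst n * ∫⁻ x, ∫⁻ t, (ENNReal.ofReal (wt b n t) * f t) ^ 2 *
        (ENNReal.ofReal (wt b n (x - t)) * g (x - t)) ^ 2 := by
        apply le_of_eq
        apply lintegral_const_mul''
        have h1 : AEMeasurable (fun p : ℝ × ℝ => (ENNReal.ofReal (wt b n p.2) * f p.2) ^ 2)
          (volume.prod volume) := hF.comp_snd
        have h2 : AEMeasurable (fun p : ℝ × ℝ => (ENNReal.ofReal (wt b n (p.1 - p.2)) *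
          g (p.1 - p.2)) ^ 2) (volume.prod volume) :=
          hG.comp_quasiMeasurePreserving (quasiMeasurePreserving_sub _ _)
        exact (h1.mul h2).lintegral_prod_right'
    _ = _ := by rw [lintegral_conv_mul_right hF hG]

lemma aestronglyMeasurable_cv {u v : ℝ → ℂ} (hu : AEStronglyMeasurable u volume)
    (hv : AEStronglyMeasurable v volume) : AEStronglyMeasurable (cv u v) volume := by
  have h1 : AEStronglyMeasurable (fun p : ℝ × ℝ => u p.2) (volume.prod volume) := hu.comp_snd
  have h2 : AEStronglyMeasurable (fun p : ℝ × ℝ => v (p.1 - p.2)) (volume.prod volume) :=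
    hv.comp_quasiMeasurePreserving (quasiMeasurePreserving_sub _ _)
  exact (h1.mul h2).integral_prod_right'

lemma enorm_cv_le (u v : ℝ → ℂ) (x : ℝ) : ‖cv u v x‖ₑ ≤ ∫⁻ t, ‖u t‖ₑ * ‖v (x - t)‖ₑ := by
  refine (enorm_integral_le_lintegral_enorm _).trans (le_of_eq ?_)
  simp

/-- For `n ≥ 1` the weighted space `InA b n` is closed under convolution. -/
lemma InA.cv {b : ℝ} (hb : 0 ≤ b) {n : ℕ} (hn : 1 ≤ n) {u v : ℝ → ℂ} (hu : InA b n u)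
    (hv : InA b n v) : InA b n (cv u v) := by
  refine inA_iff.2 ⟨aestronglyMeasurable_cv hu.aestronglyMeasurable hv.aestronglyMeasurable, ?_⟩
  have h := lintegral_wt_conv_le hb n hu.aestronglyMeasurable.enorm hv.aestronglyMeasurable.enorm
  refine lt_of_le_of_lt ?_ (h.trans_lt (ENNReal.mul_lt_top (wtConst_lt_top hn)
    (ENNReal.mul_lt_top (inA_iff.1 hu).2 (inA_iff.1 hv).2)))
  refine lintegral_mono fun x => ?_
  gcongr
  exact enorm_cv_le u v x

/-! ### Integrability against smaller exponential weights -/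

lemma integral_exp_neg_mul_abs {c : ℝ} (hc : 0 < c) :
    ∫ t : ℝ, Real.exp (-(c * |t|)) = 2 / c := by
  rw [integral_comp_abs (f := fun t => Real.exp (-(c * t)))]
  have := integral_exp_mul_Ioi (a := -c) (by linarith) 0
  simp only [neg_mul, mul_zero, Real.exp_zero] at this
  rw [this]
  field_simp

lemma integrable_exp_neg_mul_abs {c : ℝ} (hc : 0 < c) :
    Integrable (fun t : ℝ => Real.exp (-(c * |t|))) := by
  -- The integral of a non-integrable function is 0 by convention, whereas the value already
  -- computed is positive.
  by_contra h
  have h1 := integral_undef h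
  rw [integral_exp_neg_mul_abs hc] at h1
  have : 0 < 2 / c := by positivity
  linarith

/-- Cauchy-Schwarz against the square integrable function e^(-(a - c)|t|). -/
lemma InA.integrable_exp {a : ℝ} {m : ℕ} {u : ℝ → ℂ} (hu : InA a m u) {c : ℝ} (hc : c < a) :
    Integrable (fun t => Real.exp (c * |t|) • u t) := by
  have h0 : InA a 0 u := hu.of_le le_rfl (Nat.zero_le _)
  have h1 : MemLp (fun t : ℝ => Real.exp (-((a - c) * |t|))) 2 volume := by
    rw [memLp_two_iff_integrable_sq_norm (by fun_prop)]
    refine (integrable_exp_neg_mul_abs (c := 2 * (a - c)) (by linarith)).congr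
      (Filter.Eventually.of_forall fun t => ?_)
    simp only [Real.norm_eq_abs, Real.abs_exp, ← Real.exp_nat_mul]
    congr 1
    push_cast
    ring
  have h2 := memLp_one_iff_integrable.1 (MemLp.smul h0 h1 (r := 1))
  refine h2.congr (Filter.Eventually.of_forall fun t => ?_)
  simp only [Pi.smul_apply', wt, pow_zero, mul_one, smul_smul, ← Real.exp_add]
  ring_nf

lemma InA.integrable {b : ℝ} (hb : 0 < b) {n : ℕ} {u : ℝ → ℂ} (hu : InA b n u) :
    Integrable u := by
  simpa using hu.integrable_exp hb

end

/-! ### The convolution algebra and dyadic dilations. -/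

section

/-- Fubini needs |u| * (|v| * |w|) to converge at the given point. It does, because |v| * |w| is
again in the weighted class and hence in L². Associativity thus holds at every point, not only
almost everywhere. -/
lemma cv_assoc {b : ℝ} (hb : 0 ≤ b) {n : ℕ} (hn : 1 ≤ n) {u v w : ℝ → ℂ} (hu : InA b n u)
    (hv : InA b n v) (hw : InA b n w) : cv (cv u v) w = cv u (cv v w) := by
  ext x
  have hu2 := hu.memLp hb
  have hv2 := hv.memLp hb
  have hw2 := hw.memLp hb
  simp only [cv_eq_convolution]
  refine convolution_assoc (ContinuousLinearMap.mul ℝ ℂ) (ContinuousLinearMap.mul ℝ ℂ)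
    (ContinuousLinearMap.mul ℝ ℂ) (ContinuousLinearMap.mul ℝ ℂ) (fun a b c => by simp [mul_assoc])
    hu.aestronglyMeasurable hv.aestronglyMeasurable hw.aestronglyMeasurable
    (Filter.Eventually.of_forall fun y => integrable_mul_sub hu2 hv2 y)
    (Filter.Eventually.of_forall fun y => ?_) ?_
  · exact MemLp.integrable_mul (p := 2) (q := 2) hv2.norm (MemLp.comp_sub_left hw2.norm y)
  · refine MemLp.integrable_mul (p := 2) (q := 2) hu2.norm (MemLp.comp_sub_left (u := fun y => convolution
      (fun t => ‖v t‖) (fun t => ‖w t‖) (ContinuousLinearMap.mul ℝ ℝ) volume y) ?_ x)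
    have h := ((InA.cv hb hn hv.norm hw.norm).memLp hb).re
    refine MemLp.ae_eq (Filter.Eventually.of_forall fun y => ?_) h
    simp only [cv, convolution, ContinuousLinearMap.mul_apply']
    simp_rw [← Complex.ofReal_mul]
    rw [integral_complex_ofReal]
    simp

lemma cv_add_left {u v w : ℝ → ℂ} (hu : MemLp u 2 volume) (hv : MemLp v 2 volume)
    (hw : MemLp w 2 volume) : cv (u + v) w = cv u w + cv v w := by
  ext x
  simp only [cv, Pi.add_apply, add_mul]
  exact integral_add (integrable_mul_sub hu hw x) (integrable_mul_sub hv hw x)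

lemma cv_smul_left (c : ℂ) (u v : ℝ → ℂ) : cv (c • u) v = c • cv u v := by
  ext x
  simp only [cv, Pi.smul_apply, smul_eq_mul, mul_assoc]
  exact integral_const_mul _ _

lemma cv_smul_right (c : ℂ) (u v : ℝ → ℂ) : cv u (c • v) = c • cv u v := by
  rw [cv_comm, cv_smul_left, cv_comm]

/-- The weighted space `InA b n` as a subspace. -/
def subA (b : ℝ) (n : ℕ) : Submodule ℂ (ℝ → ℂ) where
  carrier := {u | InA b n u}
  add_mem' := InA.add
  zero_mem' := inA_zero b n
  smul_mem' c _ h := InA.const_smul h c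

/-- The convolution algebra of all functions in the weighted space `InA b n`, for `b > 0` and
`n ≥ 1`. -/
def AlgA (b : ℝ) (n : ℕ) (_ : 0 < b) (_ : 1 ≤ n) : Type := subA b n

namespace AlgA

variable {b : ℝ} {n : ℕ} {hb : 0 < b} {hn : 1 ≤ n}

instance : AddCommGroup (AlgA b n hb hn) := inferInstanceAs (AddCommGroup (subA b n))

instance : Module ℂ (AlgA b n hb hn) := inferInstanceAs (Module ℂ (subA b n))

/-- The underlying function. -/
def fn (u : AlgA b n hb hn) : ℝ → ℂ := Subtype.val u

lemma inA (u : AlgA b n hb hn) : InA b n u.fn := Subtype.property u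

/-- A function of the space as an element of the algebra. -/
def mk (u : ℝ → ℂ) (hu : InA b n u) : AlgA b n hb hn := ⟨u, hu⟩

lemma ext {u v : AlgA b n hb hn} (h : u.fn = v.fn) : u = v := Subtype.ext h

@[simp] lemma fn_add (u v : AlgA b n hb hn) : (u + v).fn = u.fn + v.fn := rfl
@[simp] lemma fn_sub (u v : AlgA b n hb hn) : (u - v).fn = u.fn - v.fn := rfl
@[simp] lemma fn_neg (u : AlgA b n hb hn) : (-u).fn = -u.fn := rfl
@[simp] lemma fn_zero : (0 : AlgA b n hb hn).fn = 0 := rfl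
@[simp] lemma fn_smul (c : ℂ) (u : AlgA b n hb hn) : (c • u).fn = c • u.fn := rfl

lemma memLp (u : AlgA b n hb hn) : MemLp u.fn 2 volume := u.inA.memLp hb.le

lemma integrable (u : AlgA b n hb hn) : Integrable u.fn := u.inA.integrable hb

instance : Mul (AlgA b n hb hn) := ⟨fun u v => ⟨cv u.fn v.fn, InA.cv hb.le hn u.inA v.inA⟩⟩

@[simp] lemma fn_mul (u v : AlgA b n hb hn) : (u * v).fn = cv u.fn v.fn := rfl

/-- The elements are functions, not classes modulo null sets; the ring axioms hold pointwise because
convolutions of L² functions converge at every point. -/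
instance : NonUnitalCommRing (AlgA b n hb hn) where
  mul_comm _ _ := ext (cv_comm _ _)
  mul_assoc u v w := ext (cv_assoc hb.le hn u.inA v.inA w.inA)
  left_distrib u v w := ext (by
    rw [fn_mul, cv_comm, fn_add, cv_add_left v.memLp w.memLp u.memLp, fn_add, fn_mul, fn_mul,
      cv_comm u.fn, cv_comm u.fn])
  right_distrib u v w := ext (cv_add_left u.memLp v.memLp w.memLp)
  zero_mul _ := ext (by ext x; simp [cv])
  mul_zero _ := ext (by ext x; simp [cv])

instance : IsScalarTower ℂ (AlgA b n hb hn) (AlgA b n hb hn) :=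
  ⟨fun c _ _ => ext (cv_smul_left c _ _)⟩

instance : SMulCommClass ℂ (AlgA b n hb hn) (AlgA b n hb hn) :=
  ⟨fun c _ _ => ext (cv_smul_right c _ _).symm⟩

lemma fn_sum {ι : Type*} (s : Finset ι) (u : ι → AlgA b n hb hn) :
    (∑ k ∈ s, u k).fn = ∑ k ∈ s, (u k).fn :=
  map_sum (subA b n).subtype.toAddMonoidHom u s

end AlgA

/-! ### Dyadic dilations -/

/-- The dilation `2^j u(2^j x)`. -/
def dil (j : ℕ) (u : ℝ → ℂ) : ℝ → ℂ := fun x => (2 : ℂ) ^ j * u (2 ^ j * x)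

lemma dil_zero (u : ℝ → ℂ) : dil 0 u = u := by ext x; simp [dil]

lemma dil_add (j k : ℕ) (u : ℝ → ℂ) : dil (j + k) u = dil j (dil k u) := by
  ext x; simp only [dil, pow_add]; ring_nf

lemma cv_dil (j : ℕ) (u v : ℝ → ℂ) : cv (dil j u) (dil j v) = dil j (cv u v) := by
  ext x
  simp only [cv, dil]
  have h := Measure.integral_comp_mul_left (fun t => u t * v (2 ^ j * x - t)) ((2 : ℝ) ^ j)
  have h2 : ∀ t, (2 : ℂ) ^ j * u (2 ^ j * t) * ((2 : ℂ) ^ j * v (2 ^ j * (x - t))) =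
      (2 : ℂ) ^ j * 2 ^ j * (u (2 ^ j * t) * v (2 ^ j * x - 2 ^ j * t)) := by
    intro t; rw [mul_sub]; ring
  simp_rw [h2]
  rw [integral_const_mul, h, abs_of_pos (by positivity), Complex.real_smul]
  push_cast
  field_simp

lemma integral_mul_dil (j : ℕ) (f u : ℝ → ℂ) :
    ∫ x, f x * dil j u x = ∫ x, f ((2 ^ j)⁻¹ * x) * u x := by
  have h := Measure.integral_comp_mul_left (fun t => f ((2 ^ j)⁻¹ * t) * u t) ((2 : ℝ) ^ j)
  have h2 : ∀ x, f x * dil j u x =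
      2 ^ j * (f ((2 ^ j)⁻¹ * (2 ^ j * x)) * u (2 ^ j * x)) := by
    intro t; rw [inv_mul_cancel_left₀ (by positivity)]; simp only [dil]; ring
  simp_rw [h2]
  rw [integral_const_mul, h, abs_of_pos (by positivity), Complex.real_smul]
  push_cast
  field_simp

lemma aestronglyMeasurable_dil {u : ℝ → ℂ} (hu : AEStronglyMeasurable u volume) (j : ℕ) :
    AEStronglyMeasurable (dil j u) volume := by
  have h : AEStronglyMeasurable (fun x : ℝ => u ((2 : ℝ) ^ j • x)) volume :=
    hu.comp_quasiMeasurePreserving (Measure.quasiMeasurePreserving_smul volume (by positivity))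
  exact h.const_mul _

lemma lintegral_comp_mul_left {a : ℝ} (ha : 0 < a) (f : ℝ → ℝ≥0∞) :
    ∫⁻ x, f (a * x) = ENNReal.ofReal a⁻¹ * ∫⁻ x, f x := by
  have h := lintegral_map_equiv (μ := volume) f (Homeomorph.mulLeft₀ a ha.ne').toMeasurableEquiv
  have h2 : Measure.map (Homeomorph.mulLeft₀ a ha.ne').toMeasurableEquiv volume =
      ENNReal.ofReal |a⁻¹| • volume := Real.map_volume_mul_left ha.ne'
  rw [h2, lintegral_smul_measure, abs_of_pos (inv_pos.2 ha)] at h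
  exact h.symm

lemma lintegral_enorm_dil_sq (j : ℕ) (u : ℝ → ℂ) (c : ℝ → ℝ≥0∞) :
    ∫⁻ x, (c (2 ^ j * x) * ‖dil j u x‖ₑ) ^ 2 = 2 ^ j * ∫⁻ x, (c x * ‖u x‖ₑ) ^ 2 := by
  have h := lintegral_comp_mul_left (a := 2 ^ j) (by positivity) fun x => (c x * ‖u x‖ₑ) ^ 2
  have e : ∀ x, (c (2 ^ j * x) * ‖dil j u x‖ₑ) ^ 2 =
      (2 ^ j * 2 ^ j) * (c (2 ^ j * x) * ‖u (2 ^ j * x)‖ₑ) ^ 2 := by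
    intro x
    have : ‖(2 : ℂ) ^ j‖ₑ = 2 ^ j := by
      rw [← ofReal_norm]; simp [ENNReal.ofReal_pow]
    simp only [dil, enorm_mul, this]
    ring
  simp_rw [e]
  rw [lintegral_const_mul' _ _ (by finiteness), h, ENNReal.ofReal_inv_of_pos (by positivity),
    ENNReal.ofReal_pow (by norm_num), ENNReal.ofReal_ofNat, ← mul_assoc, mul_assoc (2 ^ j),
    ENNReal.mul_inv_cancel (by simp) (by finiteness), mul_one]

lemma InA.dil {b : ℝ} (hb : 0 ≤ b) {n : ℕ} {u : ℝ → ℂ} (hu : InA b n u) (j : ℕ) :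
    InA b n (dil j u) := by
  refine inA_iff.2 ⟨aestronglyMeasurable_dil hu.aestronglyMeasurable j, ?_⟩
  have h := lintegral_enorm_dil_sq j u fun t => ENNReal.ofReal (wt b n t)
  refine lt_of_le_of_lt (lintegral_mono fun x => ?_) (h.trans_lt
    (ENNReal.mul_lt_top (by simp) (inA_iff.1 hu).2))
  have : |x| ≤ |2 ^ j * x| := by
    rw [abs_mul, abs_of_pos (by positivity : (0 : ℝ) < 2 ^ j)]
    exact le_mul_of_one_le_left (abs_nonneg x) (one_le_pow₀ (by norm_num))
  have := wt_mono_abs hb n this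
  gcongr

end

/-! ### Derivatives encoded by primitives. -/

section

/-! ### Primitives -/

/-- The primitive `∫_{-∞}^x v`. -/
def prim (v : ℝ → ℂ) (x : ℝ) : ℂ := ∫ t in Set.Iic x, v t

lemma prim_eq_indicator (v : ℝ → ℂ) (x : ℝ) :
    prim v x = ∫ t, (Set.Iic x).indicator v t := (integral_indicator measurableSet_Iic).symm

lemma prim_sub (v : ℝ → ℂ) (x s : ℝ) : prim v (x - s) = ∫ t in Set.Iic x, v (t - s) := by
  rw [prim_eq_indicator, ← integral_indicator measurableSet_Iic,
    ← integral_sub_right_eq_self _ s]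
  congr 1
  ext t
  simp [Set.indicator]

lemma prim_cv {v w : ℝ → ℂ} (hv : Integrable v) (hw : Integrable w) :
    cv (prim v) w = prim (cv v w) := by
  rw [cv_comm, cv_comm v]
  ext x
  simp only [cv, prim_sub]
  simp only [prim]
  have h := (hw.convolution_integrand (ContinuousLinearMap.mul ℝ ℂ) hv).swap
  have h2 : volume.prod (volume.restrict (Set.Iic x)) =
      ((volume : Measure ℝ).prod volume).restrict (Set.univ ×ˢ Set.Iic x) := by
    rw [← Measure.prod_restrict, Measure.restrict_univ]
  simp_rw [← integral_const_mul]
  rw [integral_integral_swap]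
  · rfl
  · rw [h2]
    exact h.integrableOn

lemma cv_prim_comm {u v : ℝ → ℂ} (hu : Integrable u) (hv : Integrable v) :
    cv (prim u) v = cv u (prim v) := by
  rw [prim_cv hu hv, cv_comm u, cv_comm u, prim_cv hv hu]

lemma norm_prim_le {v : ℝ → ℂ} (hv : Integrable v) (x : ℝ) : ‖prim v x‖ ≤ ∫ t, ‖v t‖ :=
  (norm_integral_le_integral_norm _).trans
    (setIntegral_le_integral hv.norm (Filter.Eventually.of_forall fun _ => norm_nonneg _))

lemma continuous_prim {v : ℝ → ℂ} (hv : Integrable v) : Continuous (prim v) := by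
  have h : prim v = fun x => prim v 0 + ∫ t in (0 : ℝ)..x, v t := by
    ext x
    rw [← intervalIntegral.integral_Iic_sub_Iic hv.integrableOn hv.integrableOn]
    simp [prim]
  rw [h]
  exact continuous_const.add (hv.continuous_primitive 0)

lemma prim_eq_neg {v : ℝ → ℂ} (hv : Integrable v) (h0 : ∫ t, v t = 0) (x : ℝ) :
    prim v x = -∫ t in Set.Ioi x, v t := by
  have := integral_add_compl (measurableSet_Iic (a := x)) hv
  rw [Set.compl_Iic, h0] at this
  exact eq_neg_of_add_eq_zero_left this

/-- Integration by parts as Fubini on the half-plane t ≤ x. The boundary term is (∫ e)(∫ v), which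
the zero mean of v removes. -/
lemma integral_mul_prim {e v : ℝ → ℂ} (he : Integrable e) (hv : Integrable v)
    (h0 : ∫ t, v t = 0) : ∫ x, e x * prim v x = -∫ x, prim e x * v x := by
  have key : ∫ x, ∫ t, {p : ℝ × ℝ | p.2 ≤ p.1}.indicator (fun p => e p.1 * v p.2) (x, t) =
      ∫ t, ∫ x, {p : ℝ × ℝ | p.2 ≤ p.1}.indicator (fun p => e p.1 * v p.2) (x, t) := by
    apply integral_integral_swap
    exact (he.mul_prod hv).indicator (measurableSet_le measurable_snd measurable_fst)
  have h1 : ∀ x, ∫ t, {p : ℝ × ℝ | p.2 ≤ p.1}.indicator (fun p => e p.1 * v p.2) (x, t) =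
      e x * prim v x := by
    intro x
    rw [prim_eq_indicator, ← integral_const_mul]
    congr 1; ext t
    simp [Set.indicator]
  have h2 : ∀ t, ∫ x, {p : ℝ × ℝ | p.2 ≤ p.1}.indicator (fun p => e p.1 * v p.2) (x, t) =
      ((∫ x, e x) - prim e t) * v t := by
    intro t
    have h3 := integral_add_compl (measurableSet_Iic (a := t)) he
    have h4 : (∫ x, e x) - prim e t = ∫ x in Set.Ici t, e x := by
      rw [← h3, integral_Ici_eq_integral_Ioi, Set.compl_Iic, prim]; ring
    rw [h4, ← integral_indicator measurableSet_Ici, ← integral_mul_const]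
    congr 1; ext x
    simp [Set.indicator]
  simp_rw [h1, h2, sub_mul] at key
  rw [key, integral_sub (hv.const_mul _), integral_const_mul, h0, mul_zero, zero_sub]
  refine hv.bdd_mul (continuous_prim he).aestronglyMeasurable
    (Filter.Eventually.of_forall fun x => norm_prim_le he x)

/-- `v` is the derivative of the integrable function `u`, in the sense that `u` is almost everywhere
a primitive of the integrable function `v`. -/
structure Prim (u v : ℝ → ℂ) : Prop where
  left : Integrable u
  right : Integrable v
  zero : ∫ t, v t = 0
  ae_eq : u =ᵐ[volume] prim v

lemma Prim.add {u v u' v' : ℝ → ℂ} (h : Prim u v) (h' : Prim u' v') : Prim (u + u') (v + v') where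
  left := h.left.add h'.left
  right := h.right.add h'.right
  zero := by
    have := integral_add h.right h'.right
    simp only [h.zero, h'.zero, add_zero] at this
    simpa using this
  ae_eq := by
    filter_upwards [h.ae_eq, h'.ae_eq] with x h1 h2
    rw [Pi.add_apply, h1, h2, prim, prim, prim]
    exact (integral_add h.right.integrableOn h'.right.integrableOn).symm

lemma Prim.smul {u v : ℝ → ℂ} (h : Prim u v) (c : ℂ) : Prim (c • u) (c • v) where
  left := h.left.smul c
  right := h.right.smul c
  zero := by simp [integral_const_mul, h.zero]
  ae_eq := by
    filter_upwards [h.ae_eq] with x h1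
    simp only [Pi.smul_apply, smul_eq_mul, prim, h1]
    exact (integral_const_mul _ _).symm

lemma integrable_cv {u v : ℝ → ℂ} (hu : Integrable u) (hv : Integrable v) :
    Integrable (cv u v) := hu.integrable_convolution (ContinuousLinearMap.mul ℝ ℂ) hv

lemma integral_cv {u v : ℝ → ℂ} (hu : Integrable u) (hv : Integrable v) :
    ∫ x, cv u v x = (∫ x, u x) * ∫ x, v x :=
  integral_convolution (ContinuousLinearMap.mul ℝ ℂ) hu hv

lemma Prim.cv {u v w : ℝ → ℂ} (h : Prim u v) (hw : Integrable w) : Prim (cv u w) (cv v w) where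
  left := integrable_cv h.left hw
  right := integrable_cv h.right hw
  zero := by rw [integral_cv h.right hw, h.zero, zero_mul]
  ae_eq := by
    rw [cv_congr h.ae_eq (Filter.EventuallyEq.refl _ w), prim_cv h.right hw]

/-- Either side is the derivative of u * v. No sign appears, in contrast to integration by parts. -/
lemma Prim.cv_swap {u u' v v' : ℝ → ℂ} (h : Prim u u') (h' : Prim v v') :
    ExpBesov.cv u v' = ExpBesov.cv u' v := by
  rw [cv_congr h.ae_eq (Filter.EventuallyEq.refl _ v'), cv_prim_comm h.right h'.right,
    cv_congr (Filter.EventuallyEq.refl _ u') h'.ae_eq]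

lemma integrable_dil {u : ℝ → ℂ} (hu : Integrable u) (j : ℕ) : Integrable (dil j u) :=
  (hu.comp_mul_left' (by positivity)).const_mul _

lemma integral_dil (j : ℕ) (u : ℝ → ℂ) : ∫ x, dil j u x = ∫ x, u x := by
  simpa using integral_mul_dil j (fun _ => 1) u

lemma Prim.dil {u v : ℝ → ℂ} (h : Prim u v) (j : ℕ) : Prim (dil j u) ((2 : ℂ) ^ j • dil j v) where
  left := integrable_dil h.left j
  right := (integrable_dil h.right j).smul _
  zero := by
    simp [integral_const_mul, integral_dil, h.zero]
  ae_eq := by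
    have h1 := (Measure.quasiMeasurePreserving_smul (r := (2 : ℝ) ^ j) (volume : Measure ℝ)
      (by positivity)).ae_eq_comp h.ae_eq
    filter_upwards [h1] with x hx
    simp only [Function.comp, smul_eq_mul] at hx
    have := integral_mul_dil j ((Set.Iic x).indicator fun _ => 1) v
    have e : ∀ y, (Set.Iic x).indicator (fun _ => (1 : ℂ)) ((2 ^ j)⁻¹ * y) * v y =
        (Set.Iic (2 ^ j * x)).indicator v y := by
      intro y
      have : (2 ^ j)⁻¹ * y ≤ x ↔ y ≤ 2 ^ j * x := inv_mul_le_iff₀ (by positivity)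
      by_cases hy : y ≤ 2 ^ j * x <;> simp [Set.indicator, this, hy]
    simp_rw [e] at this
    rw [← prim_eq_indicator, ← hx] at this
    rw [prim, ← integral_indicator measurableSet_Iic]
    simp only [ExpBesov.dil]
    rw [← this, ← integral_const_mul]
    congr 1; ext y
    by_cases hy : y ≤ x <;> simp [Set.indicator, hy, ExpBesov.dil]

/-- Reflection turns a primitive from the left into one from the right; the zero mean identifies the
two up to sign. -/
lemma Prim.reflect {u v : ℝ → ℂ} (h : Prim u v) (x : ℝ) :
    Prim (fun y => u (x - y)) (fun y => -v (x - y)) where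
  left := h.left.comp_sub_left x
  right := (h.right.comp_sub_left x).neg
  zero := by
    rw [integral_neg, integral_sub_left_eq_self v volume x, h.zero, neg_zero]
  ae_eq := by
    have h1 := (Measure.measurePreserving_sub_left (volume : Measure ℝ)
      x).quasiMeasurePreserving.ae_eq_comp h.ae_eq
    filter_upwards [h1] with y hy
    simp only [Function.comp] at hy
    rw [hy, prim_eq_neg h.right h.zero, prim, integral_neg, ← integral_Ici_eq_integral_Ioi,
      ← integral_indicator measurableSet_Ici, ← integral_indicator measurableSet_Iic,
      ← integral_sub_left_eq_self _ volume x]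
    congr 2; ext t
    have : x ≤ x - t + y ↔ t ≤ y := by constructor <;> intro h <;> linarith
    simp [Set.indicator, this]

lemma Prim.integral_deriv_smul {u v : ℝ → ℂ} (h : Prim u v) {η : ℝ → ℝ} (hη : ContDiff ℝ ∞ η)
    (hc : HasCompactSupport η) : ∫ x, deriv η x • u x = -∫ x, η x • v x := by
  have hd : Continuous (deriv η) := hη.continuous_deriv (by simp)
  have he : Integrable (fun x : ℝ => ((deriv η x : ℝ) : ℂ)) :=
    (hd.integrable_of_hasCompactSupport hc.deriv).ofReal
  have h1 := integral_mul_prim he h.right h.zero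
  have h2 : ∀ x, prim (fun x => ((deriv η x : ℝ) : ℂ)) x = η x := by
    intro x
    rw [prim, integral_complex_ofReal]
    congr 1
    exact HasCompactSupport.integral_Iic_deriv_eq (hη.of_le (by simp)) hc x
  simp_rw [h2] at h1
  calc ∫ x, deriv η x • u x = ∫ x, ((deriv η x : ℝ) : ℂ) * prim v x := by
        apply integral_congr_ae
        filter_upwards [h.ae_eq] with x hx
        rw [hx, Complex.real_smul]
    _ = _ := by rw [h1]; simp [Complex.real_smul]

end

/-! ### From weak derivatives to primitives; decay, moments and antiderivatives. -/

section

/-- `v` is the weak derivative of `u` on the line. -/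
def WeakD (u v : ℝ → ℂ) : Prop := ∀ η : ℝ → ℝ, ContDiff ℝ ∞ η → HasCompactSupport η →
  ∫ x, deriv η x • u x = -∫ x, η x • v x

lemma Prim.weakD {u v : ℝ → ℂ} (h : Prim u v) : WeakD u v :=
  fun _ h1 h2 => h.integral_deriv_smul h1 h2

/-- Frees the test function from compact support: multiply f by the cutoff χ(x/(N + 1)) and use
dominated convergence. The term in which the cutoff is differentiated carries the factor 1/(N + 1).
-/
lemma WeakD.integral_deriv_smul {u v : ℝ → ℂ} (h : WeakD u v) {f : ℝ → ℝ} (hf : ContDiff ℝ ∞ f)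
    (h1 : Integrable fun x => f x • u x) (h2 : Integrable fun x => deriv f x • u x)
    (h3 : Integrable fun x => f x • v x) : ∫ x, deriv f x • u x = -∫ x, f x • v x := by
  let χ : ContDiffBump (0 : ℝ) := ⟨1, 2, by norm_num, by norm_num⟩
  have hχ : ContDiff ℝ ∞ χ := χ.contDiff
  have hχd : Continuous (deriv χ) := hχ.continuous_deriv (by simp)
  obtain ⟨C, hC⟩ := hχd.bounded_above_of_compact_support χ.hasCompactSupport.deriv
  have hC0 : 0 ≤ C := (norm_nonneg _).trans (hC 0)
  let η : ℕ → ℝ → ℝ := fun N x => χ ((N + 1 : ℝ)⁻¹ * x) * f x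
  have hηd : ∀ N x, deriv (η N) x =
      (N + 1 : ℝ)⁻¹ * deriv χ ((N + 1 : ℝ)⁻¹ * x) * f x + χ ((N + 1 : ℝ)⁻¹ * x) * deriv f x := by
    intro N x
    have e1 : HasDerivAt (fun y => χ ((N + 1 : ℝ)⁻¹ * y))
        (deriv χ ((N + 1 : ℝ)⁻¹ * x) * ((N + 1 : ℝ)⁻¹ * 1)) x :=
      ((hχ.differentiable (by simp)) _).hasDerivAt.comp x ((hasDerivAt_id x).const_mul _)
    have e2 : HasDerivAt f (deriv f x) x := ((hf.differentiable (by simp)) _).hasDerivAt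
    have e3 : HasDerivAt (η N) _ x := e1.mul e2
    rw [e3.deriv]
    ring
  have key : ∀ N, ∫ x, deriv (η N) x • u x = -∫ x, η N x • v x := by
    intro N
    apply h
    · exact (hχ.comp (contDiff_const.mul contDiff_id)).mul hf
    · apply HasCompactSupport.mul_right
      exact χ.hasCompactSupport.comp_homeomorph
        (Homeomorph.mulLeft₀ ((N + 1 : ℝ)⁻¹) (by positivity))
  have hlim : ∀ x : ℝ, Tendsto (fun N : ℕ => (N + 1 : ℝ)⁻¹ * x) atTop (𝓝 0) := by
    intro x
    have := (tendsto_one_div_add_atTop_nhds_zero_nat (𝕜 := ℝ)).mul_const x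
    simpa using this
  have hlim1 : ∀ x : ℝ, Tendsto (fun N : ℕ => χ ((N + 1 : ℝ)⁻¹ * x)) atTop (𝓝 1) := by
    intro x
    have := (hχ.continuous.tendsto 0).comp (hlim x)
    rwa [χ.one_of_mem_closedBall (by simp [χ])] at this
  have hlim0 : Tendsto (fun N : ℕ => (N + 1 : ℝ)⁻¹) atTop (𝓝 0) := by
    simpa using tendsto_one_div_add_atTop_nhds_zero_nat (𝕜 := ℝ)
  have hN1 : ∀ N : ℕ, (N + 1 : ℝ)⁻¹ ≤ 1 := fun N =>
    inv_le_one_of_one_le₀ (by linarith [(Nat.cast_nonneg N : (0 : ℝ) ≤ N)])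
  have L1 : Tendsto (fun N => ∫ x, deriv (η N) x • u x) atTop (𝓝 (∫ x, deriv f x • u x)) := by
    have heq : ∀ N x, deriv (η N) x • u x =
        ((N + 1 : ℝ)⁻¹ * deriv χ ((N + 1 : ℝ)⁻¹ * x)) • (f x • u x) +
          χ ((N + 1 : ℝ)⁻¹ * x) • (deriv f x • u x) := by
      intro N x; rw [hηd, add_smul, smul_smul, smul_smul]
    refine tendsto_integral_of_dominated_convergence
      (fun x => C * ‖f x • u x‖ + ‖deriv f x • u x‖) (fun N => ?_)
      ((h1.norm.const_mul C).add h2.norm) (fun N => ?_) ?_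
    · simp_rw [heq]
      have m1 : ∀ {g : ℝ → ℝ} {F : ℝ → ℂ}, AEStronglyMeasurable g volume →
        Integrable F → AEStronglyMeasurable (fun x => g x • F x) volume := fun hg hF => hg.smul hF.1
      refine (m1 ?_ h1).add (m1 ?_ h2)
      · exact Continuous.aestronglyMeasurable (by fun_prop)
      · exact (hχ.continuous.comp (by fun_prop)).aestronglyMeasurable
    · refine Eventually.of_forall fun x => ?_
      rw [heq]
      refine (norm_add_le _ _).trans ?_
      rw [norm_smul, norm_smul (χ _)]
      gcongr
      · rw [norm_mul, Real.norm_of_nonneg (by positivity)]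
        calc _ ≤ 1 * C := by
              gcongr
              · exact hN1 N
              · exact hC _
          _ = C := one_mul C
      · refine mul_le_of_le_one_left (norm_nonneg _) ?_
        rw [Real.norm_of_nonneg χ.nonneg]
        exact χ.le_one
    · refine Eventually.of_forall fun x => ?_
      simp_rw [heq]
      have a1 : Tendsto (fun N : ℕ => (N + 1 : ℝ)⁻¹ * deriv χ ((N + 1 : ℝ)⁻¹ * x)) atTop (𝓝 0) := by
        simpa using hlim0.mul ((hχd.tendsto 0).comp (hlim x))
      have := (a1.smul_const (f x • u x)).add ((hlim1 x).smul_const (deriv f x • u x))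
      simpa using this
  have L2 : Tendsto (fun N => ∫ x, η N x • v x) atTop (𝓝 (∫ x, f x • v x)) := by
    have heq : ∀ N x, η N x • v x = χ ((N + 1 : ℝ)⁻¹ * x) • (f x • v x) := by
      intro N x; rw [smul_smul]
    simp_rw [heq]
    refine tendsto_integral_of_dominated_convergence
      (fun x => ‖f x • v x‖) (fun N => ?_) h3.norm (fun N => ?_) ?_
    · exact AEStronglyMeasurable.smul (hχ.continuous.comp (by fun_prop)).aestronglyMeasurable h3.1
    · refine Eventually.of_forall fun x => ?_
      rw [norm_smul]
      refine mul_le_of_le_one_left (norm_nonneg _) ?_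
      rw [Real.norm_of_nonneg χ.nonneg]
      exact χ.le_one
    · refine Eventually.of_forall fun x => ?_
      simpa using (hlim1 x).smul_const (f x • v x)
  simp_rw [key] at L1
  exact tendsto_nhds_unique L1 L2.neg

/-- The test function 1 gives the zero mean of v. The primitive `Z` of a bump `η`, which is bounded
but need not have compact support, shows that u and the primitive of v have the same integral
against `η`. -/
lemma WeakD.prim {u v : ℝ → ℂ} (h : WeakD u v) (hu : Integrable u) (hv : Integrable v) :
    Prim u v := by
  have h0 : ∫ t, v t = 0 := by
    have := h.integral_deriv_smul (f := fun _ => 1) contDiff_const (by simpa using hu) (by simp)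
      (by simpa using hv)
    simpa using this
  refine ⟨hu, hv, h0, ?_⟩
  have hl : LocallyIntegrable (ExpBesov.prim v) := (continuous_prim hv).locallyIntegrable
  refine ae_eq_of_integral_contDiff_smul_eq hu.locallyIntegrable hl fun η h1 h2 => ?_
  have hηi : Integrable η := h1.continuous.integrable_of_hasCompactSupport h2
  have hηc : Integrable (fun x => (η x : ℂ)) := hηi.ofReal
  let Z : ℝ → ℝ := fun x => ∫ t in Set.Iic x, η t
  have hZ0 : ∀ x, ExpBesov.prim (fun t => (η t : ℂ)) x = Z x := fun x => integral_complex_ofReal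
  have hZd : ∀ x, HasDerivAt Z (η x) x := by
    intro x
    have e : Z = fun x => Z 0 + ∫ t in (0 : ℝ)..x, η t := by
      ext x
      rw [← intervalIntegral.integral_Iic_sub_Iic hηi.integrableOn hηi.integrableOn]
      simp [Z]
    rw [e]
    exact (intervalIntegral.integral_hasDerivAt_right hηi.intervalIntegrable
      h1.continuous.aestronglyMeasurable.stronglyMeasurableAtFilter
      h1.continuous.continuousAt).const_add _
  have hZ' : deriv Z = η := funext fun x => (hZd x).deriv
  have hZs : ContDiff ℝ ∞ Z := by
    rw [contDiff_infty_iff_deriv]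
    exact ⟨fun x => (hZd x).differentiableAt, hZ' ▸ h1⟩
  have hZb : ∀ x, ‖Z x‖ ≤ ∫ t, ‖(η t : ℂ)‖ := by
    intro x
    have := norm_prim_le hηc x
    rwa [hZ0, Complex.norm_real] at this
  have hbdd : ∀ g : ℝ → ℂ, Integrable g → Integrable fun x => Z x • g x := fun g hg =>
    hg.bdd_smul _ hZs.continuous.aestronglyMeasurable (Eventually.of_forall hZb)
  have e1 := h.integral_deriv_smul hZs (hbdd u hu) ?_ (hbdd v hv)
  · rw [hZ'] at e1
    rw [e1]
    have e2 := integral_mul_prim hηc hv h0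
    simp_rw [hZ0] at e2
    simpa [Complex.real_smul] using e2.symm
  · rw [hZ']
    obtain ⟨C, hC⟩ := h1.continuous.bounded_above_of_compact_support h2
    exact hu.bdd_smul _ h1.continuous.aestronglyMeasurable (Eventually.of_forall hC)

/-! ### Exponentially decaying functions, moments and antiderivatives -/

/-- The functions `u` with `e^{a|t|} u ∈ L²` for all `a < b`. -/
def Dec (b : ℝ) (u : ℝ → ℂ) : Prop := ∀ a < b, InA a 0 u

lemma InA.dec {b : ℝ} {n : ℕ} {u : ℝ → ℂ} (hu : InA b n u) : Dec b u :=
  fun _ ha => hu.of_le ha.le (Nat.zero_le _)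

lemma Dec.integrable_exp {b : ℝ} {u : ℝ → ℂ} (hu : Dec b u) {c : ℝ} (hc : c < b) :
    Integrable (fun t => Real.exp (c * |t|) • u t) := by
  obtain ⟨a, h1, h2⟩ := exists_between hc
  exact (hu a h2).integrable_exp h1

lemma Dec.integrable {b : ℝ} (hb : 0 < b) {u : ℝ → ℂ} (hu : Dec b u) : Integrable u := by
  simpa using hu.integrable_exp hb

lemma Dec.integrable_pow {b : ℝ} (hb : 0 < b) {u : ℝ → ℂ} (hu : Dec b u) (m : ℕ) :
    Integrable (fun t => t ^ m • u t) := by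
  have h := hu.integrable_exp (c := b / 2) (by linarith)
  refine (h.norm.const_mul ((m.factorial : ℝ) * ((b / 2) ^ m)⁻¹)).mono'
    ((by fun_prop : Continuous fun t : ℝ => t ^ m).aestronglyMeasurable.smul (hu.integrable hb).1)
    (Eventually.of_forall fun t => ?_)
  rw [norm_smul, norm_smul, ← mul_assoc, Real.norm_of_nonneg (Real.exp_pos _).le, norm_pow,
    Real.norm_eq_abs]
  gcongr
  have := Real.pow_div_factorial_le_exp (b / 2 * |t|) (by positivity) m
  rw [mul_pow, div_le_iff₀ (by positivity)] at this
  rw [mul_assoc, ← div_eq_inv_mul, mul_div_assoc', le_div_iff₀ (by positivity)]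
  linarith

/-- The zero mean permits integrating over whichever half-line from x points away from the origin;
there |t| ≥ |x|, so e^(-a|x|) can be extracted. -/
lemma norm_prim_le_exp {a : ℝ} (ha : 0 ≤ a) {v : ℝ → ℂ} (hv : Integrable v) (h0 : ∫ t, v t = 0)
    (he : Integrable fun t => Real.exp (a * |t|) • v t) (x : ℝ) :
    ‖prim v x‖ ≤ Real.exp (-(a * |x|)) * ∫ t, ‖Real.exp (a * |t|) • v t‖ := by
  have main : ∀ s : Set ℝ, MeasurableSet s → (∀ t ∈ s, |x| ≤ |t|) →
      ‖∫ t in s, v t‖ ≤ Real.exp (-(a * |x|)) * ∫ t, ‖Real.exp (a * |t|) • v t‖ := by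
    intro s hs hx
    refine (norm_integral_le_integral_norm _).trans ?_
    rw [← integral_const_mul]
    refine (setIntegral_mono_on hv.norm.integrableOn (he.norm.const_mul _).integrableOn hs
      fun t ht => ?_).trans (setIntegral_le_integral (he.norm.const_mul _)
        (Eventually.of_forall fun t => by positivity))
    rw [norm_smul, ← mul_assoc, Real.norm_of_nonneg (Real.exp_pos _).le, ← Real.exp_add]
    refine le_mul_of_one_le_left (norm_nonneg _) (Real.one_le_exp ?_)
    nlinarith [hx t ht]
  rcases le_total x 0 with h | h
  · refine main _ measurableSet_Iic fun t ht => ?_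
    rw [abs_of_nonpos h, abs_of_nonpos (le_trans ht h)]
    linarith [Set.mem_Iic.1 ht]
  · rw [prim_eq_neg hv h0, norm_neg]
    refine main _ measurableSet_Ioi fun t ht => ?_
    rw [abs_of_nonneg h, abs_of_nonneg (h.trans (le_of_lt ht))]
    exact le_of_lt ht

lemma Dec.prim {b : ℝ} (hb : 0 < b) {v : ℝ → ℂ} (hv : Dec b v) (h0 : ∫ t, v t = 0) :
    Dec b (prim v) := by
  intro a' ha'
  -- A rate strictly above a' leaves the square integrable factor e^(-(a - a')|t|); the maximum with
  -- 0 also makes a positive.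
  obtain ⟨a, h1, h2⟩ := exists_between (max_lt ha' hb)
  have ha : 0 < a := (le_max_right _ _).trans_lt h1
  have haa : a' < a := (le_max_left _ _).trans_lt h1
  have hvi := hv.integrable hb
  set K := ∫ t, ‖Real.exp (a * |t|) • v t‖
  have hg : MemLp (fun t : ℝ => Real.exp (-((a - a') * |t|))) 2 volume := by
    rw [memLp_two_iff_integrable_sq_norm (by fun_prop)]
    refine (integrable_exp_neg_mul_abs (c := 2 * (a - a')) (by linarith)).congr
      (Eventually.of_forall fun t => ?_)
    simp only [Real.norm_eq_abs, Real.abs_exp, ← Real.exp_nat_mul]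
    congr 1
    push_cast
    ring
  refine MemLp.of_le_mul (c := K) hg
    ((continuous_wt a' 0).smul (continuous_prim hvi)).aestronglyMeasurable
    (Eventually.of_forall fun t => ?_)
  rw [norm_smul, Real.norm_of_nonneg (wt_pos _ _ _).le, Real.norm_of_nonneg (Real.exp_pos _).le]
  have := norm_prim_le_exp ha.le hvi h0 (hv.integrable_exp h2) t
  calc _ ≤ wt a' 0 t * (Real.exp (-(a * |t|)) * K) := by
        gcongr; exact (wt_pos _ _ _).le
    _ = K * (Real.exp (a' * |t|) * Real.exp (-(a * |t|))) := by simp [wt]; ring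
    _ = _ := by rw [← Real.exp_add]; ring_nf

lemma Dec.prim_prim {b : ℝ} (hb : 0 < b) {v : ℝ → ℂ} (hv : Dec b v) (h0 : ∫ t, v t = 0) :
    Prim (ExpBesov.prim v) v :=
  ⟨(hv.prim hb h0).integrable hb, hv.integrable hb, h0, EventuallyEq.refl _ _⟩

/-- Integration by parts against x^(m+1). Hence an antiderivative inherits the vanishing moments,
with one order fewer. -/
lemma Prim.moment {b : ℝ} (hb : 0 < b) {u v : ℝ → ℂ} (h : Prim u v) (hu : Dec b u) (hv : Dec b v)
    (m : ℕ) : ((m : ℝ) + 1) • ∫ x, x ^ m • u x = -∫ x, x ^ (m + 1) • v x := by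
  have hd : deriv (fun x : ℝ => x ^ (m + 1)) = fun x => ((m : ℝ) + 1) * x ^ m := by
    ext x; simp
  have := h.weakD.integral_deriv_smul (f := fun x => x ^ (m + 1)) (by fun_prop)
    (hu.integrable_pow hb _) ?_ (hv.integrable_pow hb _)
  · rw [← this, hd, ← integral_smul]
    simp_rw [smul_smul]
  · rw [hd]
    simp_rw [mul_smul]
    exact (hu.integrable_pow hb m).smul _

/-- A decaying function whose moments of order less than `n` vanish is an `n`-th derivative. -/
lemma Dec.exists_antideriv {b : ℝ} (hb : 0 < b) (n : ℕ) {v : ℝ → ℂ} (hv : Dec b v)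
    (h0 : ∀ s < n, ∫ x, x ^ s • v x = 0) : ∃ V : ℕ → ℝ → ℂ, V n = v ∧
      (∀ s < n, Prim (V s) (V (s + 1))) ∧ Dec b (V 0) := by
  induction n generalizing v with
  | zero => exact ⟨fun _ => v, rfl, by simp, hv⟩
  | succ n ih =>
    have hz : ∫ t, v t = 0 := by simpa using h0 0 (by omega)
    have hp := hv.prim_prim hb hz
    have hd := hv.prim hb hz
    -- The induction continues with the primitive of v, whose moment of order s is a multiple of the
    -- moment of v of order s + 1.
    obtain ⟨V, h1, h2, h3⟩ := ih hd fun s hs => by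
      have := hp.moment hb hd hv s
      rw [h0 (s + 1) (by omega), neg_zero] at this
      exact (smul_eq_zero.1 this).resolve_left (by positivity)
    refine ⟨fun s => if s ≤ n then V s else v, by simp, fun s hs => ?_, by simpa using h3⟩
    rcases Nat.lt_succ_iff_lt_or_eq.1 hs with h | h
    · simp only [h.le, if_true, Nat.succ_le_of_lt h]
      exact h2 s h
    · subst h
      simpa [h1] using hp

end

/-! ### Chains of derivatives of test functions, and moment conditions. -/

section

/-! ### Chains of derivatives -/

/-- A function `u 0` in the weighted space, together with its derivatives `u 1, …, u n`. -/
structure Chain (b : ℝ) (n : ℕ) (u : ℕ → ℝ → ℂ) : Prop where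
  inA : ∀ s ≤ n, InA b n (u s)
  prim : ∀ s < n, Prim (u s) (u (s + 1))

lemma Chain.add {b : ℝ} {n : ℕ} {u v : ℕ → ℝ → ℂ} (hu : Chain b n u) (hv : Chain b n v) :
    Chain b n (u + v) :=
  ⟨fun s hs => (hu.inA s hs).add (hv.inA s hs), fun s hs => (hu.prim s hs).add (hv.prim s hs)⟩

lemma Chain.smul {b : ℝ} {n : ℕ} {u : ℕ → ℝ → ℂ} (hu : Chain b n u) (c : ℂ) :
    Chain b n (c • u) :=
  ⟨fun s hs => (hu.inA s hs).const_smul c, fun s hs => (hu.prim s hs).smul c⟩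

lemma Chain.cv {b : ℝ} (hb : 0 < b) {n : ℕ} (hn : 1 ≤ n) {u : ℕ → ℝ → ℂ} (hu : Chain b n u)
    {w : ℝ → ℂ} (hw : InA b n w) : Chain b n (fun s => cv (u s) w) :=
  ⟨fun s hs => InA.cv hb.le hn (hu.inA s hs) hw, fun s hs => (hu.prim s hs).cv (hw.integrable hb)⟩

lemma Prim.dil_smul {u v : ℝ → ℂ} (h : Prim u v) (j s : ℕ) :
    Prim ((2 : ℂ) ^ (j * s) • ExpBesov.dil j u) ((2 : ℂ) ^ (j * (s + 1)) • ExpBesov.dil j v) := by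
  have := (h.dil j).smul ((2 : ℂ) ^ (j * s))
  rwa [smul_smul, ← pow_add, show j * s + j = j * (s + 1) by ring] at this

lemma Chain.dil {b : ℝ} (hb : 0 ≤ b) {n : ℕ} {u : ℕ → ℝ → ℂ} (hu : Chain b n u) (j : ℕ) :
    Chain b n (fun s => (2 : ℂ) ^ (j * s) • dil j (u s)) :=
  ⟨fun s hs => ((hu.inA s hs).dil hb j).const_smul _, fun s hs => (hu.prim s hs).dil_smul j s⟩

lemma InA.comp_sub_left {b : ℝ} (hb : 0 ≤ b) {n : ℕ} {u : ℝ → ℂ} (hu : InA b n u) (x : ℝ) :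
    InA b n (fun y => u (x - y)) := by
  have h := MemLp.comp_sub_left hu x
  refine MemLp.of_le_mul (c := wt b n x) h ((continuous_wt b n).aestronglyMeasurable.smul
    (hu.aestronglyMeasurable.comp_quasiMeasurePreserving
      (Measure.measurePreserving_sub_left (volume : Measure ℝ) x).quasiMeasurePreserving))
    (Eventually.of_forall fun t => ?_)
  rw [norm_smul, norm_smul, Real.norm_of_nonneg (wt_pos _ _ _).le,
    Real.norm_of_nonneg (wt_pos _ _ _).le, ← mul_assoc]
  gcongr
  rw [mul_comm]
  have := wt_sub_le hb n x (x - t)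
  rw [sub_sub_cancel] at this
  linarith

lemma Chain.reflect {b : ℝ} (hb : 0 ≤ b) {n : ℕ} {u : ℕ → ℝ → ℂ} (hu : Chain b n u) (x : ℝ) :
    Chain b n (fun s y => (-1) ^ s * u s (x - y)) := by
  refine ⟨fun s hs => ((hu.inA s hs).comp_sub_left hb x).const_smul _, fun s hs => ?_⟩
  have := ((hu.prim s hs).reflect x).smul ((-1) ^ s)
  convert this using 1
  all_goals
    ext y
    simp [pow_succ]

/-- Lets a chain start with φ itself rather than an almost everywhere equal copy. -/
lemma Chain.congr_zero {b : ℝ} {n : ℕ} {u : ℕ → ℝ → ℂ} (hu : Chain b n u) {φ : ℝ → ℂ}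
    (h : u 0 =ᵐ[volume] φ) : Chain b n (fun s => if s = 0 then φ else u s) := by
  refine ⟨fun s hs => ?_, fun s hs => ?_⟩
  · rcases Nat.eq_zero_or_pos s with rfl | h0
    · simpa using (hu.inA 0 hs).congr h
    · simpa [h0.ne'] using hu.inA s hs
  · rcases Nat.eq_zero_or_pos s with rfl | h0
    · have := hu.prim 0 hs
      simpa using (⟨this.left.congr h, this.right, this.zero, h.symm.trans this.ae_eq⟩ : Prim φ _)
    · simpa [h0.ne'] using hu.prim s hs

/-! ### One-dimensional test functions have chains of derivatives -/

lemma measurePreserving_fin_one : MeasurePreserving (fun (t : ℝ) (_ : Fin 1) => t) :=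
  (volume_preserving_funUnique (Fin 1) ℝ).symm

lemma measurableEmbedding_fin_one : MeasurableEmbedding (fun (t : ℝ) (_ : Fin 1) => t) :=
  (MeasurableEquiv.funUnique (Fin 1) ℝ).symm.measurableEmbedding

lemma integral_fin_one {E : Type*} [NormedAddCommGroup E] [NormedSpace ℝ E]
    (F : (Fin 1 → ℝ) → E) : ∫ x, F x = ∫ t : ℝ, F fun _ => t :=
  (measurePreserving_fin_one.integral_comp measurableEmbedding_fin_one F).symm

lemma partialD_fin_one {f : ℝ → ℝ} (hf : Differentiable ℝ f) :
    partialD (0 : Fin 1) (fun x => f (x 0)) = fun x => deriv f (x 0) := by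
  ext x
  have h : HasFDerivAt (fun x : Fin 1 → ℝ => f (x 0))
      ((fderiv ℝ f (x 0)).comp (ContinuousLinearMap.proj 0)) x :=
    (hf (x 0)).hasFDerivAt.comp x (hasFDerivAt_apply (0 : Fin 1) x)
  rw [partialD, h.fderiv]
  simp

lemma multiD_fin_one (s : ℕ) {f : ℝ → ℝ} (hf : ContDiff ℝ ∞ f) :
    multiD (fun _ : Fin 1 => s) (fun x => f (x 0)) = fun x => iteratedDeriv s f (x 0) := by
  have : multiD (fun _ : Fin 1 => s) (fun x => f (x 0)) =
      (partialD (0 : Fin 1))^[s] (fun x => f (x 0)) := by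
    simp [multiD, List.finRange_succ]
  rw [this]
  clear this
  induction s with
  | zero => simp
  | succ s ih =>
    rw [Function.iterate_succ_apply', ih, partialD_fin_one, iteratedDeriv_succ]
    exact hf.differentiable_iteratedDeriv s (by exact_mod_cast ENat.natCast_lt_top s)

/-- The powers β = 0 and β = n alone control the weight, since (1 + |t|)^n ≤ 2^n (1 + |t|^n). The
separately given weak derivatives of φ are linked to one another by testing the one of order s with
η' and the one of order s + 1 with η. -/
lemma MemX1.exists_chain {b : ℝ} (hb : 0 < b) {n : ℕ} {φ : ℝ → ℂ} (h : MemX1 b n φ) :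
    ∃ u, Chain b n u ∧ u 0 = φ := by
  choose! g hg hg' using h
  let u : ℕ → ℝ → ℂ := fun s t => g (fun _ => s) (fun _ => t)
  have hle : ∀ s ≤ n, (fun _ : Fin 1 => s) ≤ fun _ => n := fun s hs _ => hs
  have hA : ∀ s ≤ n, InA b n (u s) := by
    intro s hs
    have h0 := (hg' _ (hle s hs) (fun _ => 0) (fun _ => Nat.zero_le _)).comp_measurePreserving
      measurePreserving_fin_one
    have h1 := (hg' _ (hle s hs) (fun _ => n) (fun _ => le_rfl)).comp_measurePreserving
      measurePreserving_fin_one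
    have h2 : MemLp (fun t : ℝ => (2 : ℝ) ^ n * (Real.exp (b * |t|) * ‖u s t‖ +
        Real.exp (b * |t|) * |t| ^ n * ‖u s t‖)) 2 volume := by
      refine MemLp.ae_eq (Eventually.of_forall fun t => ?_) ((h0.norm.add h1.norm).const_mul (2 ^ n))
      simp [weighted, l1, u, -Complex.ofReal_mul, -Complex.ofReal_exp]
    have hm : AEStronglyMeasurable (u s) volume := by
      have hE : AEStronglyMeasurable (fun t : ℝ => Real.exp (-(b * |t|))) volume := by fun_prop
      refine (hE.smul h0.1).congr (Eventually.of_forall fun t => ?_)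
      simp [weighted, l1, u, Complex.exp_neg]
    refine MemLp.of_le h2 ((continuous_wt b n).aestronglyMeasurable.smul hm)
      (Eventually.of_forall fun t => ?_)
    rw [norm_smul, Real.norm_of_nonneg (wt_pos _ _ _).le, Real.norm_of_nonneg (by positivity), wt]
    have : (1 + |t|) ^ n ≤ 2 ^ n * (1 + |t| ^ n) := by
      rcases le_total 1 |t| with h | h
      · calc (1 + |t|) ^ n ≤ (2 * |t|) ^ n := by gcongr; linarith
          _ = 2 ^ n * |t| ^ n := mul_pow _ _ _
          _ ≤ _ := by gcongr; simp
      · calc (1 + |t|) ^ n ≤ 2 ^ n := by gcongr; linarith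
          _ ≤ _ := by
            have : 0 ≤ |t| ^ n := by positivity
            nlinarith [pow_pos (two_pos : (0 : ℝ) < 2) n]
    calc _ ≤ Real.exp (b * |t|) * (2 ^ n * (1 + |t| ^ n)) * ‖u s t‖ := by gcongr
      _ = _ := by ring
  have hw : ∀ s ≤ n, ∀ η : ℝ → ℝ, ContDiff ℝ ∞ η → HasCompactSupport η →
      ∫ t, iteratedDeriv s η t • φ t = (-1 : ℂ) ^ s * ∫ t, η t • u s t := by
    intro s hs η h1 h2
    have h3 := (hg _ (hle s hs)).2.2 (fun x => η (x 0)) (h1.comp (contDiff_apply ℝ ℝ 0)) ?_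
    · rw [integral_fin_one, integral_fin_one] at h3
      simpa [multiD_fin_one s h1] using h3
    · exact h2.comp_homeomorph (Homeomorph.funUnique (Fin 1) ℝ)
  have hφ : u 0 =ᵐ[volume] φ := by
    have hl : LocallyIntegrable φ := by
      have := (hg _ (hle 0 (Nat.zero_le _))).1
      have h3 := locallyIntegrable_map_homeomorph (Homeomorph.funUnique (Fin 1) ℝ) (f := φ)
        (μ := volume)
      have h4 : Measure.map (Homeomorph.funUnique (Fin 1) ℝ) volume = volume :=
        (volume_preserving_funUnique (Fin 1) ℝ).map_eq
      rw [h4] at h3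
      exact h3.2 this
    refine ae_eq_of_integral_contDiff_smul_eq
      ((hA 0 (Nat.zero_le _)).integrable hb).locallyIntegrable hl fun η h1 h2 => ?_
    simpa using (hw 0 (Nat.zero_le _) η h1 h2).symm
  refine ⟨_, Chain.congr_zero (u := u) ⟨hA, fun s hs => ?_⟩ hφ, by simp⟩
  refine WeakD.prim (fun η h1 h2 => ?_) ((hA s hs.le).integrable hb) ((hA (s + 1) hs).integrable hb)
  have e1 := hw s hs.le (deriv η) (by
    rw [contDiff_infty_iff_deriv] at h1; exact h1.2) h2.deriv
  have e2 := hw (s + 1) hs η h1 h2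
  rw [iteratedDeriv_succ', e1, pow_succ, mul_assoc] at e2
  have := mul_left_cancel₀ (pow_ne_zero s (by norm_num)) e2
  simpa using this

/-! ### Moments -/

/-- The moments of `u` up to the order `L` are those of `c` times the Dirac measure. -/
def HasMom (L : ℕ) (c : ℂ) (u : ℝ → ℂ) : Prop :=
  ∀ s ≤ L, ∫ x, x ^ s • u x = if s = 0 then c else 0

lemma HasMom.add {b : ℝ} (hb : 0 < b) {L : ℕ} {c d : ℂ} {u v : ℝ → ℂ} (hu : HasMom L c u)
    (hv : HasMom L d v) (hu' : Dec b u) (hv' : Dec b v) : HasMom L (c + d) (u + v) := by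
  intro s hs
  simp only [Pi.add_apply, smul_add]
  rw [integral_add (hu'.integrable_pow hb s) (hv'.integrable_pow hb s), hu s hs, hv s hs]
  split_ifs <;> simp

lemma HasMom.smul {L : ℕ} {c : ℂ} {u : ℝ → ℂ} (hu : HasMom L c u) (a : ℂ) :
    HasMom L (a * c) (a • u) := by
  intro s hs
  simp only [Pi.smul_apply, smul_comm _ a]
  rw [integral_smul, hu s hs]
  split_ifs <;> simp

lemma HasMom.dil {L : ℕ} {c : ℂ} {u : ℝ → ℂ} (hu : HasMom L c u) (j : ℕ) :
    HasMom L c (dil j u) := by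
  intro s hs
  have h := integral_mul_dil j (fun x => (x : ℂ) ^ s) u
  have h2 := hu s hs
  simp only [Complex.real_smul, Complex.ofReal_pow] at h2 ⊢
  rw [h]
  push_cast
  simp_rw [mul_pow, mul_assoc]
  rw [integral_const_mul, h2]
  split_ifs with h0
  · simp [h0]
  · simp

lemma pow_smul_cv {U V : ℕ → ℝ → ℂ} {u v : ℝ → ℂ} (hU : ∀ m t, U m t = t ^ m • u t)
    (hV : ∀ m t, V m t = t ^ m • v t) (s : ℕ) (x : ℝ)
    (h : ∀ m k, Integrable fun t => U m t * V k (x - t)) :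
    x ^ s • cv u v x =
      ∑ m ∈ Finset.range (s + 1), (s.choose m : ℂ) * cv (U m) (V (s - m)) x := by
  simp only [cv]
  simp_rw [← integral_const_mul]
  rw [← integral_finsetSum _ fun m _ => (h m (s - m)).const_mul _, ← integral_smul]
  congr 1; ext t
  have : (x : ℝ) ^ s = (t + (x - t)) ^ s := by ring
  rw [this, add_pow, Finset.sum_smul]
  refine Finset.sum_congr rfl fun m _ => ?_
  simp only [hU, hV, Complex.real_smul]
  push_cast
  ring

/-- Expand x^s = (t + (x - t))^s: a term is nonzero only if both exponents vanish. Up to order L,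
convolution therefore multiplies as for Dirac measures. -/
lemma HasMom.cv {b : ℝ} (hb : 0 < b) {L : ℕ} {c d : ℂ} {u v : ℝ → ℂ} (hu : HasMom L c u)
    (hv : HasMom L d v) (hu' : Dec b u) (hv' : Dec b v) : HasMom L (c * d) (cv u v) := by
  intro s hs
  obtain ⟨U, hU⟩ : ∃ U : ℕ → ℝ → ℂ, U = fun m t => t ^ m • u t := ⟨_, rfl⟩
  obtain ⟨V, hV⟩ : ∃ V : ℕ → ℝ → ℂ, V = fun m t => t ^ m • v t := ⟨_, rfl⟩
  have hi : ∀ m, Integrable (U m) := fun m => hU ▸ hu'.integrable_pow hb m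
  have hj : ∀ m, Integrable (V m) := fun m => hV ▸ hv'.integrable_pow hb m
  have hi0 : ∀ m ≤ L, ∫ x, U m x = if m = 0 then c else 0 := by rw [hU]; exact hu
  have hj0 : ∀ m ≤ L, ∫ x, V m x = if m = 0 then d else 0 := by rw [hV]; exact hv
  -- Integrability of the factors gives convergence of these convolutions only for almost every x,
  -- which suffices under the integral.
  have hall : ∀ᵐ x : ℝ, ∀ m k : ℕ, Integrable (fun t : ℝ => U m t * V k (x - t)) :=
    ae_all_iff.2 fun m => ae_all_iff.2 fun k =>
      (hi m).ae_convolution_exists (ContinuousLinearMap.mul ℝ ℂ) (hj k)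
  have key : ∀ᵐ x : ℝ, x ^ s • ExpBesov.cv u v x =
      ∑ m ∈ Finset.range (s + 1), (s.choose m : ℂ) * ExpBesov.cv (U m) (V (s - m)) x :=
    hall.mono fun x hx => pow_smul_cv (fun m t => by rw [hU]) (fun m t => by rw [hV]) s x hx
  rw [integral_congr_ae key, integral_finsetSum _ fun m _ =>
    (integrable_cv (hi m) (hj (s - m))).const_mul _]
  have e : ∀ m ∈ Finset.range (s + 1),
      ∫ x, (s.choose m : ℂ) * ExpBesov.cv (U m) (V (s - m)) x =
        (s.choose m : ℂ) * ((if m = 0 then c else 0) * if s - m = 0 then d else 0) := by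
    intro m hm
    have := Finset.mem_range.1 hm
    rw [integral_const_mul, integral_cv (hi m) (hj (s - m)), hi0 m (by omega),
      hj0 (s - m) (by omega)]
  rw [Finset.sum_congr rfl e, Finset.sum_range_succ', Finset.sum_eq_zero fun m _ => by simp]
  by_cases h0 : s = 0 <;> simp [h0]

end

/-! ### Almost orthogonality and the reproducing formula in one variable. -/

section

/-! ### Almost orthogonality of dilated functions -/

lemma cv_chain_swap {n : ℕ} {P Q : ℕ → ℝ → ℂ} (hP : ∀ s < n, Prim (P s) (P (s + 1)))
    (hQ : ∀ s < n, Prim (Q s) (Q (s + 1))) : cv (P 0) (Q n) = cv (P n) (Q 0) := by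
  have h : ∀ s ≤ n, cv (P 0) (Q n) = cv (P s) (Q (n - s)) := by
    intro s
    induction s with
    | zero => simp
    | succ s ih =>
      intro hs
      rw [ih (by omega), show n - s = n - (s + 1) + 1 by omega]
      exact (hP s (by omega)).cv_swap (hQ (n - (s + 1)) (by omega))
  simpa using h n le_rfl

/-- Since j ≤ k, the weight at scale 2^j splits into one for each factor at its own scale.
Cauchy-Schwarz then gives the size 2^((j+k)/2), bounded by 2^k. -/
lemma norm_cv_dil_le {a : ℝ} (ha : 0 ≤ a) {u v : ℝ → ℂ} (hu : InA a 0 u) (hv : InA a 0 v) :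
    ∃ C : ℝ, 0 ≤ C ∧ ∀ j k : ℕ, j ≤ k → ∀ x,
      ‖cv (dil j u) (dil k v) x‖ ≤ C * 2 ^ k * Real.exp (-(a * 2 ^ j * |x|)) := by
  set M := (∫⁻ t, (ENNReal.ofReal (wt a 0 t) * ‖u t‖ₑ) ^ 2) *
    ∫⁻ t, (ENNReal.ofReal (wt a 0 t) * ‖v t‖ₑ) ^ 2 with hM
  have hMtop : M ≠ ⊤ := (ENNReal.mul_lt_top (inA_iff.1 hu).2 (inA_iff.1 hv).2).ne
  refine ⟨√M.toReal, Real.sqrt_nonneg _, fun j k hjk x => ?_⟩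
  have hum := aestronglyMeasurable_dil hu.aestronglyMeasurable j
  have hvm := aestronglyMeasurable_dil hv.aestronglyMeasurable k
  have hW : ∀ i : ℕ, AEMeasurable (fun t => ENNReal.ofReal (wt a 0 (2 ^ i * t))) volume := by
    intro i
    have := continuous_wt a 0
    exact (Continuous.measurable (by fun_prop)).ennreal_ofReal.aemeasurable
  have h1 : (ENNReal.ofReal (wt a 0 (2 ^ j * x)) * ‖cv (dil j u) (dil k v) x‖ₑ) ^ 2 ≤
      (2 ^ k) ^ 2 * M := by
    calc _ ≤ (∫⁻ t, (ENNReal.ofReal (wt a 0 (2 ^ j * t)) * ‖dil j u t‖ₑ) *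
          (ENNReal.ofReal (wt a 0 (2 ^ k * (x - t))) * ‖dil k v (x - t)‖ₑ)) ^ 2 := by
          gcongr
          refine (mul_le_mul_right (enorm_cv_le _ _ x) _).trans ?_
          rw [← lintegral_const_mul' _ _ ENNReal.ofReal_ne_top]
          refine lintegral_mono fun t => ?_
          have : wt a 0 (2 ^ j * x) ≤ wt a 0 (2 ^ j * t) * wt a 0 (2 ^ k * (x - t)) := by
            refine (wt_le_mul_sub ha 0 _ (2 ^ j * t)).trans ?_
            gcongr
            · exact (wt_pos _ _ _).le
            · apply wt_mono_abs ha
              rw [← mul_sub, abs_mul, abs_mul, abs_of_pos (by positivity : (0 : ℝ) < 2 ^ j),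
                abs_of_pos (by positivity : (0 : ℝ) < 2 ^ k)]
              gcongr
              norm_num
          calc _ ≤ ENNReal.ofReal (wt a 0 (2 ^ j * t) * wt a 0 (2 ^ k * (x - t))) *
                (‖dil j u t‖ₑ * ‖dil k v (x - t)‖ₑ) := by gcongr
            _ = _ := by rw [ENNReal.ofReal_mul (wt_pos _ _ _).le]; ring
      _ ≤ (2 ^ j * ∫⁻ t, (ENNReal.ofReal (wt a 0 t) * ‖u t‖ₑ) ^ 2) *
          (2 ^ k * ∫⁻ t, (ENNReal.ofReal (wt a 0 t) * ‖v t‖ₑ) ^ 2) := by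
          refine (lintegral_mul_sq_le ((hW j).mul hum.enorm)
            (aemeasurable_comp_sub ((hW k).mul hvm.enorm) x)).trans (le_of_eq ?_)
          simp only [Pi.mul_apply]
          rw [lintegral_enorm_dil_sq j u fun t => ENNReal.ofReal (wt a 0 t),
            lintegral_sub_left_eq_self (fun t => (ENNReal.ofReal (wt a 0 (2 ^ k * t)) *
              ‖dil k v t‖ₑ) ^ 2) x,
            lintegral_enorm_dil_sq k v fun t => ENNReal.ofReal (wt a 0 t)]
      _ = (2 ^ j * 2 ^ k) * M := by rw [hM]; ring
      _ ≤ _ := by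
          rw [sq]
          gcongr
          norm_num
  have h2 : (wt a 0 (2 ^ j * x) * ‖cv (dil j u) (dil k v) x‖) ^ 2 ≤ (2 ^ k * √M.toReal) ^ 2 := by
    rw [mul_pow (2 ^ k), Real.sq_sqrt ENNReal.toReal_nonneg]
    have h3 := ENNReal.toReal_mono (by finiteness) h1
    simpa [ENNReal.toReal_mul, ENNReal.toReal_pow, ENNReal.toReal_ofReal (wt_pos _ _ _).le] using h3
  have h4 := (abs_le_of_sq_le_sq' h2 (by positivity)).2
  have h5 : wt a 0 (2 ^ j * x) = Real.exp (a * 2 ^ j * |x|) := by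
    rw [wt, abs_mul, abs_of_pos (by positivity : (0 : ℝ) < 2 ^ j)]
    simp [mul_assoc]
  rw [h5] at h4
  rw [Real.exp_neg, ← div_eq_mul_inv, le_div_iff₀ (Real.exp_pos _)]
  linarith

/-- Each derivative moved from the finer to the coarser factor gains 2^(-(k-j)). Of the L + 1 gains,
one is spent on replacing 2^k by 2^j. -/
lemma norm_cv_dil_chain_le {a : ℝ} (ha : 0 ≤ a) {L : ℕ} {U V : ℕ → ℝ → ℂ}
    (hU : ∀ s < L + 1, Prim (U s) (U (s + 1))) (hV : ∀ s < L + 1, Prim (V s) (V (s + 1)))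
    (hUn : InA a 0 (U (L + 1))) (hV0 : InA a 0 (V 0)) :
    ∃ C : ℝ, 0 ≤ C ∧ ∀ j k : ℕ, j ≤ k → ∀ x, ‖cv (dil j (U 0)) (dil k (V (L + 1))) x‖ ≤
      C * 2 ^ j * ((1 / 2) ^ (k - j)) ^ L * Real.exp (-(a * 2 ^ j * |x|)) := by
  obtain ⟨C, hC, h⟩ := norm_cv_dil_le ha hUn hV0
  refine ⟨C, hC, fun j k hjk x => ?_⟩
  have e := cv_chain_swap (n := L + 1) (P := fun s => (2 : ℂ) ^ (j * s) • dil j (U s))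
    (Q := fun s => (2 : ℂ) ^ (k * s) • dil k (V s)) (fun s hs => (hU s hs).dil_smul j s)
    (fun s hs => (hV s hs).dil_smul k s)
  have e2 := congrArg (fun f => ‖f x‖) e
  simp only [cv_smul_left, cv_smul_right, mul_zero, pow_zero, one_smul, Pi.smul_apply,
    norm_smul, norm_pow, Complex.norm_ofNat] at e2
  have h2 := h j k hjk x
  obtain ⟨m, rfl⟩ := Nat.exists_eq_add_of_le hjk
  rw [Nat.add_sub_cancel_left]
  have e3 : ‖cv (dil j (U 0)) (dil (j + m) (V (L + 1))) x‖ =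
      (1 / 2) ^ (m * (L + 1)) * ‖cv (dil j (U (L + 1))) (dil (j + m) (V 0)) x‖ := by
    rw [add_mul, pow_add, mul_assoc] at e2
    have := mul_left_cancel₀ (pow_ne_zero _ (by norm_num)) e2
    rw [← this, ← mul_assoc, ← mul_pow]
    norm_num
  rw [e3]
  calc _ ≤ (1 / 2) ^ (m * (L + 1)) * (C * 2 ^ (j + m) * Real.exp (-(a * 2 ^ j * |x|))) := by gcongr
    _ = C * 2 ^ j * ((1 / 2) ^ (m * L)) * ((1 / 2) ^ m * 2 ^ m) *
        Real.exp (-(a * 2 ^ j * |x|)) := by ring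
    _ = _ := by rw [← mul_pow, pow_mul]; norm_num

/-! ### A Calderón reproducing formula -/

namespace AlgA

variable {b : ℝ} {n : ℕ} {hb : 0 < b} {hn : 1 ≤ n}

/-- The dyadic dilation on the convolution algebra. -/
def dil (j : ℕ) (u : AlgA b n hb hn) : AlgA b n hb hn := mk (ExpBesov.dil j u.fn) (u.inA.dil hb.le j)

@[simp] lemma fn_dil (j : ℕ) (u : AlgA b n hb hn) : (dil j u).fn = ExpBesov.dil j u.fn := rfl

lemma dil_sub_apply (j : ℕ) (u v : AlgA b n hb hn) : dil j (u - v) = dil j u - dil j v :=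
  ext (by ext x; simp [ExpBesov.dil, mul_sub])

lemma dil_smul_apply (j : ℕ) (c : ℂ) (u : AlgA b n hb hn) : dil j (c • u) = c • dil j u :=
  ext (by ext x; simp [ExpBesov.dil, mul_left_comm])

lemma dil_mul_apply (j : ℕ) (u v : AlgA b n hb hn) : dil j (u * v) = dil j u * dil j v :=
  ext (cv_dil j u.fn v.fn).symm

lemma dil_dil (j k : ℕ) (u : AlgA b n hb hn) : dil j (dil k u) = dil (j + k) u :=
  ext (dil_add j k u.fn).symm

lemma dil_zero (u : AlgA b n hb hn) : dil 0 u = u := ext (ExpBesov.dil_zero u.fn)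

/-- The difference `2 g(2·) - g`, which generates the levels `j ≥ 1`. -/
def diff (g : AlgA b n hb hn) : AlgA b n hb hn := dil 1 g - g

/-- The dual function of `diff g`: the quotient of `P(s) - P(t)` by `s - t` for
`P(t) = 3 t² - 2 σ t³`, evaluated at `s = 2 g(2·)` and `t = g`. -/
def dual (σ : ℂ) (g : AlgA b n hb hn) : AlgA b n hb hn :=
  (3 : ℂ) • (dil 1 g + g) - (2 * σ) • (dil 1 g * dil 1 g + dil 1 g * g + g * g)

/-- The approximate identity `P(g)` for `P(t) = 3 t² - 2 σ t³`. -/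
def approx (σ : ℂ) (g : AlgA b n hb hn) : AlgA b n hb hn :=
  (3 : ℂ) • (g * g) - (2 * σ) • (g * g * g)

/-- The system generated by `g`. -/
def Phi (g : AlgA b n hb hn) : ℕ → AlgA b n hb hn
  | 0 => g
  | k + 1 => dil k (diff g)

/-- The dual system of `Phi g` in the reproducing formula. -/
def Psi (σ : ℂ) (g : AlgA b n hb hn) : ℕ → AlgA b n hb hn
  | 0 => (3 : ℂ) • g - (2 * σ) • (g * g)
  | k + 1 => dil k (dual σ g)

lemma dual_mul_diff (σ : ℂ) (g : AlgA b n hb hn) :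
    dual σ g * diff g = dil 1 (approx σ g) - approx σ g := by
  -- Adjoining a unit turns scalars into ring elements, so that the polynomial identity is settled
  -- in a commutative ring.
  apply Unitization.inr_injective (R := ℂ)
  simp only [dual, diff, approx, dil_sub_apply, dil_smul_apply, dil_mul_apply,
    Unitization.inr_mul, Unitization.inr_sub, Unitization.inr_add, Unitization.inr_smul,
    Algebra.smul_def]
  simp only [map_mul, map_ofNat]
  ring

/-- The sum telescopes: the level k + 1 contributes P(g) dilated by 2^(k+1) minus P(g) dilated by
2^k, and the level 0 contributes P(g) itself. -/
lemma sum_Psi_mul_Phi (σ : ℂ) (g : AlgA b n hb hn) (N : ℕ) :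
    ∑ k ∈ Finset.range (N + 1), Psi σ g k * Phi g k = dil N (approx σ g) := by
  induction N with
  | zero =>
    rw [zero_add, Finset.sum_range_one, dil_zero, Psi, Phi, approx, sub_mul, smul_mul_assoc,
      smul_mul_assoc]
  | succ N ih =>
    rw [Finset.sum_range_succ, ih, Psi, Phi, ← dil_mul_apply, dual_mul_diff, dil_sub_apply,
      dil_dil]
    abel

/-- The index shifts by one because φ = g - 2⁻¹g(2⁻¹·) is a difference with the coarser scale,
whereas `diff g` is one with the finer scale. -/
lemma fn_Phi (g : AlgA b n hb hn) (j : ℕ) : (Phi g j).fn = dyadic g.fn j := by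
  cases j with
  | zero => simp [Phi, dyadic]
  | succ k =>
    ext x
    simp only [Phi, diff, fn_dil, fn_sub, ExpBesov.dil, Pi.sub_apply, dyadic, diffFun]
    rw [if_neg (Nat.succ_ne_zero k), show (2 : ℝ) ^ (k + 1) * x = 2 ^ 1 * (2 ^ k * x) by ring,
      show (2 : ℝ)⁻¹ * (2 ^ 1 * (2 ^ k * x)) = 2 ^ k * x by ring]
    ring

/-- The integral is multiplicative under convolution, so it equals P(σ) = 3σ² - 2σ⁴ = 1. -/
lemma integral_approx {σ : ℂ} {g : AlgA b n hb hn} (h : ∫ x, g.fn x = σ) (hσ : σ ^ 2 = 1) :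
    ∫ x, (approx σ g).fn x = 1 := by
  have i1 := g.integrable
  have i2 := (g * g).integrable
  have i3 := (g * g * g).integrable
  have e2 : ∫ x, (g * g).fn x = σ * σ := by rw [fn_mul, integral_cv i1 i1, h]
  have e3 : ∫ x, (g * g * g).fn x = σ * σ * σ := by rw [fn_mul, integral_cv i2 i1, h, e2]
  have : ∫ x, (approx σ g).fn x = 3 * (σ * σ) - (2 * σ) * (σ * σ * σ) := by
    rw [← e3, ← e2, ← integral_const_mul, ← integral_const_mul, ← integral_sub]
    · rfl
    · exact i2.const_mul _
    · exact i3.const_mul _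
  rw [this]
  linear_combination (3 - 2 * (σ ^ 2 + 1)) * hσ

lemma hasMom_diff {L : ℕ} {σ : ℂ} {g : AlgA b n hb hn} (h : HasMom L σ g.fn) :
    HasMom L 0 (diff g).fn := by
  have := (h.dil 1).add hb (h.smul (-1)) (dil 1 g).inA.dec (g.inA.const_smul (-1)).dec
  convert this using 1
  · ring
  · ext x; simp [diff, sub_eq_add_neg]

/-- Both g and its dilation act as σ times the Dirac measure up to order L, so the divided
difference of P acts as P'(σ) = 6σ - 6σ³, which is 0. The coefficients of P are chosen for this. -/
lemma hasMom_dual {L : ℕ} {σ : ℂ} {g : AlgA b n hb hn} (h : HasMom L σ g.fn) (hσ : σ ^ 2 = 1) :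
    HasMom L 0 (dual σ g).fn := by
  have hd : HasMom L σ (dil 1 g).fn := h.dil 1
  have a1 := hd.add hb h (dil 1 g).inA.dec g.inA.dec
  have a2 := hd.cv hb hd (dil 1 g).inA.dec (dil 1 g).inA.dec
  have a3 := hd.cv hb h (dil 1 g).inA.dec g.inA.dec
  have a4 := h.cv hb h g.inA.dec g.inA.dec
  have a5 := (a2.add hb a3 (dil 1 g * dil 1 g).inA.dec (dil 1 g * g).inA.dec).add hb a4
    (dil 1 g * dil 1 g + dil 1 g * g).inA.dec (g * g).inA.dec
  have := (a1.smul 3).add hb (a5.smul (-(2 * σ))) ((3 : ℂ) • (dil 1 g + g)).inA.dec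
    ((-(2 * σ)) • (dil 1 g * dil 1 g + dil 1 g * g + g * g)).inA.dec
  convert this using 1
  · linear_combination 6 * σ * hσ
  · ext x; simp [dual, sub_eq_add_neg]; ring

/-- The functions with `n` derivatives in the weighted space. -/
def Smooth (u : AlgA b n hb hn) : Prop := ∃ U, Chain b n U ∧ U 0 = u.fn

lemma Smooth.add {u v : AlgA b n hb hn} (hu : Smooth u) (hv : Smooth v) : Smooth (u + v) := by
  obtain ⟨U, h1, h2⟩ := hu
  obtain ⟨V, h3, h4⟩ := hv
  exact ⟨U + V, h1.add h3, by simp [h2, h4]⟩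

lemma Smooth.smul {u : AlgA b n hb hn} (hu : Smooth u) (c : ℂ) : Smooth (c • u) := by
  obtain ⟨U, h1, h2⟩ := hu
  exact ⟨c • U, h1.smul c, by simp [h2]⟩

lemma Smooth.sub {u v : AlgA b n hb hn} (hu : Smooth u) (hv : Smooth v) : Smooth (u - v) := by
  have := hu.add (hv.smul (-1))
  rwa [neg_one_smul, ← sub_eq_add_neg] at this

lemma Smooth.mul {u : AlgA b n hb hn} (hu : Smooth u) (v : AlgA b n hb hn) : Smooth (u * v) := by
  obtain ⟨U, h1, h2⟩ := hu
  exact ⟨_, h1.cv hb hn v.inA, by simp [h2]⟩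

lemma Smooth.dil {u : AlgA b n hb hn} (hu : Smooth u) (j : ℕ) : Smooth (dil j u) := by
  obtain ⟨U, h1, h2⟩ := hu
  exact ⟨_, h1.dil hb.le j, by simp [h2]⟩

lemma Smooth.diff {g : AlgA b n hb hn} (h : Smooth g) : Smooth (diff g) := (h.dil 1).sub h

lemma Smooth.Phi {g : AlgA b n hb hn} (h : Smooth g) (j : ℕ) : Smooth (Phi g j) := by
  cases j with
  | zero => exact h
  | succ k => exact h.diff.dil k

lemma Smooth.dual {g : AlgA b n hb hn} (h : Smooth g) (σ : ℂ) : Smooth (dual σ g) :=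
  (((h.dil 1).add h).smul _).sub (((((h.dil 1).mul _).add ((h.dil 1).mul _)).add (h.mul _)).smul _)

/-- The coarser factor supplies L + 1 derivatives, the vanishing moments of the finer one supply L +
1 antiderivatives. The latter decay only at rates below b, whence the strict inequality a < b. -/
lemma Smooth.exists_norm_mul_le {L : ℕ} {hn : 1 ≤ L + 1} {u v : AlgA b (L + 1) hb hn}
    (hu : Smooth u) (hv : HasMom L 0 v.fn) {a : ℝ} (ha : 0 ≤ a) (hab : a < b) :
    ∃ C : ℝ, 0 ≤ C ∧ ∀ j k : ℕ, j ≤ k → ∀ x, ‖(AlgA.dil j u * AlgA.dil k v).fn x‖ ≤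
      C * 2 ^ j * ((1 / 2) ^ (k - j)) ^ L * Real.exp (-(a * 2 ^ j * |x|)) := by
  obtain ⟨U, h1, h2⟩ := hu
  obtain ⟨V, h3, h4, h5⟩ := v.inA.dec.exists_antideriv hb (L + 1) fun s hs => by
    simpa using hv s (by omega)
  have := norm_cv_dil_chain_le ha h1.prim h4 ((h1.inA _ le_rfl).dec a hab) (h5 a hab)
  rwa [h2, h3] at this

/-- Whichever factor is finer has the vanishing moments, except at the levels (0, 0), where no gain
is needed. The truncated `min j k - 1` in the exponential is the dilation exponent of the coarser
factor, since the level j + 1 is a dilation by 2^j. -/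
lemma exists_norm_Phi_mul_Psi_le {L : ℕ} {hn : 1 ≤ L + 1} {σ : ℂ} {g : AlgA b (L + 1) hb hn}
    (hg : Smooth g) (hmom : HasMom L σ g.fn) (hσ : σ ^ 2 = 1) {a : ℝ} (ha : 0 ≤ a) (hab : a < b) :
    ∃ C : ℝ, 0 ≤ C ∧ ∀ j k x, ‖(Phi g j * Psi σ g k).fn x‖ ≤
      C * 2 ^ min j k * ((1 / 2) ^ ((j - k) + (k - j))) ^ L *
        Real.exp (-(a * 2 ^ (min j k - 1) * |x|)) := by
  have hΨ0 : Smooth (Psi σ g 0) := (hg.smul _).sub ((hg.mul g).smul _)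
  obtain ⟨C1, hC1, h1⟩ := hg.exists_norm_mul_le (hasMom_dual hmom hσ) ha hab
  obtain ⟨C2, hC2, h2⟩ := hg.diff.exists_norm_mul_le (hasMom_dual hmom hσ) ha hab
  obtain ⟨C3, hC3, h3⟩ := (hg.dual σ).exists_norm_mul_le (hasMom_diff hmom) ha hab
  obtain ⟨C4, hC4, h4⟩ := hΨ0.exists_norm_mul_le (hasMom_diff hmom) ha hab
  obtain ⟨C5, hC5, h5⟩ := norm_cv_dil_le ha (g.inA.dec a hab) ((Psi σ g 0).inA.dec a hab)
  -- The distance between the levels exceeds that between the dilation exponents by at most one;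
  -- this costs the factor 2^L.
  have hstep : ∀ {C' : ℝ} {m m' r r' : ℕ} {x : ℝ} (C : ℝ), 0 ≤ C → C ≤ C' → m' ≤ m → r ≤ r' + 1 →
      C * 2 ^ m' * ((1 / 2) ^ r') ^ L * Real.exp (-(a * 2 ^ m' * |x|)) ≤
      (C' * 2 ^ L) * 2 ^ m * ((1 / 2) ^ r) ^ L * Real.exp (-(a * 2 ^ m' * |x|)) := by
    intro C' m m' r r' x C hC hCC' hm hr
    have hC' : 0 ≤ C' := hC.trans hCC'
    have e1 : (2 : ℝ) ^ m' ≤ 2 ^ m := pow_le_pow_right₀ (by norm_num) hm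
    have e2 : ((1 / 2 : ℝ) ^ r') ^ L ≤ 2 ^ L * ((1 / 2) ^ r) ^ L := by
      rw [← mul_pow]
      gcongr
      calc (1 / 2 : ℝ) ^ r' = 2 * (1 / 2) ^ (r' + 1) := by rw [pow_succ]; ring
        _ ≤ _ := by
          gcongr 2 * ?_
          exact pow_le_pow_of_le_one (by norm_num) (by norm_num) hr
    calc _ ≤ C' * 2 ^ m * (2 ^ L * ((1 / 2) ^ r) ^ L) * Real.exp (-(a * 2 ^ m' * |x|)) := by gcongr
      _ = _ := by ring
  refine ⟨(C1 + C2 + C3 + C4 + C5) * 2 ^ L, by positivity, fun j k x => ?_⟩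
  rcases j with _ | j <;> rcases k with _ | k
  · have := h5 0 0 le_rfl x
    rw [ExpBesov.dil_zero, ExpBesov.dil_zero] at this
    refine (this.trans (le_of_eq ?_)).trans (hstep (m' := 0) (r' := 0) C5 hC5 (by linarith) (by simp) (by simp))
    simp
  · have := h1 0 k (Nat.zero_le _) x
    rw [dil_zero] at this
    exact this.trans (hstep C1 hC1 (by linarith) (by simp) (by omega))
  · have := h4 0 j (Nat.zero_le _) x
    rw [dil_zero, mul_comm] at this
    exact this.trans (hstep C4 hC4 (by linarith) (by simp) (by omega))
  · rcases le_total j k with h | h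
    · have := h2 j k h x
      have e : min (j + 1) (k + 1) - 1 = j := by omega
      rw [e]
      exact this.trans (hstep C2 hC2 (by linarith) (by omega) (by omega))
    · have := h3 k j h x
      rw [mul_comm] at this
      have e : min (j + 1) (k + 1) - 1 = k := by omega
      rw [e]
      exact this.trans (hstep C3 hC3 (by linarith) (by omega) (by omega))

end AlgA

/-! ### The moments of the generator -/

/-- The derivative of order s of the Fourier transform at 0 is a nonzero multiple of the moment of
order s of φ, which is (1 - 2^s) times that of g; for s ≥ 1 this factor is nonzero. -/
lemma hasMom_of_iteratedDeriv_fourier {b : ℝ} (hb : 0 < b) {L : ℕ} {g : ℝ → ℂ} (hg : Dec b g)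
    (h : ∀ s ≤ L, iteratedDeriv s (𝓕 (diffFun g)) 0 = 0) : HasMom L (∫ x, g x) g := by
  have hi : ∀ s, Integrable fun x : ℝ => x ^ s • ((2 : ℂ)⁻¹ * g (2⁻¹ * x)) := by
    intro s
    have := ((hg.integrable_pow hb s).comp_mul_left' (R := 2⁻¹) (by norm_num)).const_mul
      ((2 : ℂ) ^ s * 2⁻¹)
    refine this.congr (Eventually.of_forall fun x => ?_)
    simp only [Complex.real_smul, mul_pow, inv_pow]
    push_cast
    field_simp
  have hm : ∀ s : ℕ, ∫ x : ℝ, x ^ s • ((2 : ℂ)⁻¹ * g (2⁻¹ * x)) = 2 ^ s * ∫ x, x ^ s • g x := by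
    intro s
    have := Measure.integral_comp_mul_left (fun x => x ^ s • g x) (2⁻¹ : ℝ)
    have e : ∀ x : ℝ, x ^ s • ((2 : ℂ)⁻¹ * g (2⁻¹ * x)) =
        (2 ^ s * 2⁻¹) * ((2⁻¹ * x) ^ s • g (2⁻¹ * x)) := by
      intro x
      simp only [Complex.real_smul, mul_pow, inv_pow]
      push_cast
      field_simp
    simp_rw [e]
    rw [integral_const_mul, this]
    simp [mul_assoc]
  intro s hs
  split_ifs with h0
  · simp [h0]
  have hd : ∀ s, Integrable fun x : ℝ => x ^ s • diffFun g x := by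
    intro s
    refine ((hg.integrable_pow hb s).sub (hi s)).congr (Eventually.of_forall fun x => ?_)
    simp [diffFun, mul_sub]
  have h1 := h s hs
  rw [Real.iteratedDeriv_fourier (N := ⊤) (fun m _ => hd m) le_top, Real.fourier_eq] at h1
  simp only [inner_zero_right, neg_zero, AddChar.map_zero_eq_one, one_smul, smul_eq_mul,
    mul_pow (_ * _ * _), mul_assoc ((-2 * (Real.pi : ℂ) * Complex.I) ^ s)] at h1
  rw [integral_const_mul] at h1
  have h2 := (mul_eq_zero.1 h1).resolve_left (pow_ne_zero _ (by simp [Real.pi_ne_zero]))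
  have h3 : ∫ x : ℝ, (x : ℂ) ^ s * diffFun g x =
      (∫ x, x ^ s • g x) - 2 ^ s * ∫ x, x ^ s • g x := by
    rw [← hm, ← integral_sub (hg.integrable_pow hb s) (hi s)]
    congr 1; ext x
    simp [diffFun, mul_sub]
  rw [h3, ← one_sub_mul] at h2
  refine (mul_eq_zero.1 h2).resolve_left ?_
  refine sub_ne_zero.2 fun h4 => ?_
  have h5 : (1 : ℝ) = 2 ^ s := by exact_mod_cast h4
  have h6 : (1 : ℝ) < 2 ^ s := one_lt_pow₀ (by norm_num) h0
  linarith

end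

/-! ### Tensor products and their weak derivatives. -/

section

/-! ### Tensor products -/

/-- The tensor product `∏ u_i(x_i)`. -/
def tens {d : ℕ} (u : Fin d → ℝ → ℂ) (x : Fin d → ℝ) : ℂ := ∏ i, u i (x i)

/-- The weight `∏ e^{b|x_i|} (1 + |x_i|)^n`. -/
def wtd {d : ℕ} (b : ℝ) (n : ℕ) (x : Fin d → ℝ) : ℝ := ∏ i, wt b n (x i)

section wtd

variable {d : ℕ}

lemma wtd_pos (b : ℝ) (n : ℕ) (x : Fin d → ℝ) : 0 < wtd b n x :=
  Finset.prod_pos fun _ _ => wt_pos _ _ _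

lemma continuous_wtd (b : ℝ) (n : ℕ) : Continuous (wtd b n : (Fin d → ℝ) → ℝ) :=
  continuous_finsetProd _ fun i _ => (continuous_wt b n).comp (continuous_apply i)

lemma wtd_add_le {b : ℝ} (hb : 0 ≤ b) (n : ℕ) (x y : Fin d → ℝ) :
    wtd b n (x + y) ≤ wtd b n x * wtd b n y := by
  rw [wtd, wtd, wtd, ← Finset.prod_mul_distrib]
  exact Finset.prod_le_prod (fun i _ => (wt_pos _ _ _).le) fun i _ => wt_add_le hb n _ _

lemma wtd_neg (b : ℝ) (n : ℕ) (x : Fin d → ℝ) : wtd b n (-x) = wtd b n x := by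
  simp [wtd, wt_neg]

lemma wtd_sub_le {b : ℝ} (hb : 0 ≤ b) (n : ℕ) (x y : Fin d → ℝ) :
    wtd b n (x - y) ≤ wtd b n x * wtd b n y := by
  simpa [sub_eq_add_neg, wtd_neg] using wtd_add_le hb n x (-y)

lemma abs_weight_le_wtd {b : ℝ} {n : ℕ} {β : Fin d → ℕ} (hβ : β ≤ fun _ => n) (x : Fin d → ℝ) :
    |Real.exp (b * l1 x) * ∏ i, x i ^ β i| ≤ wtd b n x := by
  rw [abs_mul, Real.abs_exp, l1, Finset.mul_sum, Real.exp_sum, Finset.abs_prod,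
    ← Finset.prod_mul_distrib]
  refine Finset.prod_le_prod (fun i _ => by positivity) fun i _ => ?_
  rw [wt, abs_pow]
  gcongr
  calc |x i| ^ β i ≤ (1 + |x i|) ^ β i := by gcongr; linarith
    _ ≤ _ := pow_le_pow_right₀ (by linarith [abs_nonneg (x i)]) (hβ i)

lemma MemLp.weighted {b : ℝ} {n : ℕ} {g : (Fin d → ℝ) → ℂ} (hm : AEStronglyMeasurable g volume)
    (hg : MemLp (fun x => wtd b n x • g x) 2 volume) {β : Fin d → ℕ} (hβ : β ≤ fun _ => n) :
    MemLp (weighted b β g) 2 volume := by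
  refine MemLp.of_le hg ?_ (Eventually.of_forall fun x => ?_)
  · have hc : Continuous fun x : Fin d → ℝ => Real.exp (b * l1 x) * ∏ i, x i ^ β i := by
      unfold l1
      fun_prop
    exact hc.aestronglyMeasurable.smul hm
  · rw [ExpBesov.weighted, norm_smul, norm_smul, Real.norm_of_nonneg (wtd_pos _ _ _).le]
    gcongr
    exact abs_weight_le_wtd hβ x

end wtd

section tens

variable {d : ℕ}

lemma aestronglyMeasurable_tens {u : Fin d → ℝ → ℂ}
    (hu : ∀ i, AEStronglyMeasurable (u i) volume) : AEStronglyMeasurable (tens u) volume := by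
  have : ∀ i ∈ Finset.univ, AEStronglyMeasurable (fun x : Fin d → ℝ => u i (x i)) volume :=
    fun i _ => (hu i).comp_quasiMeasurePreserving (Measure.quasiMeasurePreserving_eval _ i)
  exact Finset.aestronglyMeasurable_fun_prod _ this

lemma integrable_tens {u : Fin d → ℝ → ℂ} (hu : ∀ i, Integrable (u i)) : Integrable (tens u) :=
  Integrable.fintype_prod hu

lemma memLp_tens {u : Fin d → ℝ → ℂ} (hu : ∀ i, MemLp (u i) 2 volume) :
    MemLp (tens u) 2 volume := by
  rw [memLp_two_iff_integrable_sq_norm (aestronglyMeasurable_tens fun i => (hu i).1)]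
  have h : ∀ i, Integrable (fun t => ‖u i t‖ ^ 2) := fun i =>
    (memLp_two_iff_integrable_sq_norm (hu i).1).1 (hu i)
  refine (Integrable.fintype_prod h).congr (Eventually.of_forall fun x => ?_)
  simp [tens, Finset.prod_pow]

lemma wtd_smul_tens (b : ℝ) (n : ℕ) (u : Fin d → ℝ → ℂ) (x : Fin d → ℝ) :
    wtd b n x • tens u x = tens (fun i t => wt b n t • u i t) x := by
  simp [wtd, tens, Complex.real_smul, Finset.prod_mul_distrib]

lemma memLp_wtd_tens {b : ℝ} {n : ℕ} {u : Fin d → ℝ → ℂ} (hu : ∀ i, InA b n (u i)) :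
    MemLp (fun x => wtd b n x • tens u x) 2 volume := by
  simp_rw [wtd_smul_tens]
  exact memLp_tens hu

lemma integrable_smul_tens {u : Fin d → ℝ → ℂ} (hu : ∀ i, Integrable (u i))
    {η : (Fin d → ℝ) → ℝ} (h : ContDiff ℝ ∞ η ∧ HasCompactSupport η) :
    Integrable fun x => η x • tens u x := by
  obtain ⟨C, hC⟩ := h.1.continuous.bounded_above_of_compact_support h.2
  exact (integrable_tens hu).bdd_smul _ h.1.continuous.aestronglyMeasurable
    (Eventually.of_forall hC)

lemma tens_insertNth {m : ℕ} (i : Fin (m + 1)) (u : Fin (m + 1) → ℝ → ℂ) (t : ℝ) (y : Fin m → ℝ) :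
    tens u (i.insertNth t y) = u i t * tens (fun j => u (i.succAbove j)) y := by
  simp [tens, Fin.prod_univ_succAbove _ i]

lemma integral_insertNth {m : ℕ} (i : Fin (m + 1)) {F : (Fin (m + 1) → ℝ) → ℂ}
    (hF : Integrable F) : ∫ x, F x = ∫ y : Fin m → ℝ, ∫ t : ℝ, F (i.insertNth t y) := by
  have h := (volume_preserving_piFinSuccAbove (fun _ : Fin (m + 1) => ℝ) i).symm
  rw [← h.integral_comp' F]
  have h2 : Integrable (fun p => F ((MeasurableEquiv.piFinSuccAbove (fun _ => ℝ) i).symm p)) :=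
    h.integrable_comp_of_integrable hF
  exact integral_prod_symm _ h2

/-- By Fubini the coordinate i is integrated first; on each line the claim is the one-dimensional
integration by parts with the restricted test function. -/
lemma integral_partialD_tens {u : Fin d → ℝ → ℂ} {v : ℝ → ℂ} {i : Fin d}
    (hu : ∀ j, Integrable (u j)) (h : Prim (u i) v) {η : (Fin d → ℝ) → ℝ}
    (hη : ContDiff ℝ ∞ η ∧ HasCompactSupport η) :
    ∫ x, partialD i η x • tens u x = -∫ x, η x • tens (Function.update u i v) x := by
  have hu' : ∀ j, Integrable (Function.update u i v j) := by
    intro j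
    rcases eq_or_ne j i with rfl | hj
    · simpa using h.right
    · simpa [hj] using hu j
  obtain _ | m := d
  · exact i.elim0
  rw [integral_insertNth i (integrable_smul_tens hu (partialD_regular i η hη)),
    integral_insertNth i (integrable_smul_tens hu' hη), ← integral_neg]
  congr 1; ext y
  have hins : ∀ t : ℝ, HasDerivAt (fun t : ℝ => (i.insertNth t y : Fin (m + 1) → ℝ))
      (Pi.single i 1) t := by
    intro t
    rw [hasDerivAt_pi]
    intro j
    refine Fin.succAboveCases i ?_ (fun k => ?_) j
    · simpa using hasDerivAt_id' t
    · simpa using hasDerivAt_const t (y k)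
  have hcont : ContDiff ℝ ∞ (fun t : ℝ => (i.insertNth t y : Fin (m + 1) → ℝ)) := by
    rw [contDiff_pi]
    intro j
    refine Fin.succAboveCases i ?_ (fun k => ?_) j
    · simpa using contDiff_fun_id
    · simpa using contDiff_const
  have hd : deriv (fun t => η (i.insertNth t y)) = fun t => partialD i η (i.insertNth t y) := by
    ext t
    exact (((hη.1.differentiable (by simp)) _).hasFDerivAt.comp_hasDerivAt t (hins t)).deriv
  have hc : HasCompactSupport fun t => η (i.insertNth t y) := by
    have hemb : Topology.IsClosedEmbedding (fun t : ℝ => (i.insertNth t y : Fin (m + 1) → ℝ)) :=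
      Function.LeftInverse.isClosedEmbedding (f := fun x => x i) (fun t => by simp)
        (continuous_apply i) hcont.continuous
    exact hη.2.comp_isClosedEmbedding hemb
  have key := h.integral_deriv_smul (hη.1.comp hcont) hc
  rw [show (η ∘ fun t : ℝ => (i.insertNth t y : Fin (m + 1) → ℝ)) =
    fun t => η (i.insertNth t y) from rfl, hd] at key
  simp_rw [tens_insertNth, Function.update_self, Function.update_of_ne (Fin.succAbove_ne i _),
    ← smul_mul_assoc]
  rw [integral_mul_const, key, integral_mul_const]
  simp

lemma iterate_partialD_regular (i : Fin d) {η : (Fin d → ℝ) → ℝ}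
    (h : ContDiff ℝ ∞ η ∧ HasCompactSupport η) (m : ℕ) :
    ContDiff ℝ ∞ ((partialD i)^[m] η) ∧ HasCompactSupport ((partialD i)^[m] η) := by
  induction m with
  | zero => exact h
  | succ m ih =>
    rw [Function.iterate_succ_apply']
    exact partialD_regular i _ ih

lemma foldr_partialD_regular (α : Fin d → ℕ) {η : (Fin d → ℝ) → ℝ}
    (h : ContDiff ℝ ∞ η ∧ HasCompactSupport η) (l : List (Fin d)) :
    ContDiff ℝ ∞ (l.foldr (fun i g => (partialD i)^[α i] g) η) ∧
      HasCompactSupport (l.foldr (fun i g => (partialD i)^[α i] g) η) := by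
  induction l with
  | nil => exact h
  | cons i l ih => exact iterate_partialD_regular i ih _

lemma integral_iterate_partialD_tens {n : ℕ} {U : Fin d → ℕ → ℝ → ℂ}
    (hi : ∀ i, ∀ s ≤ n, Integrable (U i s)) (hU : ∀ i, ∀ s < n, Prim (U i s) (U i (s + 1)))
    (i : Fin d) (m : ℕ) {γ : Fin d → ℕ} (hγ : ∀ j, γ j ≤ n) (hm : γ i + m ≤ n)
    {η : (Fin d → ℝ) → ℝ} (hη : ContDiff ℝ ∞ η ∧ HasCompactSupport η) :
    ∫ x, (partialD i)^[m] η x • tens (fun j => U j (γ j)) x =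
      (-1) ^ m * ∫ x, η x • tens (fun j => U j (Function.update γ i (γ i + m) j)) x := by
  induction m generalizing η with
  | zero => simp
  | succ m ih =>
    rw [Function.iterate_succ_apply, ih (by omega) (partialD_regular i η hη),
      integral_partialD_tens (v := U i (γ i + m + 1)) _ _ hη]
    · rw [pow_succ, mul_assoc, neg_one_mul]
      congr! 6 with x
      ext j : 1
      rcases eq_or_ne j i with rfl | hj
      · simp [add_assoc]
      · simp [hj]
    · intro j
      apply hi
      rcases eq_or_ne j i with rfl | hj
      · simp; omega
      · simpa [hj] using hγ j
    · simpa using hU i (γ i + m) (by omega)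

/-- Here γ records the orders already transferred to the tensor product, so that the induction can
run over the list. Absence of repetitions means that each coordinate is raised once. -/
lemma integral_foldr_partialD_tens {n : ℕ} {U : Fin d → ℕ → ℝ → ℂ}
    (hi : ∀ i, ∀ s ≤ n, Integrable (U i s)) (hU : ∀ i, ∀ s < n, Prim (U i s) (U i (s + 1)))
    (α : Fin d → ℕ) (l : List (Fin d)) (hl : l.Nodup) {γ : Fin d → ℕ} (hγ : ∀ j, γ j ≤ n)
    (hγα : ∀ j ∈ l, γ j + α j ≤ n)
    {η : (Fin d → ℝ) → ℝ} (hη : ContDiff ℝ ∞ η ∧ HasCompactSupport η) :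
    ∫ x, (l.foldr (fun i g => (partialD i)^[α i] g) η) x • tens (fun j => U j (γ j)) x =
      (-1) ^ (l.map α).sum *
        ∫ x, η x • tens (fun j => U j (if j ∈ l then γ j + α j else γ j)) x := by
  induction l generalizing γ with
  | nil => simp
  | cons i l ih =>
    rw [List.nodup_cons] at hl
    have hle : ∀ j, Function.update γ i (γ i + α i) j ≤ n := by
      intro j
      rcases eq_or_ne j i with rfl | hj
      · simpa using hγα j (by simp)
      · simpa [hj] using hγ j
    have e : (fun j => U j (if j ∈ l then Function.update γ i (γ i + α i) j + α j else
        Function.update γ i (γ i + α i) j)) =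
        fun j => U j (if j ∈ i :: l then γ j + α j else γ j) := by
      ext j : 1
      rcases eq_or_ne j i with rfl | hj
      · simp [hl.1]
      · simp [hj]
    rw [List.foldr_cons, integral_iterate_partialD_tens hi hU i (α i) hγ (hγα i (by simp))
      (foldr_partialD_regular α hη l), ih hl.2 hle, List.map_cons, List.sum_cons, pow_add,
      mul_assoc, e]
    · intro j hj
      have : j ≠ i := fun h => hl.1 (h ▸ hj)
      simpa [this] using hγα j (by simp [hj])

lemma Chain.hasWeakDeriv_tens {b : ℝ} (hb : 0 < b) {n : ℕ} {U : Fin d → ℕ → ℝ → ℂ}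
    (hU : ∀ i, Chain b n (U i)) {α : Fin d → ℕ} (hα : α ≤ fun _ => n) :
    HasWeakDeriv α (tens fun i => U i 0) (tens fun i => U i (α i)) := by
  have hi : ∀ i, ∀ s ≤ n, Integrable (U i s) := fun i s hs => ((hU i).inA s hs).integrable hb
  refine ⟨(integrable_tens fun i => hi i 0 (Nat.zero_le _)).locallyIntegrable,
    (integrable_tens fun i => hi i _ (hα i)).locallyIntegrable, fun η h1 h2 => ?_⟩
  have := integral_foldr_partialD_tens hi (fun i => (hU i).prim) α (List.finRange d)
    (List.nodup_finRange d) (γ := fun _ => 0) (fun _ => Nat.zero_le _)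
    (fun j _ => by simpa using hα j) ⟨h1, h2⟩
  simpa [multiD, Fin.sum_univ_def] using this

lemma Chain.tens_mem_X {b : ℝ} (hb : 0 < b) {n : ℕ} {U : Fin d → ℕ → ℝ → ℂ}
    (hU : ∀ i, Chain b n (U i)) : (tens fun i => U i 0) ∈ X b (fun _ : Fin d => n) :=
  fun _ hα => ⟨_, Chain.hasWeakDeriv_tens hb hU hα, fun _ hβ =>
    MemLp.weighted (aestronglyMeasurable_tens fun i =>
      ((hU i).inA _ (hα i)).aestronglyMeasurable) (memLp_wtd_tens fun i => (hU i).inA _ (hα i)) hβ⟩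

end tens

end

/-! ### Dual elements as sums of L² pairings. -/

section

/-! ### Representation of bounded functionals -/

variable {d : ℕ}

lemma HasWeakDeriv.ae_eq {α : Fin d → ℕ} {φ g h : (Fin d → ℝ) → ℂ} (hg : HasWeakDeriv α φ g)
    (hh : HasWeakDeriv α φ h) : g =ᵐ[volume] h := by
  refine ae_eq_of_integral_contDiff_smul_eq hg.2.1 hh.2.1 fun η h1 h2 => ?_
  have := (hg.2.2 η h1 h2).symm.trans (hh.2.2 η h1 h2)
  exact mul_left_cancel₀ (pow_ne_zero _ (by norm_num)) this

lemma weighted_congr {b : ℝ} {β : Fin d → ℕ} {g h : (Fin d → ℝ) → ℂ} (hgh : g =ᵐ[volume] h) :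
    weighted b β g =ᵐ[volume] weighted b β h := by
  filter_upwards [hgh] with x hx
  simp [weighted, hx]

lemma hasWeakDeriv_weakDeriv {b : ℝ} {s : Fin d → ℕ} {φ : (Fin d → ℝ) → ℂ} (hφ : φ ∈ X b s)
    {α : Fin d → ℕ} (hα : α ≤ s) : HasWeakDeriv α φ (weakDeriv α φ) := by
  obtain ⟨g, hg, -⟩ := hφ α hα
  have h : ∃ g, HasWeakDeriv α φ g := ⟨g, hg⟩
  rw [weakDeriv, dif_pos h]
  exact h.choose_spec

lemma memLp_weighted_weakDeriv {b : ℝ} {s : Fin d → ℕ} {φ : (Fin d → ℝ) → ℂ} (hφ : φ ∈ X b s)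
    {α β : Fin d → ℕ} (hα : α ≤ s) (hβ : β ≤ s) : MemLp (weighted b β (weakDeriv α φ)) 2 := by
  obtain ⟨g, hg, hg'⟩ := hφ α hα
  exact (hg' β hβ).ae_eq (weighted_congr (hg.ae_eq (hasWeakDeriv_weakDeriv hφ hα)))

lemma weakDeriv_add {b : ℝ} {s : Fin d → ℕ} {φ ψ : (Fin d → ℝ) → ℂ} (hφ : φ ∈ X b s)
    (hψ : ψ ∈ X b s) {α : Fin d → ℕ} (hα : α ≤ s) :
    weakDeriv α (φ + ψ) =ᵐ[volume] weakDeriv α φ + weakDeriv α ψ := by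
  refine (hasWeakDeriv_weakDeriv ((X b s).add_mem hφ hψ) hα).ae_eq
    ((hasWeakDeriv_weakDeriv hφ hα).add (hasWeakDeriv_weakDeriv hψ hα) fun η h1 h2 => ?_)
  exact ⟨(multiD_regular α η ⟨h1, h2⟩).1.continuous, (multiD_regular α η ⟨h1, h2⟩).2⟩

lemma HasWeakDeriv.const_smul {α : Fin d → ℕ} {φ g : (Fin d → ℝ) → ℂ} (hg : HasWeakDeriv α φ g)
    (c : ℂ) : HasWeakDeriv α (c • φ) (c • g) := by
  refine ⟨hg.1.smul c, hg.2.1.smul c, fun η h1 h2 => ?_⟩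
  simp only [Pi.smul_apply, smul_comm _ c, integral_smul]
  rw [hg.2.2 η h1 h2]
  simp only [smul_eq_mul]
  ring

lemma weakDeriv_smul {b : ℝ} {s : Fin d → ℕ} {φ : (Fin d → ℝ) → ℂ} (hφ : φ ∈ X b s) (c : ℂ)
    {α : Fin d → ℕ} (hα : α ≤ s) : weakDeriv α (c • φ) =ᵐ[volume] c • weakDeriv α φ :=
  (hasWeakDeriv_weakDeriv ((X b s).smul_mem c hφ) hα).ae_eq
    ((hasWeakDeriv_weakDeriv hφ hα).const_smul c)

/-- The embedding of `X_b^s` into a finite product of `L²`-spaces. -/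
def embX (b : ℝ) (s : Fin d → ℕ) :
    X b s →ₗ[ℂ] (Finset.Iic s × Finset.Iic s → Lp ℂ 2 (volume : Measure (Fin d → ℝ))) where
  toFun φ p := (memLp_weighted_weakDeriv φ.2 (Finset.mem_Iic.1 p.1.2)
    (Finset.mem_Iic.1 p.2.2)).toLp
  map_add' φ ψ := by
    ext1 p
    rw [Pi.add_apply, ← MemLp.toLp_add]
    refine MemLp.toLp_congr _ _ ((weighted_congr
      (weakDeriv_add φ.2 ψ.2 (Finset.mem_Iic.1 p.1.2))).trans (Eventually.of_forall fun x => ?_))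
    simp [weighted]
  map_smul' c φ := by
    ext1 p
    rw [Pi.smul_apply, RingHom.id_apply, ← MemLp.toLp_const_smul]
    refine MemLp.toLp_congr _ _ ((weighted_congr
      (weakDeriv_smul φ.2 c (Finset.mem_Iic.1 p.1.2))).trans (Eventually.of_forall fun x => ?_))
    simp only [weighted, Pi.smul_apply]
    rw [smul_comm]

lemma xNorm_eq_sum_embX {b : ℝ} {s : Fin d → ℕ} (φ : X b s) :
    xNorm b s φ = ∑ p, ‖embX b s φ p‖ := by
  rw [Fintype.sum_prod_type, xNorm, ← Finset.sum_coe_sort]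
  refine Finset.sum_congr rfl fun α _ => ?_
  rw [← Finset.sum_coe_sort]
  refine Finset.sum_congr rfl fun β _ => ?_
  rw [embX, LinearMap.coe_mk, AddHom.coe_mk, Lp.norm_toLp]

/-- Boundedness makes f vanish on the kernel of `embX`, so f descends to the range and extends by
Hahn-Banach. The cardinality compares the sum norm with the supremum norm of the finite product. -/
lemma XDual.exists_extension {b : ℝ} {s : Fin d → ℕ} (f : XDual b s) :
    ∃ F : (Finset.Iic s × Finset.Iic s → Lp ℂ 2 (volume : Measure (Fin d → ℝ))) →L[ℂ] ℂ,
      ∀ φ, F (embX b s φ) = f.toLin φ := by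
  obtain ⟨C, hC⟩ := f.bounded
  have hbound : ∀ φ, ‖f.toLin φ‖ ≤
      (|C| * Fintype.card (Finset.Iic s × Finset.Iic s)) * ‖embX b s φ‖ := by
    intro φ
    refine (hC φ).trans ?_
    rw [xNorm_eq_sum_embX, mul_assoc]
    have h1 : ∑ p, ‖embX b s φ p‖ ≤
        Fintype.card (Finset.Iic s × Finset.Iic s) * ‖embX b s φ‖ := by
      have := Finset.sum_le_card_nsmul Finset.univ (fun p => ‖embX b s φ p‖) ‖embX b s φ‖
        fun p _ => norm_le_pi_norm _ p
      simpa [nsmul_eq_mul] using this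
    exact mul_le_mul (le_abs_self C) h1 (Finset.sum_nonneg fun _ _ => norm_nonneg _) (abs_nonneg C)
  have hker : LinearMap.ker (embX b s) ≤ LinearMap.ker f.toLin := by
    intro φ hφ
    rw [LinearMap.mem_ker] at hφ ⊢
    have := hbound φ
    rw [hφ, norm_zero, mul_zero] at this
    exact norm_le_zero_iff.1 this
  let g : LinearMap.range (embX b s) →ₗ[ℂ] ℂ :=
    ((LinearMap.ker (embX b s)).liftQ f.toLin hker).comp
      (embX b s).quotKerEquivRange.symm.toLinearMap
  have hg : ∀ φ, g ⟨embX b s φ, LinearMap.mem_range_self _ φ⟩ = f.toLin φ := by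
    intro φ
    have : (embX b s).quotKerEquivRange.symm ⟨embX b s φ, LinearMap.mem_range_self _ φ⟩ =
        (LinearMap.ker (embX b s)).mkQ φ := by
      rw [LinearEquiv.symm_apply_eq]
      rfl
    simp only [g, LinearMap.comp_apply, LinearEquiv.coe_coe, this]
    exact Submodule.liftQ_apply _ _ _
  obtain ⟨F, hF, -⟩ := exists_extension_norm_eq (LinearMap.range (embX b s))
    (g.mkContinuous (|C| * Fintype.card (Finset.Iic s × Finset.Iic s)) (by
      rintro ⟨_, φ, rfl⟩
      rw [hg]
      exact hbound φ))
  exact ⟨F, fun φ => (hF ⟨_, LinearMap.mem_range_self _ φ⟩).trans (hg φ)⟩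

/-- The weight `e^{b|x|₁} x^β` divided by `wtd b n`. -/
def relWeight (b : ℝ) (n : ℕ) (β : Fin d → ℕ) (x : Fin d → ℝ) : ℝ :=
  (wtd b n x)⁻¹ * (Real.exp (b * l1 x) * ∏ i, x i ^ β i)

lemma continuous_relWeight (b : ℝ) (n : ℕ) (β : Fin d → ℕ) : Continuous (relWeight b n β) := by
  have h1 := (continuous_wtd (d := d) b n).inv₀ fun x => (wtd_pos b n x).ne'
  have h2 : Continuous fun x : Fin d → ℝ => Real.exp (b * l1 x) * ∏ i, x i ^ β i := by
    unfold l1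
    fun_prop
  exact h1.mul h2

lemma norm_relWeight_le {b : ℝ} {n : ℕ} {β : Fin d → ℕ} (hβ : β ≤ fun _ => n) (x : Fin d → ℝ) :
    ‖relWeight b n β x‖ ≤ 1 := by
  rw [relWeight, norm_mul, norm_inv, Real.norm_of_nonneg (wtd_pos _ _ _).le,
    inv_mul_le_iff₀ (wtd_pos _ _ _), mul_one]
  exact abs_weight_le_wtd hβ x

/-- Riesz represents each component of the extension. As every weight e^(b|x|₁)x^β is `wtd b n`
times a function bounded by 1, the terms for all β merge into a single L² function `H α`. -/
lemma XDual.exists_repr {b : ℝ} {n : ℕ} {s : Fin d → ℕ} (hs : ∀ β ≤ s, β ≤ fun _ => n)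
    (f : XDual b s) :
    ∃ H : (Fin d → ℕ) → (Fin d → ℝ) → ℂ, (∀ α, MemLp (H α) 2 volume) ∧
      ∀ (φ : (Fin d → ℝ) → ℂ) (hφ : φ ∈ X b s) (g : (Fin d → ℕ) → (Fin d → ℝ) → ℂ),
        (∀ α ≤ s, HasWeakDeriv α φ (g α)) →
        (∀ α ≤ s, MemLp (fun x => wtd b n x • g α x) 2 volume) →
        f.toLin ⟨φ, hφ⟩ = ∑ α ∈ Finset.Iic s, ∫ y, H α y * (wtd b n y • g α y) := by
  obtain ⟨F, hF⟩ := f.exists_extension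
  let h : Finset.Iic s → Finset.Iic s → Lp ℂ 2 (volume : Measure (Fin d → ℝ)) := fun α β =>
    (InnerProductSpace.toDual ℂ _).symm
      (F.comp (ContinuousLinearMap.single ℂ (fun _ => Lp ℂ 2 (volume : Measure (Fin d → ℝ))) (α, β)))
  have hh : ∀ v, F v = ∑ α, ∑ β, ∫ y, inner ℂ (h α β y) (v (α, β) y) := by
    intro v
    conv_lhs => rw [← LinearMap.sum_single_apply _ v]
    rw [map_sum, Fintype.sum_prod_type]
    refine Finset.sum_congr rfl fun α _ => Finset.sum_congr rfl fun β _ => ?_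
    rw [← L2.inner_def, InnerProductSpace.toDual_symm_apply]
    rfl
  have hK : ∀ α β, MemLp (fun y => relWeight b n β.1 y • (starRingEnd ℂ) (h α β y)) 2 volume := by
    intro α β
    refine MemLp.of_le (Lp.memLp (h α β)) ((continuous_relWeight b n _).aestronglyMeasurable.smul
      (Complex.continuous_conj.comp_aestronglyMeasurable (Lp.aestronglyMeasurable _)))
      (Eventually.of_forall fun y => ?_)
    rw [norm_smul, RCLike.norm_conj]
    exact mul_le_of_le_one_left (norm_nonneg _) (norm_relWeight_le (hs _ (Finset.mem_Iic.1 β.2)) y)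
  refine ⟨fun α => if hα : α ∈ Finset.Iic s then
    fun y => ∑ β, relWeight b n β.1 y • (starRingEnd ℂ) (h ⟨α, hα⟩ β y) else 0, fun α => ?_, ?_⟩
  · beta_reduce
    split_ifs with hα
    · exact memLp_finsetSum _ fun β _ => hK ⟨α, hα⟩ β
    · exact MemLp.zero
  · intro φ hφ g hg hg'
    rw [← hF, hh, ← Finset.sum_coe_sort (Finset.Iic s)]
    refine Finset.sum_congr rfl fun α _ => ?_
    have hα := Finset.mem_Iic.1 α.2
    simp only [α.2, dif_pos, Finset.sum_mul]
    rw [integral_finsetSum]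
    · refine Finset.sum_congr rfl fun β _ => integral_congr_ae ?_
      have h1 : embX b s ⟨φ, hφ⟩ (α, β) =ᵐ[volume] weighted b β.1 (weakDeriv α.1 φ) :=
        MemLp.coeFn_toLp (memLp_weighted_weakDeriv hφ hα (Finset.mem_Iic.1 β.2))
      filter_upwards [h1, weighted_congr (b := b) (β := β.1)
        ((hasWeakDeriv_weakDeriv hφ hα).ae_eq (hg _ hα))] with y h2 h3
      rw [h2, h3, RCLike.inner_apply, weighted, relWeight]
      have := (wtd_pos b n y).ne'
      simp only [Complex.real_smul]
      push_cast
      have h4 : (wtd b n y : ℂ) ≠ 0 := by exact_mod_cast this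
      field_simp
    · intro β _
      exact (hK α β).integrable_mul (hg' _ hα)

end

/-! ### Continuity, growth and associativity of the L² pairings. -/

section

variable {d : ℕ}

/-! ### Convolutions in the duality of weighted `L²`-spaces -/

lemma tendsto_eLpNorm_translate {H : (Fin d → ℝ) → ℂ} (hH : MemLp H 2 volume) (x₀ : Fin d → ℝ) :
    Tendsto (fun x => eLpNorm ((fun t => H (x - t)) - fun t => H (x₀ - t)) 2 volume) (𝓝 x₀)
      (𝓝 0) := by
  let g : (Fin d → ℝ) → C(Fin d → ℝ, Fin d → ℝ) := fun x => ⟨fun t => x - t, by fun_prop⟩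
  have hg : Continuous g := ContinuousMap.continuous_of_continuous_uncurry g (by
    change Continuous fun p : (Fin d → ℝ) × (Fin d → ℝ) => p.1 - p.2
    fun_prop)
  have hm : ∀ x, MeasurePreserving (g x) volume volume := fun x =>
    Measure.measurePreserving_sub_left (volume : Measure (Fin d → ℝ)) x
  have h := Filter.Tendsto.compMeasurePreservingLp (tendsto_const_nhds (x := hH.toLp))
    (hg.tendsto x₀) hm (hm x₀) (by simp : (2 : ℝ≥0∞) ≠ ⊤)
  simp only [Lp.toLp_compMeasurePreserving] at h
  rw [Lp.tendsto_Lp_iff_tendsto_eLpNorm] at h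
  refine h.congr fun x => eLpNorm_congr_ae ?_
  exact (MemLp.coeFn_toLp (hH.comp_measurePreserving (hm x))).sub (EventuallyEq.refl _ _)

lemma enorm_integral_mul_le {α : Type*} [MeasurableSpace α] {μ : Measure α} {f g : α → ℂ}
    (hf : AEStronglyMeasurable f μ) (hg : AEStronglyMeasurable g μ) :
    ‖∫ a, f a * g a ∂μ‖ₑ ≤ eLpNorm f 2 μ * eLpNorm g 2 μ := by
  refine (enorm_integral_le_lintegral_enorm _).trans ?_
  simp_rw [enorm_mul]
  have h := ENNReal.lintegral_mul_le_Lp_mul_Lq μ Real.HolderConjugate.two_two hf.enorm hg.enorm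
  rw [eLpNorm_eq_lintegral_rpow_enorm_toReal two_ne_zero ENNReal.ofNat_ne_top,
    eLpNorm_eq_lintegral_rpow_enorm_toReal two_ne_zero ENNReal.ofNat_ne_top]
  exact h

/-- The pairing of `v(x - ·)` with `wtd b n • H`. -/
def pair (b : ℝ) (n : ℕ) (H v : (Fin d → ℝ) → ℂ) (x : Fin d → ℝ) : ℂ :=
  ∫ y, H y * (wtd b n y • v (x - y))

lemma pair_eq (b : ℝ) (n : ℕ) (H v : (Fin d → ℝ) → ℂ) (x : Fin d → ℝ) :
    pair b n H v x =
      ∫ t, H (x - t) * ((wtd b n (x - t) * (wtd b n t)⁻¹) • (wtd b n t • v t)) := by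
  rw [pair, ← integral_sub_left_eq_self _ volume x]
  congr 1; ext t
  rw [smul_smul, inv_mul_cancel_right₀ (wtd_pos _ _ _).ne', sub_sub_cancel]

lemma wtd_sub_mul_inv_le {b : ℝ} (hb : 0 ≤ b) (n : ℕ) (x t : Fin d → ℝ) :
    wtd b n (x - t) * (wtd b n t)⁻¹ ≤ wtd b n x := by
  rw [← div_eq_mul_inv, div_le_iff₀ (wtd_pos _ _ _)]
  exact wtd_sub_le hb n x t

lemma memLp_wtd_sub_smul {b : ℝ} (hb : 0 ≤ b) {n : ℕ} {V : (Fin d → ℝ) → ℂ}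
    (hV : MemLp V 2 volume) (x : Fin d → ℝ) :
    MemLp (fun t => (wtd b n (x - t) * (wtd b n t)⁻¹) • V t) 2 volume := by
  have hc : Continuous fun t : Fin d → ℝ => wtd b n (x - t) * (wtd b n t)⁻¹ :=
    ((continuous_wtd b n).comp (by fun_prop)).mul
      ((continuous_wtd b n).inv₀ fun t => (wtd_pos b n t).ne')
  refine MemLp.of_le_mul (c := wtd b n x) hV (hc.aestronglyMeasurable.smul hV.1)
    (Eventually.of_forall fun t => ?_)
  rw [norm_smul, norm_mul, norm_inv, Real.norm_of_nonneg (wtd_pos _ _ _).le,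
    Real.norm_of_nonneg (wtd_pos _ _ _).le]
  gcongr
  exact wtd_sub_mul_inv_le hb n x t

lemma enorm_integral_mul_wtd_sub_le {b : ℝ} (hb : 0 ≤ b) {n : ℕ} {G V : (Fin d → ℝ) → ℂ}
    (hG : AEStronglyMeasurable G volume) (hV : MemLp V 2 volume) (x : Fin d → ℝ) :
    ‖∫ t, G t * ((wtd b n (x - t) * (wtd b n t)⁻¹) • V t)‖ₑ ≤
      eLpNorm G 2 volume * (ENNReal.ofReal (wtd b n x) * eLpNorm V 2 volume) := by
  refine (enorm_integral_mul_le hG (memLp_wtd_sub_smul hb hV x).1).trans ?_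
  gcongr
  refine eLpNorm_le_mul_eLpNorm_of_ae_le_mul (Eventually.of_forall fun t => ?_) 2
  rw [norm_smul, norm_mul, norm_inv, Real.norm_of_nonneg (wtd_pos _ _ _).le,
    Real.norm_of_nonneg (wtd_pos _ _ _).le]
  gcongr
  exact wtd_sub_mul_inv_le hb n x t

lemma exists_norm_pair_le {b : ℝ} (hb : 0 ≤ b) {n : ℕ} {H v : (Fin d → ℝ) → ℂ}
    (hH : MemLp H 2 volume) (hv : MemLp (fun x => wtd b n x • v x) 2 volume) :
    ∃ C : ℝ, ∀ x, ‖pair b n H v x‖ ≤ C * wtd b n x := by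
  refine ⟨(eLpNorm H 2 volume * eLpNorm (fun x => wtd b n x • v x) 2 volume).toReal, fun x => ?_⟩
  have hs := Measure.measurePreserving_sub_left (volume : Measure (Fin d → ℝ)) x
  have h := enorm_integral_mul_wtd_sub_le (G := fun t => H (x - t)) hb (n := n)
    (hH.comp_measurePreserving hs).1 hv x
  rw [← pair_eq, show eLpNorm (fun t => H (x - t)) 2 volume = eLpNorm H 2 volume from
    eLpNorm_comp_measurePreserving hH.1 hs] at h
  have h2 := ENNReal.toReal_mono (ENNReal.mul_ne_top hH.2.ne
    (ENNReal.mul_ne_top ENNReal.ofReal_ne_top hv.2.ne)) h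
  rw [toReal_enorm] at h2
  refine h2.trans (le_of_eq ?_)
  rw [ENNReal.toReal_mul, ENNReal.toReal_mul, ENNReal.toReal_ofReal (wtd_pos _ _ _).le,
    ENNReal.toReal_mul]
  ring

/-- After substitution x enters through `H` and through a quotient of weights. The first dependence
is continuous because translation is continuous in L², the second by dominated convergence. -/
lemma continuous_pair {b : ℝ} (hb : 0 ≤ b) {n : ℕ} {H v : (Fin d → ℝ) → ℂ}
    (hH : MemLp H 2 volume) (hv : MemLp (fun x => wtd b n x • v x) 2 volume) :
    Continuous (pair b n H v) := by
  rw [continuous_iff_continuousAt]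
  intro x₀
  obtain ⟨V, hV⟩ : ∃ V : (Fin d → ℝ) → ℂ, V = fun x => wtd b n x • v x := ⟨_, rfl⟩
  rw [← hV] at hv
  have hs := fun x => Measure.measurePreserving_sub_left (volume : Measure (Fin d → ℝ)) x
  have hHx := fun x => hH.comp_measurePreserving (hs x)
  have hpe : ∀ x, pair b n H v x =
      ∫ t, H (x - t) * ((wtd b n (x - t) * (wtd b n t)⁻¹) • V t) := by
    intro x; rw [pair_eq, hV]
  have hi := fun x x' => (hHx x).integrable_mul (memLp_wtd_sub_smul hb (n := n) hv x')
  have hWc := (continuous_wtd (d := d) b n)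
  have hbd : ∀ᶠ x in 𝓝 x₀, wtd b n x ≤ wtd b n x₀ + 1 :=
    (hWc.tendsto x₀).eventually (eventually_le_nhds (by linarith))
  have L1 : Tendsto (fun x => ∫ t, (H (x - t) - H (x₀ - t)) *
      ((wtd b n (x - t) * (wtd b n t)⁻¹) • V t)) (𝓝 x₀) (𝓝 0) := by
    have hK : ENNReal.ofReal (wtd b n x₀ + 1) * eLpNorm V 2 volume ≠ ⊤ :=
      ENNReal.mul_ne_top ENNReal.ofReal_ne_top hv.2.ne
    have hT := ENNReal.Tendsto.mul_const (tendsto_eLpNorm_translate hH x₀) (Or.inr hK)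
    rw [zero_mul] at hT
    rw [tendsto_iff_edist_tendsto_0]
    refine tendsto_of_tendsto_of_tendsto_of_le_of_le' tendsto_const_nhds hT
      (Eventually.of_forall fun _ => zero_le) ?_
    filter_upwards [hbd] with x hx
    rw [edist_zero_right]
    refine (enorm_integral_mul_wtd_sub_le hb ((hHx x).1.sub (hHx x₀).1) hv x).trans ?_
    exact mul_le_mul_right (mul_le_mul_left (ENNReal.ofReal_le_ofReal hx) _) _
  have L2 : Tendsto (fun x => ∫ t, H (x₀ - t) *
      ((wtd b n (x - t) * (wtd b n t)⁻¹) • V t)) (𝓝 x₀) (𝓝 (pair b n H v x₀)) := by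
    rw [hpe]
    refine tendsto_integral_filter_of_dominated_convergence
      (fun t => (wtd b n x₀ + 1) * (‖H (x₀ - t)‖ * ‖V t‖)) (Eventually.of_forall fun x =>
        ((hi x₀ x).1)) ?_ ?_ (Eventually.of_forall fun t => ?_)
    · filter_upwards [hbd] with x hx
      refine Eventually.of_forall fun t => ?_
      rw [norm_mul, norm_smul, norm_mul, norm_inv, Real.norm_of_nonneg (wtd_pos _ _ _).le,
        Real.norm_of_nonneg (wtd_pos _ _ _).le, mul_left_comm]
      gcongr
      exact (wtd_sub_mul_inv_le hb n x t).trans hx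
    · have := ((hHx x₀).norm.integrable_mul hv.norm).const_mul (wtd b n x₀ + 1)
      exact this
    · refine tendsto_const_nhds.mul (Tendsto.smul_const (Tendsto.mul_const _ ?_) _)
      exact (hWc.comp (by fun_prop : Continuous fun x : Fin d → ℝ => x - t)).tendsto x₀
  have L3 := L1.add L2
  rw [zero_add] at L3
  refine L3.congr fun x => ?_
  rw [hpe, ← integral_add]
  · congr 1; ext t; ring
  · refine ((hi x x).sub (hi x₀ x)).congr (Eventually.of_forall fun t => ?_)
    simp [sub_mul]
  · exact hi x₀ x

lemma cv_tens (k u : Fin d → ℝ → ℂ) (x : Fin d → ℝ) :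
    ∫ z, tens k z * tens u (x - z) = tens (fun i => cv (k i) (u i)) x := by
  have := integral_fintype_prod_volume_eq_prod (𝕜 := ℂ)
    (fun (i : Fin d) (t : ℝ) => k i t * u i (x i - t))
  simp only [tens, ← Finset.prod_mul_distrib, Pi.sub_apply]
  exact this

lemma quasiMeasurePreserving_sub_sub (x : Fin d → ℝ) : Measure.QuasiMeasurePreserving
    (fun p : (Fin d → ℝ) × (Fin d → ℝ) => x - p.1 - p.2) (volume.prod volume) volume := by
  have h := (Measure.measurePreserving_sub_left (volume : Measure (Fin d → ℝ))
    x).quasiMeasurePreserving.comp (quasiMeasurePreserving_add volume volume)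
  simpa [Function.comp_def, sub_sub] using h

/-- Fubini, with absolute convergence because the coordinatewise convolutions of |k| and |u| stay in
the weighted class and so pair with `H` in L². -/
lemma integral_tens_mul_pair {b : ℝ} (hb : 0 < b) {n : ℕ} (hn : 1 ≤ n) {H : (Fin d → ℝ) → ℂ}
    (hH : MemLp H 2 volume) {k u : Fin d → ℝ → ℂ} (hk : ∀ i, InA b n (k i))
    (hu : ∀ i, InA b n (u i)) (x : Fin d → ℝ) :
    Integrable (fun z => tens k z * pair b n H (tens u) (x - z)) ∧
      ∫ z, tens k z * pair b n H (tens u) (x - z) =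
        pair b n H (tens fun i => cv (k i) (u i)) x := by
  have hs := fun x => Measure.measurePreserving_sub_left (volume : Measure (Fin d → ℝ)) x
  have hkm := aestronglyMeasurable_tens fun i => (hk i).aestronglyMeasurable
  have hum := aestronglyMeasurable_tens fun i => (hu i).aestronglyMeasurable
  have hk2 : MemLp (tens k) 2 volume := memLp_tens fun i => (hk i).memLp hb.le
  have hu2 : MemLp (tens u) 2 volume := memLp_tens fun i => (hu i).memLp hb.le
  have hint : Integrable (Function.uncurry fun z y =>
      tens k z * (H y * (wtd b n y • tens u (x - z - y)))) (volume.prod volume) := by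
    rw [integrable_prod_iff']
    · refine ⟨Eventually.of_forall fun y => ?_, ?_⟩
      · have h1 := hk2.integrable_mul (hu2.comp_measurePreserving (hs (x - y)))
        refine (h1.const_mul (H y * wtd b n y)).congr (Eventually.of_forall fun z => ?_)
        simp only [Function.uncurry_apply_pair, Pi.mul_apply, Function.comp_apply,
          Complex.real_smul]
        rw [sub_right_comm]
        ring
      · have e : ∀ y, ∫ z, ‖Function.uncurry (fun z y =>
            tens k z * (H y * (wtd b n y • tens u (x - z - y)))) (z, y)‖ =
            ‖H y‖ * ‖wtd b n y • tens (fun i t => cv (fun s => (‖k i s‖ : ℂ))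
              (fun s => (‖u i s‖ : ℂ)) (x i - t)) y‖ := by
          intro y
          have h1 := cv_tens (fun i s => (‖k i s‖ : ℂ)) (fun i s => (‖u i s‖ : ℂ)) (x - y)
          have h2 : ∀ z, tens (fun i s => (‖k i s‖ : ℂ)) z *
              tens (fun i s => (‖u i s‖ : ℂ)) (x - y - z) =
              ((‖tens k z‖ * ‖tens u (x - y - z)‖ : ℝ) : ℂ) := by
            intro z; simp [tens]
          simp_rw [h2] at h1
          rw [integral_complex_ofReal] at h1
          have h3 := congrArg norm h1
          rw [Complex.norm_real, Real.norm_of_nonneg (by positivity)] at h3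
          have h4 : ‖tens (fun i t => cv (fun s => (‖k i s‖ : ℂ))
              (fun s => (‖u i s‖ : ℂ)) (x i - t)) y‖ =
              ∫ z, ‖tens k z‖ * ‖tens u (x - y - z)‖ := by
            rw [h3]; simp [tens]
          rw [norm_smul, Real.norm_of_nonneg (wtd_pos _ _ _).le, h4, ← integral_const_mul,
            ← integral_const_mul]
          congr 1; ext z
          simp only [Function.uncurry_apply_pair, norm_mul, norm_smul]
          rw [Real.norm_of_nonneg (wtd_pos _ _ _).le, sub_right_comm x z y]
          ring
        simp_rw [e]
        exact hH.norm.integrable_mul (memLp_wtd_tens fun i =>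
          (InA.cv hb.le hn (hk i).norm (hu i).norm).comp_sub_left hb.le (x i)).norm
    · refine hkm.comp_fst.mul (hH.1.comp_snd.mul
        (((continuous_wtd b n).comp continuous_snd).aestronglyMeasurable.smul ?_))
      exact hum.comp_quasiMeasurePreserving (quasiMeasurePreserving_sub_sub x)
  simp only [pair]
  simp_rw [← integral_const_mul]
  refine ⟨hint.integral_prod_left, ?_⟩
  rw [integral_integral_swap hint]
  congr 1; ext y
  rw [← cv_tens, ← integral_smul, ← integral_const_mul]
  congr 1; ext z
  rw [sub_right_comm]
  simp only [Complex.real_smul]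
  ring

end

/-! ### The reproducing inequality for functionals. -/

section

variable {d : ℕ}

/-! ### The reproducing formula -/

/-- The functions `H` depend on f alone and serve all test functions. The signs come from
differentiating the reflected function y ↦ Φ(x - y). -/
lemma XDual.exists_conv_eq {b : ℝ} (hb : 0 < b) {n : ℕ} (f : XDual b (fun _ : Fin d => n)) :
    ∃ H : (Fin d → ℕ) → (Fin d → ℝ) → ℂ, (∀ α, MemLp (H α) 2 volume) ∧
      ∀ U : Fin d → ℕ → ℝ → ℂ, (∀ i, Chain b n (U i)) → ∀ x,
        conv (tens fun i => U i 0) f x = ∑ α ∈ Finset.Iic (fun _ : Fin d => n),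
          (-1) ^ (∑ i, α i) * pair b n (H α) (tens fun i => U i (α i)) x := by
  obtain ⟨H, hH, h⟩ := f.exists_repr (n := n) fun _ hβ => hβ
  refine ⟨H, hH, fun U hU x => ?_⟩
  have hV := fun i => (hU i).reflect hb.le (x i)
  have e0 : (fun y => tens (fun i => U i 0) (x - y)) =
      tens fun i y => (-1) ^ 0 * U i 0 (x i - y) := by
    ext y; simp [tens]
  have hmem : (fun y => tens (fun i => U i 0) (x - y)) ∈ X b fun _ : Fin d => n := by
    rw [e0]; exact Chain.tens_mem_X hb hV
  rw [conv, dif_pos hmem]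
  rw [h _ hmem (fun α => tens fun i y => (-1) ^ α i * U i (α i) (x i - y))]
  · refine Finset.sum_congr rfl fun α _ => ?_
    rw [pair, ← integral_const_mul]
    congr 1; ext y
    simp only [tens, Finset.prod_mul_distrib, Finset.prod_pow_eq_pow_sum, Complex.real_smul,
      Pi.sub_apply]
    ring
  · intro α hα
    rw [e0]
    exact Chain.hasWeakDeriv_tens hb hV hα
  · exact fun α hα => memLp_wtd_tens fun i => (hV i).inA _ (hα i)

variable {b : ℝ} {n : ℕ} {hb : 0 < b} {hn : 1 ≤ n}

open AlgA

lemma continuous_conv_tens (f : XDual b (fun _ : Fin d => n)) {u : Fin d → AlgA b n hb hn}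
    (hu : ∀ i, Smooth (u i)) : Continuous (conv (tens fun i => (u i).fn) f) := by
  obtain ⟨H, hH, h⟩ := f.exists_conv_eq hb
  choose U hU hU0 using hu
  simp_rw [← hU0]
  rw [funext (h U hU)]
  refine continuous_finsetSum _ fun α hα => continuous_const.mul (continuous_pair hb.le (hH α) ?_)
  exact memLp_wtd_tens fun i => (hU i).inA _ (Finset.mem_Iic.1 hα i)

/-- The constant depends on f. The bound serves only to justify a limit and does not enter the final
constants. -/
lemma exists_norm_conv_tens_le (f : XDual b (fun _ : Fin d => n)) {u : Fin d → AlgA b n hb hn}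
    (hu : ∀ i, Smooth (u i)) :
    ∃ C : ℝ, ∀ x, ‖conv (tens fun i => (u i).fn) f x‖ ≤ C * wtd b n x := by
  obtain ⟨H, hH, h⟩ := f.exists_conv_eq hb
  choose U hU hU0 using hu
  simp_rw [← hU0]
  have hp : ∀ α : Fin d → ℕ, ∃ C : ℝ, α ∈ Finset.Iic (fun _ : Fin d => n) → ∀ x,
      ‖pair b n (H α) (tens fun i => U i (α i)) x‖ ≤ C * wtd b n x := by
    intro α
    by_cases hα : α ∈ Finset.Iic (fun _ : Fin d => n)
    · obtain ⟨C, hC⟩ := exists_norm_pair_le hb.le (hH α) (memLp_wtd_tens fun i =>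
        (hU i).inA _ (Finset.mem_Iic.1 hα i))
      exact ⟨C, fun _ => hC⟩
    · exact ⟨0, fun h => absurd h hα⟩
  choose C hC using hp
  refine ⟨∑ α ∈ Finset.Iic (fun _ : Fin d => n), C α, fun x => ?_⟩
  rw [h U hU, Finset.sum_mul]
  refine norm_sum_le_of_le _ fun α hα => ?_
  simpa using hC α hα x

/-- Associativity k * (u * f) = (k * u) * f. All derivatives fall on u, so k need not be smooth. -/
lemma integral_tens_mul_conv (f : XDual b (fun _ : Fin d => n)) (k : Fin d → AlgA b n hb hn)
    {u : Fin d → AlgA b n hb hn} (hu : ∀ i, Smooth (u i)) (x : Fin d → ℝ) :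
    ∫ z, tens (fun i => (k i).fn) z * conv (tens fun i => (u i).fn) f (x - z) =
      conv (tens fun i => (k i * u i).fn) f x := by
  obtain ⟨H, hH, h⟩ := f.exists_conv_eq hb
  choose U hU hU0 using hu
  have hkU : ∀ i, Chain b n fun s => cv (U i s) (k i).fn := fun i => (hU i).cv hb hn (k i).inA
  have e : ∀ i, (k i * u i).fn = cv (U i 0) (k i).fn := fun i => by
    rw [hU0, fn_mul, cv_comm]
  simp_rw [e, ← hU0]
  rw [h _ hkU, funext (h U hU)]
  simp_rw [Finset.mul_sum, mul_left_comm _ ((-1 : ℂ) ^ _)]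
  have hI := fun α (hα : α ∈ Finset.Iic (fun _ : Fin d => n)) =>
    integral_tens_mul_pair hb hn (hH α) (fun i => (k i).inA)
      (fun i => (hU i).inA _ (Finset.mem_Iic.1 hα i)) x
  rw [integral_finsetSum _ fun α hα => (hI α hα).1.const_mul _]
  refine Finset.sum_congr rfl fun α hα => ?_
  rw [integral_const_mul, (hI α hα).2]
  simp_rw [cv_comm (k _).fn]

lemma smooth_tens_mem_X {u : Fin d → AlgA b n hb hn} (hu : ∀ i, Smooth (u i)) (x : Fin d → ℝ) :
    (fun y => tens (fun i => (u i).fn) (x - y)) ∈ X b fun _ : Fin d => n := by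
  choose U hU hU0 using hu
  have := Chain.tens_mem_X hb fun i => (hU i).reflect hb.le (x i)
  simp only [pow_zero, one_mul, hU0] at this
  exact this

lemma conv_tens_sum (f : XDual b (fun _ : Fin d => n)) (s : Finset ℕ)
    {u : Fin d → ℕ → AlgA b n hb hn} (hu : ∀ i k, Smooth (u i k)) (x : Fin d → ℝ) :
    conv (tens fun i => (∑ k ∈ s, u i k).fn) f x =
      ∑ κ ∈ Fintype.piFinset fun _ : Fin d => s, conv (tens fun i => (u i (κ i)).fn) f x := by
  have hm := fun κ : Fin d → ℕ => smooth_tens_mem_X (fun i => hu i (κ i)) x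
  have e : (fun y => tens (fun i => (∑ k ∈ s, u i k).fn) (x - y)) =
      ∑ κ ∈ Fintype.piFinset fun _ : Fin d => s,
        fun y => tens (fun i => (u i (κ i)).fn) (x - y) := by
    ext y
    simp only [tens, fn_sum, Finset.sum_apply]
    exact Finset.prod_univ_sum _ _
  have hs := e ▸ Submodule.sum_mem _ fun κ _ => hm κ
  rw [conv, dif_pos hs]
  simp_rw [conv, dif_pos (hm _)]
  rw [← map_sum]
  congr 1
  refine Subtype.ext (e.trans ?_)
  simp

lemma AlgA.integrable_wt_half (h : AlgA b n hb hn) :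
    Integrable fun t => wt b n (2⁻¹ * t) • h.fn t := by
  have hv : InA b 0 fun t => (1 + |t|) ^ n • h.fn t :=
    MemLp.ae_eq (Eventually.of_forall fun t => by simp [wt, mul_assoc]) h.inA
  refine (hv.integrable_exp (half_lt_self hb)).mono
    (((continuous_wt b n).comp (by fun_prop)).aestronglyMeasurable.smul
      h.inA.aestronglyMeasurable) (Eventually.of_forall fun t => ?_)
  rw [smul_smul, norm_smul, norm_smul]
  gcongr ?_ * _
  rw [wt, Real.norm_of_nonneg (by positivity), Real.norm_of_nonneg (by positivity), abs_mul,
    abs_of_pos (by norm_num : (0 : ℝ) < 2⁻¹)]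
  have := abs_nonneg t
  gcongr ?_ * ?_
  · apply Real.exp_le_exp.2; linarith
  · gcongr; linarith

lemma integral_tens_dil_mul (h : Fin d → ℝ → ℂ) (F : (Fin d → ℝ) → ℂ) (N : ℕ) (x : Fin d → ℝ) :
    ∫ z, tens (fun i => ExpBesov.dil N (h i)) z * F (x - z) =
      ∫ z, tens h z * F (x - ((2 : ℝ) ^ N)⁻¹ • z) := by
  have h1 := Measure.integral_comp_smul (volume : Measure (Fin d → ℝ))
    (fun z => tens h z * F (x - ((2 : ℝ) ^ N)⁻¹ • z)) ((2 : ℝ) ^ N)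
  have h2 : ∀ z : Fin d → ℝ, tens (fun i => ExpBesov.dil N (h i)) z * F (x - z) =
      ((2 : ℂ) ^ N) ^ d * (tens h ((2 : ℝ) ^ N • z) *
        F (x - ((2 : ℝ) ^ N)⁻¹ • ((2 : ℝ) ^ N • z))) := by
    intro z
    rw [inv_smul_smul₀ (by positivity)]
    simp [tens, ExpBesov.dil, Finset.prod_mul_distrib, mul_assoc]
  simp_rw [h2]
  rw [integral_const_mul, h1, Module.finrank_fin_fun, abs_of_pos (by positivity),
    Complex.real_smul, ← mul_assoc]
  push_cast
  rw [mul_inv_cancel₀ (pow_ne_zero _ (pow_ne_zero _ two_ne_zero)), one_mul]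

/-- F may grow like the weight at which h is merely square integrable. After rescaling, F is
evaluated at x - 2^(-N)z; for N ≥ 1 this halves the exponential rate and gives an integrable
majorant (`AlgA.integrable_wt_half`). -/
lemma tendsto_integral_tens_dil (h : Fin d → AlgA b n hb hn) {F : (Fin d → ℝ) → ℂ}
    (hF : Continuous F) {C : ℝ} (hC : ∀ x, ‖F x‖ ≤ C * wtd b n x) (x : Fin d → ℝ) :
    Tendsto (fun N : ℕ => ∫ z, tens (fun i => (AlgA.dil N (h i)).fn) z * F (x - z)) atTop
      (𝓝 ((∏ i, ∫ t, (h i).fn t) * F x)) := by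
  have hC0 : 0 ≤ C := by
    have := (norm_nonneg _).trans (hC 0)
    exact nonneg_of_mul_nonneg_left this (wtd_pos _ _ _)
  have e : (∏ i, ∫ t, (h i).fn t) * F x = ∫ z, tens (fun i => (h i).fn) z * F x := by
    rw [integral_mul_const]
    congr 1
    exact (integral_fintype_prod_volume_eq_prod (𝕜 := ℂ) fun i => (h i).fn).symm
  simp_rw [AlgA.fn_dil, integral_tens_dil_mul]
  rw [e]
  have hm := aestronglyMeasurable_tens fun i => (h i).inA.aestronglyMeasurable
  refine tendsto_integral_filter_of_dominated_convergence
    (fun z => C * wtd b n x * ‖tens (fun i t => wt b n (2⁻¹ * t) • (h i).fn t) z‖)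
    (Eventually.of_forall fun N => hm.mul
      (hF.comp (by fun_prop : Continuous fun z : Fin d → ℝ =>
        x - ((2 : ℝ) ^ N)⁻¹ • z)).aestronglyMeasurable) ?_ ?_
    (Eventually.of_forall fun z => ?_)
  · filter_upwards [eventually_ge_atTop 1] with N hN
    refine Eventually.of_forall fun z => ?_
    have h1 : wtd b n (((2 : ℝ) ^ N)⁻¹ • z) ≤ ∏ i, wt b n (2⁻¹ * z i) := by
      refine Finset.prod_le_prod (fun i _ => (wt_pos _ _ _).le) fun i _ =>
        wt_mono_abs hb.le n ?_
      rw [Pi.smul_apply, smul_eq_mul, abs_mul, abs_mul, abs_of_pos (by positivity),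
        abs_of_pos (by norm_num : (0 : ℝ) < 2⁻¹)]
      gcongr
      exact le_self_pow₀ (by norm_num) (by omega)
    have h2 : ‖tens (fun i t => wt b n (2⁻¹ * t) • (h i).fn t) z‖ =
        (∏ i, wt b n (2⁻¹ * z i)) * ‖tens (fun i => (h i).fn) z‖ := by
      simp only [tens, norm_prod, norm_smul, Finset.prod_mul_distrib]
      congr 1
      exact Finset.prod_congr rfl fun i _ => Real.norm_of_nonneg (wt_pos _ _ _).le
    rw [h2, norm_mul]
    calc _ ≤ ‖tens (fun i => (h i).fn) z‖ * (C * (wtd b n x * wtd b n (((2 : ℝ) ^ N)⁻¹ • z))) := by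
          gcongr
          exact (hC _).trans (mul_le_mul_of_nonneg_left (wtd_sub_le hb.le n _ _) hC0)
      _ ≤ ‖tens (fun i => (h i).fn) z‖ * (C * (wtd b n x * ∏ i, wt b n (2⁻¹ * z i))) := by
          gcongr
          exact (wtd_pos _ _ _).le
      _ = _ := by ring
  · exact ((integrable_tens fun i => (h i).integrable_wt_half).norm).const_mul _
  · refine tendsto_const_nhds.mul ((hF.tendsto x).comp ?_)
    have h1 : Tendsto (fun N : ℕ => ((2 : ℝ) ^ N)⁻¹) atTop (𝓝 0) := by
      simpa using tendsto_pow_atTop_nhds_zero_of_lt_one (r := (2 : ℝ)⁻¹) (by norm_num)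
        (by norm_num)
    simpa using tendsto_const_nhds.sub (h1.smul_const z)

/-- Convolve φ_j * f with the approximate identity P(g) dilated by 2^N in each coordinate, expand by
the telescoped sum and let N → ∞. The right side bounds every N, so convergence of the series to φ_j
* f need not be shown. -/
lemma enorm_conv_tens_Phi_le (f : XDual b (fun _ : Fin d => n)) {σ : Fin d → ℂ}
    {g : Fin d → AlgA b n hb hn} (hg : ∀ i, Smooth (g i)) (hσ : ∀ i, ∫ t, (g i).fn t = σ i)
    (hσ2 : ∀ i, σ i ^ 2 = 1) (j : Fin d → ℕ) (x : Fin d → ℝ) :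
    ‖conv (tens fun i => (Phi (g i) (j i)).fn) f x‖ₑ ≤ ∑' κ : Fin d → ℕ, ∫⁻ z,
      ‖tens (fun i => (Phi (g i) (j i) * Psi (σ i) (g i) (κ i)).fn) z‖ₑ *
        ‖conv (tens fun i => (Phi (g i) (κ i)).fn) f (x - z)‖ₑ := by
  have hj := fun i => (hg i).Phi (j i)
  obtain ⟨C, hC⟩ := exists_norm_conv_tens_le f hj
  have hlim := tendsto_integral_tens_dil (fun i => approx (σ i) (g i))
    (continuous_conv_tens f hj) hC x
  simp_rw [fun i => integral_approx (hσ i) (hσ2 i)] at hlim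
  rw [Finset.prod_const_one, one_mul] at hlim
  refine le_of_tendsto hlim.enorm (Eventually.of_forall fun N => ?_)
  have e : ∀ i, AlgA.dil N (approx (σ i) (g i)) * Phi (g i) (j i) =
      ∑ k ∈ Finset.range (N + 1), Phi (g i) (j i) * Psi (σ i) (g i) k * Phi (g i) k := by
    intro i
    rw [← sum_Psi_mul_Phi, mul_comm, Finset.mul_sum]
    exact Finset.sum_congr rfl fun k _ => (mul_assoc _ _ _).symm
  rw [integral_tens_mul_conv f _ hj]
  simp_rw [e]
  rw [conv_tens_sum f _ fun i k => (((hg i).Phi (j i)).mul _).mul _]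
  refine (enorm_sum_le _ _).trans (le_trans (Finset.sum_le_sum fun κ _ => ?_)
    (ENNReal.sum_le_tsum _))
  rw [← integral_tens_mul_conv f _ fun i => (hg i).Phi (κ i)]
  refine (enorm_integral_le_lintegral_enorm _).trans (le_of_eq ?_)
  simp

end

/-! ### Hölder, Minkowski and Schur inequalities. -/

section

/-! ### Inequalities for integrals and series in `[0, ∞]` -/

/-- Hölder for a and the constant 1 with respect to the measure of density A. -/
lemma lintegral_mul_rpow_le {α : Type*} [MeasurableSpace α] {μ : Measure α} {A a : α → ℝ≥0∞}
    (hA : Measurable A) (ha : Measurable a) {p : ℝ} (hp : 1 ≤ p) :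
    (∫⁻ x, A x * a x ∂μ) ^ p ≤ (∫⁻ x, A x ∂μ) ^ (p - 1) * ∫⁻ x, A x * a x ^ p ∂μ := by
  have hp0 : 0 < p := by linarith
  have h := eLpNorm'_le_eLpNorm'_mul_rpow_measure_univ (μ := μ.withDensity A) one_pos hp
    ha.aestronglyMeasurable
  simp only [eLpNorm', enorm_eq_self, ENNReal.rpow_one, div_one] at h
  rw [lintegral_withDensity_eq_lintegral_mul _ hA ha,
    lintegral_withDensity_eq_lintegral_mul _ hA (ha.pow_const p),
    withDensity_apply _ MeasurableSet.univ, Measure.restrict_univ] at h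
  have h2 := ENNReal.rpow_le_rpow h hp0.le
  rw [ENNReal.mul_rpow_of_nonneg _ _ hp0.le, ← ENNReal.rpow_mul, ← ENNReal.rpow_mul,
    one_div_mul_cancel hp0.ne', ENNReal.rpow_one, sub_mul, one_div_mul_cancel hp0.ne', one_mul] at h2
  exact h2.trans_eq (mul_comm _ _)

lemma tsum_mul_rpow_le {ι : Type*} (A a : ι → ℝ≥0∞) {p : ℝ} (hp : 1 ≤ p) :
    (∑' k, A k * a k) ^ p ≤ (∑' k, A k) ^ (p - 1) * ∑' k, A k * a k ^ p := by
  let _ : MeasurableSpace ι := ⊤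
  have h := lintegral_mul_rpow_le (μ := Measure.count) (Measurable.of_discrete (f := A))
    (Measurable.of_discrete (f := a)) hp
  simpa only [lintegral_count] using h

lemma eLpNorm_tsum_le {α ι : Type*} [Countable ι] [MeasurableSpace α] {μ : Measure α}
    {f : ι → α → ℝ≥0∞} (hf : ∀ k, Measurable (f k)) {p : ℝ≥0∞} (hp : 1 ≤ p) :
    eLpNorm (fun x => ∑' k, f k x) p μ ≤ ∑' k, eLpNorm (f k) p μ := by
  rcases eq_or_ne p ⊤ with rfl | hpt
  · simp only [eLpNorm_exponent_top]
    refine essSup_le_of_ae_le _ ?_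
    filter_upwards [ae_all_iff.2 fun k => enorm_ae_le_eLpNormEssSup (f k) μ] with x hx
    simp only [enorm_eq_self] at hx ⊢
    exact ENNReal.tsum_le_tsum hx
  · have hp0 : p ≠ 0 := (zero_lt_one.trans_le hp).ne'
    have hp' : 0 < p.toReal := ENNReal.toReal_pos hp0 hpt
    rw [eLpNorm_eq_lintegral_rpow_enorm_toReal hp0 hpt, one_div, ENNReal.rpow_inv_le_iff hp']
    have e : ∀ x, ‖∑' k, f k x‖ₑ ^ p.toReal =
        ⨆ s : Finset ι, (∑ k ∈ s, f k x) ^ p.toReal := by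
      intro x
      rw [enorm_eq_self, ENNReal.tsum_eq_iSup_sum]
      exact (ENNReal.orderIsoRpow p.toReal hp').map_iSup _
    simp_rw [e]
    rw [lintegral_iSup_directed]
    · refine iSup_le fun s => ?_
      have h := (eLpNorm_sum_le (fun k _ => (hf k).aestronglyMeasurable) hp (μ := μ) (s := s)).trans
        (ENNReal.sum_le_tsum s)
      rw [eLpNorm_eq_lintegral_rpow_enorm_toReal hp0 hpt, one_div,
        ENNReal.rpow_inv_le_iff hp'] at h
      simpa using h
    · exact fun s => ((Finset.measurable_fun_sum _ fun k _ => hf k).pow_const _).aemeasurable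
    · refine Monotone.directed_le fun s t hst x => ?_
      exact ENNReal.rpow_le_rpow (Finset.sum_le_sum_of_subset hst) hp'.le

lemma lqNorm_mono {ι : Type*} {q : ℝ≥0∞} {x y : ι → ℝ≥0∞} (h : ∀ k, x k ≤ y k) :
    lqNorm q x ≤ lqNorm q y := by
  unfold lqNorm
  split_ifs
  · exact iSup_mono h
  · refine ENNReal.rpow_le_rpow (ENNReal.tsum_le_tsum fun k => ?_) (by positivity)
    exact ENNReal.rpow_le_rpow (h k) ENNReal.toReal_nonneg

/-- Schur's test: Hölder uses the row sums with power q - 1, interchanging the sums uses the column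
sums once. -/
lemma lqNorm_tsum_mul_le {ι : Type*} {q : ℝ≥0∞} (hq : 1 ≤ q) {A : ι → ι → ℝ≥0∞} {S : ℝ≥0∞}
    (h1 : ∀ j, ∑' k, A j k ≤ S) (h2 : ∀ k, ∑' j, A j k ≤ S) (x : ι → ℝ≥0∞) :
    lqNorm q (fun j => ∑' k, A j k * x k) ≤ S * lqNorm q x := by
  unfold lqNorm
  split_ifs with hqt
  · refine iSup_le fun j => ?_
    calc _ ≤ ∑' k, A j k * ⨆ k, x k :=
          ENNReal.tsum_le_tsum fun k => mul_le_mul_right (le_iSup x k) _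
      _ ≤ _ := by
          rw [ENNReal.tsum_mul_right]
          exact mul_le_mul_left (h1 j) _
  · have hr : 1 ≤ q.toReal := by
      rw [← ENNReal.toReal_one]; exact ENNReal.toReal_mono hqt hq
    have hr0 : 0 < q.toReal := by linarith
    rw [one_div, ENNReal.rpow_inv_le_iff hr0, ENNReal.mul_rpow_of_nonneg _ _ hr0.le,
      ← ENNReal.rpow_mul, inv_mul_cancel₀ hr0.ne', ENNReal.rpow_one]
    calc _ ≤ ∑' j, S ^ (q.toReal - 1) * ∑' k, A j k * x k ^ q.toReal :=
          ENNReal.tsum_le_tsum fun j => (tsum_mul_rpow_le _ _ hr).trans (mul_le_mul_left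
            (ENNReal.rpow_le_rpow (h1 j) (by linarith)) _)
      _ = S ^ (q.toReal - 1) * ∑' k, (∑' j, A j k) * x k ^ q.toReal := by
          rw [ENNReal.tsum_mul_left, ENNReal.tsum_comm]
          simp_rw [ENNReal.tsum_mul_right]
      _ ≤ S ^ (q.toReal - 1) * ∑' k, S * x k ^ q.toReal := by
          gcongr with k
          exact h2 k
      _ = _ := by
          rw [ENNReal.tsum_mul_left, ← mul_assoc]
          congr 1
          nth_rewrite 2 [← ENNReal.rpow_one S]
          rw [← ENNReal.rpow_add_of_nonneg _ _ (by linarith) zero_le_one, sub_add_cancel]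

lemma tsum_prod_le {ι : Type*} [Fintype ι] (a : ι → ℕ → ℝ≥0∞) :
    ∑' κ : ι → ℕ, ∏ i, a i (κ i) ≤ ∏ i, ∑' k, a i k := by
  classical
  rw [ENNReal.tsum_eq_iSup_sum]
  refine iSup_le fun s => ?_
  have hs : s ⊆ Fintype.piFinset fun i => s.image fun κ => κ i := fun κ hκ =>
    Fintype.mem_piFinset.2 fun i => Finset.mem_image_of_mem _ hκ
  refine (Finset.sum_le_sum_of_subset hs).trans ?_
  rw [← Finset.prod_univ_sum]
  exact Finset.prod_le_prod' fun i _ => ENNReal.sum_le_tsum _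

/-- One of the two truncated differences is always 0, so their sum is |j - k|; each side of j
contributes at most one geometric series. -/
lemma tsum_pow_dist_le (r : ℝ≥0∞) (j : ℕ) :
    ∑' k, r ^ ((j - k) + (k - j)) ≤ 2 * ∑' m, r ^ m := by
  rw [← Summable.sum_add_tsum_nat_add' (k := j) ENNReal.summable, two_mul]
  refine add_le_add ?_ (ENNReal.tsum_le_tsum fun k => ?_)
  · rw [← Finset.sum_range_reflect]
    calc _ = ∑ m ∈ Finset.range j, r ^ (m + 1) := by
          refine Finset.sum_congr rfl fun m hm => ?_
          have := Finset.mem_range.1 hm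
          congr 1; omega
      _ ≤ ∑' m, r ^ (m + 1) := ENNReal.sum_le_tsum _
      _ ≤ ∑' m, r ^ m :=
          ENNReal.tsum_comp_le_tsum_of_injective (add_left_injective 1) fun m => r ^ m
  · rw [Nat.sub_eq_zero_of_le (Nat.le_add_left j k), zero_add, Nat.add_sub_cancel]

end

/-! ### Weighted Young inequality and pointwise bounds for Peetre functions. -/

section

variable {d : ℕ}

/-! ### Convolution inequalities in weighted `L^p`-spaces -/

lemma measurable_lconv {H G : (Fin d → ℝ) → ℝ≥0∞} (hH : Measurable H) (hG : Measurable G) :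
    Measurable fun x => ∫⁻ z, H z * G (x - z) :=
  Measurable.lintegral_prod_right' (f := fun p : (Fin d → ℝ) × (Fin d → ℝ) =>
    H p.2 * G (p.1 - p.2)) (by fun_prop)

/-- Hölder with respect to the density H·E, where E(z) = e^((c_w/p)|z|₁). As E^p is the growth
factor of w, the weight can be moved from x to x - z, and Tonelli concludes. -/
lemma IsExpWeight.eLpNorm_lconv_le {w : (Fin d → ℝ) → ℝ} {cw : ℝ} (hw : IsExpWeight w cw)
    {p : ℝ≥0∞} (hp : 1 ≤ p) :
    ∃ C : ℝ≥0∞, C ≠ ⊤ ∧ ∀ H G : (Fin d → ℝ) → ℝ≥0∞, Measurable H → Measurable G →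
      eLpNorm (fun x => ∫⁻ z, H z * G (x - z)) p (weightMeasure w) ≤
        C * (∫⁻ z, H z * ENNReal.ofReal (Real.exp (cw * (p⁻¹).toReal * l1 z))) *
          eLpNorm G p (weightMeasure w) := by
  have hwm : AEMeasurable (fun x => ENNReal.ofReal (w x)) volume :=
    hw.locallyIntegrable.aestronglyMeasurable.aemeasurable.ennreal_ofReal
  rcases eq_or_ne p ⊤ with rfl | hpt
  · refine ⟨1, ENNReal.one_ne_top, fun H G hH hG => ?_⟩
    simp only [eLpNorm_exponent_top, one_mul, ENNReal.inv_top, ENNReal.toReal_zero, mul_zero,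
      zero_mul, Real.exp_zero, ENNReal.ofReal_one, mul_one]
    -- Positivity of w makes null sets of w dx Lebesgue null, so the essential bound survives the
    -- change of variables.
    have hac : volume ≪ weightMeasure w := withDensity_absolutelyContinuous' hwm
      (Eventually.of_forall fun x => (ENNReal.ofReal_pos.2 (hw.pos x)).ne')
    have hae := hac.ae_le (enorm_ae_le_eLpNormEssSup G (weightMeasure w))
    refine essSup_le_of_ae_le _ (Eventually.of_forall fun x => ?_)
    have hx := (Measure.measurePreserving_sub_left (volume : Measure (Fin d → ℝ))
      x).quasiMeasurePreserving.ae hae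
    simp only [enorm_eq_self] at hx ⊢
    rw [← lintegral_mul_const _ hH]
    refine lintegral_mono_ae ?_
    filter_upwards [hx] with z hz
    exact mul_le_mul_right hz _
  · have hp0 : p ≠ 0 := (zero_lt_one.trans_le hp).ne'
    have hP0 : 0 < p.toReal := ENNReal.toReal_pos hp0 hpt
    have hP : 1 ≤ p.toReal := by rw [← ENNReal.toReal_one]; exact ENNReal.toReal_mono hpt hp
    obtain ⟨C, hC, hb⟩ := hw.bound
    refine ⟨ENNReal.ofReal C ^ (1 / p.toReal),
      ENNReal.rpow_ne_top_of_nonneg (by positivity) ENNReal.ofReal_ne_top, fun H G hH hG => ?_⟩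
    obtain ⟨E, hE⟩ : ∃ E : (Fin d → ℝ) → ℝ≥0∞,
      E = fun z => ENNReal.ofReal (Real.exp (cw * (p⁻¹).toReal * l1 z)) := ⟨_, rfl⟩
    have hEm : Measurable E := by rw [hE]; unfold l1; fun_prop
    have hE0 : ∀ z, E z ≠ 0 := fun z => by
      rw [hE]; exact (ENNReal.ofReal_pos.2 (Real.exp_pos _)).ne'
    have hEt : ∀ z, E z ≠ ⊤ := fun z => by rw [hE]; exact ENNReal.ofReal_ne_top
    have hEp : ∀ z, E z ^ p.toReal = ENNReal.ofReal (Real.exp (cw * l1 z)) := fun z => by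
      simp only [hE]
      rw [ENNReal.ofReal_rpow_of_pos (Real.exp_pos _), ← Real.exp_mul, ENNReal.toReal_inv]
      congr 2
      field_simp
    have hm : Measurable fun x => ∫⁻ z, H z * G (x - z) := measurable_lconv hH hG
    have hpw : ∀ x z, ENNReal.ofReal (w x) * ((E z)⁻¹ * G (x - z)) ^ p.toReal ≤
        ENNReal.ofReal C * (ENNReal.ofReal (w (x - z)) * G (x - z) ^ p.toReal) := by
      intro x z
      have h1 : ENNReal.ofReal (w x) ≤
          ENNReal.ofReal C * ENNReal.ofReal (w (x - z)) * E z ^ p.toReal := by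
        rw [hEp, mul_assoc, ← ENNReal.ofReal_mul (hw.pos _).le, ← ENNReal.ofReal_mul hC.le]
        exact ENNReal.ofReal_le_ofReal (hb x z)
      rw [ENNReal.mul_rpow_of_nonneg _ _ hP0.le, ENNReal.inv_rpow, ← mul_assoc, ← mul_assoc]
      refine mul_le_mul_left ?_ _
      rw [← div_eq_mul_inv]
      exact ENNReal.div_le_of_le_mul h1
    have hJ : ∀ x, (∫⁻ z, H z * G (x - z)) ^ p.toReal ≤ (∫⁻ z, H z * E z) ^ (p.toReal - 1) *
        ∫⁻ z, H z * E z * ((E z)⁻¹ * G (x - z)) ^ p.toReal := by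
      intro x
      have h1 := lintegral_mul_rpow_le (μ := volume) (hH.mul hEm)
        (a := fun z => (E z)⁻¹ * G (x - z)) (by fun_prop) hP
      refine le_trans (le_of_eq ?_) h1
      congr 2; ext z
      rw [Pi.mul_apply, mul_assoc, ENNReal.mul_inv_cancel_left (hE0 z) (hEt z)]
    obtain ⟨V, hV⟩ : ∃ V, V = fun x => ENNReal.ofReal (w x) * G x ^ p.toReal := ⟨_, rfl⟩
    have hVm : AEMeasurable V volume := hV ▸ hwm.mul (hG.pow_const _).aemeasurable
    have hpV : ∀ x z, ENNReal.ofReal (w x) * ((E z)⁻¹ * G (x - z)) ^ p.toReal ≤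
        ENNReal.ofReal C * V (x - z) := fun x z => hV ▸ hpw x z
    have hAm : Measurable fun z => H z * E z := hH.mul hEm
    have hFm : AEMeasurable (fun q : (Fin d → ℝ) × (Fin d → ℝ) =>
        H q.2 * E q.2 * (ENNReal.ofReal C * V (q.1 - q.2))) (volume.prod volume) :=
      (hAm.comp measurable_snd).aemeasurable.mul
        ((hVm.comp_quasiMeasurePreserving (quasiMeasurePreserving_sub _ _)).const_mul _)
    have hmain : ∫⁻ x, ENNReal.ofReal (w x) * (∫⁻ z, H z * G (x - z)) ^ p.toReal ≤
        ENNReal.ofReal C * (∫⁻ z, H z * E z) ^ p.toReal * ∫⁻ x, V x := by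
      calc _ ≤ ∫⁻ x, (∫⁻ z, H z * E z) ^ (p.toReal - 1) * ∫⁻ z, H z * E z *
              (ENNReal.ofReal (w x) * ((E z)⁻¹ * G (x - z)) ^ p.toReal) := by
            refine lintegral_mono fun x => ?_
            refine (mul_le_mul_right (hJ x) _).trans (le_of_eq ?_)
            rw [mul_left_comm, ← lintegral_const_mul _ (by fun_prop)]
            simp_rw [mul_left_comm (ENNReal.ofReal (w x))]
        _ ≤ ∫⁻ x, (∫⁻ z, H z * E z) ^ (p.toReal - 1) * ∫⁻ z, H z * E z *
              (ENNReal.ofReal C * V (x - z)) := by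
            refine lintegral_mono fun x => mul_le_mul_right (lintegral_mono fun z => ?_) _
            exact mul_le_mul_right (hpV x z) _
        _ = (∫⁻ z, H z * E z) ^ (p.toReal - 1) * ∫⁻ z, ∫⁻ x, H z * E z *
              (ENNReal.ofReal C * V (x - z)) := by
            rw [lintegral_const_mul'' _ hFm.lintegral_prod_right', lintegral_lintegral_swap hFm]
        _ = (∫⁻ z, H z * E z) ^ (p.toReal - 1) *
              ∫⁻ z, H z * E z * (ENNReal.ofReal C * ∫⁻ x, V x) := by
            congr 2; ext z
            have hz : AEMeasurable (fun x => V (x - z)) volume :=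
              hVm.comp_quasiMeasurePreserving
                (measurePreserving_sub_right volume z).quasiMeasurePreserving
            rw [lintegral_const_mul'' _ (hz.const_mul _), lintegral_const_mul'' _ hz,
              lintegral_sub_right_eq_self]
        _ = _ := by
            rw [lintegral_mul_const _ hAm]
            have : (∫⁻ z, H z * E z) ^ p.toReal =
                (∫⁻ z, H z * E z) ^ (p.toReal - 1) * ∫⁻ z, H z * E z := by
              nth_rewrite 3 [← ENNReal.rpow_one (∫⁻ z, H z * E z)]
              rw [← ENNReal.rpow_add_of_nonneg _ _ (by linarith) zero_le_one, sub_add_cancel]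
            rw [this]
            ring
    rw [eLpNorm_eq_lintegral_rpow_enorm_toReal hp0 hpt,
      eLpNorm_eq_lintegral_rpow_enorm_toReal hp0 hpt, weightMeasure,
      lintegral_withDensity_eq_lintegral_mul₀ hwm (by fun_prop),
      lintegral_withDensity_eq_lintegral_mul₀ hwm (by fun_prop)]
    simp only [Pi.mul_apply, enorm_eq_self]
    rw [hV] at hmain
    refine (ENNReal.rpow_le_rpow hmain (by positivity)).trans (le_of_eq ?_)
    rw [ENNReal.mul_rpow_of_nonneg _ _ (by positivity),
      ENNReal.mul_rpow_of_nonneg _ _ (by positivity), ← ENNReal.rpow_mul,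
      mul_one_div_cancel hP0.ne', ENNReal.rpow_one, hE]

/-! ### Maximal functions -/

/-- The majorant of the convolution of two levels of a dyadic system. -/
def kern (D a : ℝ) (L j k : ℕ) (t : ℝ) : ℝ :=
  D * 2 ^ min j k * ((1 / 2) ^ ((j - k) + (k - j))) ^ L * Real.exp (-(a * 2 ^ (min j k - 1) * |t|))

lemma kern_nonneg {D : ℝ} (hD : 0 ≤ D) (a : ℝ) (L j k : ℕ) (t : ℝ) : 0 ≤ kern D a L j k t := by
  unfold kern; positivity

lemma measurable_prod_kern (D : Fin d → ℝ) (a : ℝ) (L : ℕ) (j κ : Fin d → ℕ) :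
    Measurable fun z : Fin d → ℝ => ENNReal.ofReal (∏ i, kern (D i) a L (j i) (κ i) (z i)) := by
  unfold kern
  fun_prop

/-- The kernel decays at a scale no finer than 2^j, so a shift by t costs at most e^(2^j a|t|). The
polynomial factor is only used as being at least 1. -/
lemma kern_sub_le {D : ℝ} (hD : 0 ≤ D) {a : ℝ} (ha : 0 ≤ a) (L n j k : ℕ) (s t : ℝ) :
    kern D a L j k (s - t) ≤
      kern D a L j k s * (Real.exp (2 ^ j * a * |t|) * (1 + |2 ^ j * t|) ^ n) := by
  unfold kern
  have h1 : (1 : ℝ) ≤ (1 + |2 ^ j * t|) ^ n := one_le_pow₀ (by linarith [abs_nonneg (2 ^ j * t)])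
  have h2 : Real.exp (-(a * 2 ^ (min j k - 1) * |s - t|)) ≤
      Real.exp (-(a * 2 ^ (min j k - 1) * |s|)) * Real.exp (2 ^ j * a * |t|) := by
    rw [← Real.exp_add]
    apply Real.exp_le_exp.2
    have h3 : |s| ≤ |s - t| + |t| := by simpa using abs_add_le (s - t) t
    have h4 : a * 2 ^ (min j k - 1) * |s| ≤ a * 2 ^ (min j k - 1) * (|s - t| + |t|) := by gcongr
    have h5 : a * 2 ^ (min j k - 1) * |t| ≤ a * 2 ^ j * |t| := by
      gcongr
      · norm_num
      · omega
    linarith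
  rw [mul_assoc (D * _ * _)]
  gcongr
  rw [← mul_assoc]
  exact h2.trans (le_mul_of_one_le_right (by positivity) h1)

/-- Translating z by y moves the shift from F to the kernel, where the Peetre denominator absorbs
it. No maximal inequality is needed, and p is unrestricted from below by one. -/
lemma peetre_le {F : (Fin d → ℕ) → (Fin d → ℝ) → ℂ} {D : Fin d → ℝ} (hD : ∀ i, 0 ≤ D i) {a : ℝ}
    (ha : 0 ≤ a) {L : ℕ} (hF : ∀ j x, ‖F j x‖ₑ ≤ ∑' κ : Fin d → ℕ, ∫⁻ z,
      ENNReal.ofReal (∏ i, kern (D i) a L (j i) (κ i) (z i)) * ‖F κ (x - z)‖ₑ)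
    (n : ℕ) (j : Fin d → ℕ) (x : Fin d → ℝ) :
    peetre j a n (F j) x ≤ ∑' κ : Fin d → ℕ, ∫⁻ z,
      ENNReal.ofReal (∏ i, kern (D i) a L (j i) (κ i) (z i)) * ‖F κ (x - z)‖ₑ := by
  refine iSup_le fun y => ENNReal.div_le_of_le_mul ((hF j (x - y)).trans ?_)
  rw [← ENNReal.tsum_mul_right]
  refine ENNReal.tsum_le_tsum fun κ => ?_
  rw [← lintegral_sub_right_eq_self _ y, ← lintegral_mul_const' _ _ ENNReal.ofReal_ne_top]
  refine lintegral_mono fun z => ?_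
  simp only [Pi.sub_apply, sub_sub_sub_cancel_right]
  rw [mul_right_comm, ← ENNReal.ofReal_mul (Finset.prod_nonneg fun i _ => kern_nonneg (hD i) _ _ _ _ _),
    ← Finset.prod_mul_distrib]
  gcongr with i
  · exact fun i _ => kern_nonneg (hD i) _ _ _ _ _
  · exact kern_sub_le (hD i) ha L n _ _ _ _

/-- The remaining rate a2^(m-1) - c is at least 2^(m-1)(a - c), because 2^(m-1) ≥ 1 even for m = 0
with truncated subtraction. Its inverse offsets the height 2^m up to a constant. -/
lemma integral_kern_mul_exp_le {D : ℝ} (hD : 0 ≤ D) {a c : ℝ} (hc : 0 ≤ c) (hca : c < a)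
    (L j k : ℕ) :
    Integrable (fun t => kern D a L j k t * Real.exp (c * |t|)) ∧
      ∫ t, kern D a L j k t * Real.exp (c * |t|) ≤
        D * (4 / (a - c)) * ((1 / 2) ^ L) ^ ((j - k) + (k - j)) := by
  have hac : 0 < a - c := sub_pos.2 hca
  set m := min j k
  have h1 : (1 : ℝ) ≤ 2 ^ (m - 1) := one_le_pow₀ (by norm_num)
  have h2 : (2 : ℝ) ^ m ≤ 2 * 2 ^ (m - 1) := by
    rw [← pow_succ']
    exact pow_le_pow_right₀ (by norm_num) (by omega)
  have h3 : 2 ^ (m - 1) * (a - c) ≤ a * 2 ^ (m - 1) - c := by nlinarith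
  have h4 : 0 < a * 2 ^ (m - 1) - c := lt_of_lt_of_le (by positivity) h3
  have e : ∀ t, kern D a L j k t * Real.exp (c * |t|) =
      D * 2 ^ m * ((1 / 2) ^ ((j - k) + (k - j))) ^ L *
        Real.exp (-((a * 2 ^ (m - 1) - c) * |t|)) := by
    intro t
    rw [kern, mul_assoc _ (Real.exp _), ← Real.exp_add]
    congr 2
    ring
  simp_rw [e]
  refine ⟨(integrable_exp_neg_mul_abs h4).const_mul _, ?_⟩
  rw [integral_const_mul, integral_exp_neg_mul_abs h4, ← pow_mul, mul_comm _ L, pow_mul]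
  have h5 : 2 ^ m * (2 / (a * 2 ^ (m - 1) - c)) ≤ 4 / (a - c) := by
    calc _ ≤ (2 * 2 ^ (m - 1)) * (2 / (2 ^ (m - 1) * (a - c))) := by gcongr
      _ = _ := by field_simp; norm_num
  calc _ = D * (2 ^ m * (2 / (a * 2 ^ (m - 1) - c))) * ((1 / 2) ^ L) ^ ((j - k) + (k - j)) := by
        ring
    _ ≤ _ := by gcongr

lemma lintegral_prod_kern_le {D : Fin d → ℝ} (hD : ∀ i, 0 ≤ D i) {a c : ℝ} (hc : 0 ≤ c)
    (hca : c < a) (L : ℕ) (j κ : Fin d → ℕ) :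
    ∫⁻ z : Fin d → ℝ, ENNReal.ofReal (∏ i, kern (D i) a L (j i) (κ i) (z i)) *
        ENNReal.ofReal (Real.exp (c * l1 z)) ≤
      ENNReal.ofReal (∏ i, D i * (4 / (a - c))) *
        ∏ i, ENNReal.ofReal ((1 / 2) ^ L) ^ ((j i - κ i) + (κ i - j i)) := by
  have hk := fun i => integral_kern_mul_exp_le (hD i) hc hca L (j i) (κ i)
  have hn := fun i (t : ℝ) => mul_nonneg (kern_nonneg (hD i) a L (j i) (κ i) t)
    (Real.exp_pos (c * |t|)).le
  have e : ∀ z : Fin d → ℝ, ENNReal.ofReal (∏ i, kern (D i) a L (j i) (κ i) (z i)) *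
      ENNReal.ofReal (Real.exp (c * l1 z)) =
      ENNReal.ofReal (∏ i, kern (D i) a L (j i) (κ i) (z i) * Real.exp (c * |z i|)) := by
    intro z
    rw [← ENNReal.ofReal_mul (Finset.prod_nonneg fun i _ => kern_nonneg (hD i) _ _ _ _ _), l1,
      Finset.mul_sum, Real.exp_sum, Finset.prod_mul_distrib]
  simp_rw [e]
  have hI : Integrable fun z : Fin d → ℝ =>
      ∏ i, kern (D i) a L (j i) (κ i) (z i) * Real.exp (c * |z i|) :=
    Integrable.fintype_prod fun i => (hk i).1
  rw [← ofReal_integral_eq_lintegral_ofReal hI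
    (Eventually.of_forall fun z => Finset.prod_nonneg fun i _ => hn i _)]
  rw [integral_fintype_prod_volume_eq_prod (𝕜 := ℝ)
    fun i t => kern (D i) a L (j i) (κ i) t * Real.exp (c * |t|)]
  simp_rw [← ENNReal.ofReal_pow (show (0 : ℝ) ≤ (1 / 2) ^ L by positivity)]
  rw [← ENNReal.ofReal_prod_of_nonneg fun i _ => by positivity,
    ← ENNReal.ofReal_mul (Finset.prod_nonneg fun i _ => mul_nonneg (hD i)
      (div_nonneg (by norm_num) (sub_pos.2 hca).le)), ← Finset.prod_mul_distrib]
  exact ENNReal.ofReal_le_ofReal (Finset.prod_le_prod (fun i _ => integral_nonneg (hn i))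
    fun i _ => (hk i).2)

end

/-! ### Summation over the levels. -/

section

variable {d : ℕ}

/-! ### The norm equivalence -/

lemma norm_le_peetre (j : Fin d → ℕ) (a : ℝ) (n : ℕ) (F : (Fin d → ℝ) → ℂ) (x : Fin d → ℝ) :
    ‖F x‖ₑ ≤ peetre j a n F x := by
  refine le_trans (le_of_eq ?_) (le_iSup _ 0)
  simp

lemma seminorm_le_add_dist (δ : Seminorm ℝ (Fin d → ℝ)) (j κ : Fin d → ℕ) :
    δ (fun i => (j i : ℝ)) ≤ δ (fun i => (κ i : ℝ)) +
      ∑ i, δ (Pi.single i 1) * (((j i - κ i) + (κ i - j i) : ℕ) : ℝ) := by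
  have e : (fun i => (j i : ℝ)) = (fun i => (κ i : ℝ)) +
      ∑ i, ((j i : ℝ) - κ i) • (Pi.single i 1 : Fin d → ℝ) := by
    ext k
    simp [Finset.sum_apply, Pi.single_apply]
  rw [e]
  refine (map_add_le_add δ _ _).trans (add_le_add le_rfl ?_)
  refine (Finset.le_sum_of_subadditive δ (map_zero δ).le (map_add_le_add δ) _ _).trans
    (Finset.sum_le_sum fun i _ => le_of_eq ?_)
  rw [map_smul_eq_mul, mul_comm, Real.norm_eq_abs]
  congr 1
  rcases le_total (j i) (κ i) with h | h
  · rw [abs_of_nonpos (by simpa using h), Nat.sub_eq_zero_of_le h, zero_add, Nat.cast_sub h,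
      neg_sub]
  · rw [abs_of_nonneg (by simpa using h), Nat.sub_eq_zero_of_le h, add_zero, Nat.cast_sub h]

/-- Passing from j to κ changes δ by at most ∑ δ(e_i)|j_i - κ_i|, so the decay 2^(-L|j_i - κ_i|)
leaves a geometric factor of ratio 2^(δ(e_i) - L) in each coordinate. -/
lemma ofReal_two_rpow_seminorm_le (δ : Seminorm ℝ (Fin d → ℝ)) (L : ℕ) (j κ : Fin d → ℕ) :
    ENNReal.ofReal ((2 : ℝ) ^ δ (fun i => (j i : ℝ))) *
        ∏ i, ENNReal.ofReal ((1 / 2) ^ L) ^ ((j i - κ i) + (κ i - j i)) ≤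
      (∏ i, ENNReal.ofReal ((2 : ℝ) ^ (δ (Pi.single i 1) - L)) ^ ((j i - κ i) + (κ i - j i))) *
        ENNReal.ofReal ((2 : ℝ) ^ δ (fun i => (κ i : ℝ))) := by
  simp_rw [← ENNReal.ofReal_pow (show (0 : ℝ) ≤ (1 / 2) ^ L by positivity),
    ← ENNReal.ofReal_pow (Real.rpow_nonneg zero_le_two _)]
  rw [← ENNReal.ofReal_prod_of_nonneg fun i _ => by positivity,
    ← ENNReal.ofReal_prod_of_nonneg fun i _ => by positivity, ← ENNReal.ofReal_mul (by positivity),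
    ← ENNReal.ofReal_mul (Finset.prod_nonneg fun i _ => by positivity)]
  refine ENNReal.ofReal_le_ofReal ?_
  have h := Real.rpow_le_rpow_of_exponent_le one_le_two (seminorm_le_add_dist δ j κ)
  rw [Real.rpow_add two_pos, Real.rpow_sum_of_pos two_pos] at h
  refine (mul_le_mul_of_nonneg_right h (Finset.prod_nonneg fun i _ => by positivity)).trans
    (le_of_eq ?_)
  rw [mul_assoc, ← Finset.prod_mul_distrib, mul_comm]
  congr 1
  refine Finset.prod_congr rfl fun i _ => ?_
  rw [Real.rpow_mul zero_le_two, Real.rpow_natCast, ← mul_pow, Real.rpow_sub two_pos,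
    Real.rpow_natCast, one_div, inv_pow, div_eq_mul_inv]

/-- The estimate of maximal functions for families that satisfy a reproducing inequality. -/
lemma exists_lqNorm_peetre_le {p q : ℝ≥0∞} (hp : 1 ≤ p) (hq : 1 ≤ q) {w : (Fin d → ℝ) → ℝ}
    {cw : ℝ} (hw : IsExpWeight w cw) (δ : Seminorm ℝ (Fin d → ℝ)) {L : ℕ}
    (hL : ∀ i, δ (Pi.single i 1) < L) {a : ℝ} (hcw : cw * (p⁻¹).toReal < a) {D : Fin d → ℝ}
    (hD : ∀ i, 0 ≤ D i) (n : ℕ) :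
    ∃ C : ℝ≥0∞, C ≠ ⊤ ∧ ∀ F : (Fin d → ℕ) → (Fin d → ℝ) → ℂ, (∀ κ, Continuous (F κ)) →
      (∀ j x, ‖F j x‖ₑ ≤ ∑' κ : Fin d → ℕ, ∫⁻ z,
        ENNReal.ofReal (∏ i, kern (D i) a L (j i) (κ i) (z i)) * ‖F κ (x - z)‖ₑ) →
      lqNorm q (fun j : Fin d → ℕ => ENNReal.ofReal ((2 : ℝ) ^ δ (fun i => (j i : ℝ))) *
          eLpNorm (peetre j a n (F j)) p (weightMeasure w)) ≤
        C * lqNorm q fun j : Fin d → ℕ => ENNReal.ofReal ((2 : ℝ) ^ δ (fun i => (j i : ℝ))) *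
          eLpNorm (F j) p (weightMeasure w) := by
  have hc : 0 ≤ cw * (p⁻¹).toReal := mul_nonneg hw.cw_pos.le ENNReal.toReal_nonneg
  have ha : 0 ≤ a := hc.trans hcw.le
  obtain ⟨Cw, hCw, hY⟩ := hw.eLpNorm_lconv_le hp
  obtain ⟨ρ, hρ⟩ : ∃ ρ : Fin d → ℝ≥0∞,
    ρ = fun i => ENNReal.ofReal ((2 : ℝ) ^ (δ (Pi.single i 1) - L)) := ⟨_, rfl⟩
  have hρ1 : ∀ i, ρ i < 1 := fun i => by
    rw [hρ, ENNReal.ofReal_lt_one]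
    exact Real.rpow_lt_one_of_one_lt_of_neg one_lt_two (sub_neg.2 (hL i))
  obtain ⟨K, hK⟩ : ∃ K, K = Cw * ENNReal.ofReal (∏ i, D i * (4 / (a - cw * (p⁻¹).toReal))) :=
    ⟨_, rfl⟩
  have hKt : K ≠ ⊤ := hK ▸ ENNReal.mul_ne_top hCw ENNReal.ofReal_ne_top
  obtain ⟨A, hA⟩ : ∃ A : (Fin d → ℕ) → (Fin d → ℕ) → ℝ≥0∞,
    A = fun j κ => K * ∏ i, ρ i ^ ((j i - κ i) + (κ i - j i)) := ⟨_, rfl⟩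
  have hA1 : ∀ j, ∑' κ, A j κ ≤ K * ∏ i, (2 * ∑' m, ρ i ^ m) := by
    intro j
    rw [hA, ENNReal.tsum_mul_left]
    refine mul_le_mul_right ((tsum_prod_le fun i k => ρ i ^ ((j i - k) + (k - j i))).trans ?_) _
    exact Finset.prod_le_prod' fun i _ => tsum_pow_dist_le _ _
  -- The matrix is symmetric, so the column sums are row sums.
  have hA2 : ∀ κ, ∑' j, A j κ ≤ K * ∏ i, (2 * ∑' m, ρ i ^ m) := by
    intro κ
    refine le_trans (le_of_eq ?_) (hA1 κ)
    congr 1; ext j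
    simp only [hA, add_comm]
  refine ⟨K * ∏ i, (2 * ∑' m, ρ i ^ m), ENNReal.mul_ne_top hKt
    (ENNReal.prod_ne_top fun i _ => ENNReal.mul_ne_top ENNReal.ofNat_ne_top ?_), fun F hFc hF => ?_⟩
  · rw [ENNReal.tsum_geometric]
    exact ENNReal.inv_ne_top.2 (tsub_pos_of_lt (hρ1 i)).ne'
  refine le_trans (lqNorm_mono fun j => ?_) (lqNorm_tsum_mul_le hq hA1 hA2 _)
  have hFm : ∀ κ, Measurable fun x => ‖F κ x‖ₑ := fun κ => (hFc κ).measurable.enorm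
  have hkm := fun κ => measurable_prod_kern D a L j κ
  have h1 : eLpNorm (peetre j a n (F j)) p (weightMeasure w) ≤
      ∑' κ : Fin d → ℕ, eLpNorm (fun x => ∫⁻ z,
        ENNReal.ofReal (∏ i, kern (D i) a L (j i) (κ i) (z i)) * ‖F κ (x - z)‖ₑ) p
        (weightMeasure w) := by
    refine le_trans (eLpNorm_mono_enorm fun x => ?_)
      (eLpNorm_tsum_le (fun κ => measurable_lconv (hkm κ) (hFm κ)) hp)
    simp only [enorm_eq_self]
    exact peetre_le hD ha hF n j x
  refine (mul_le_mul_right h1 _).trans ?_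
  rw [← ENNReal.tsum_mul_left]
  refine ENNReal.tsum_le_tsum fun κ => ?_
  have h2 := hY _ _ (hkm κ) (hFm κ)
  rw [eLpNorm_enorm] at h2
  refine (mul_le_mul_right (h2.trans (mul_le_mul_left (mul_le_mul_right
    (lintegral_prod_kern_le hD hc hcw L j κ) _) _)) _).trans ?_
  have h3 := mul_le_mul_right (ofReal_two_rpow_seminorm_le δ L j κ)
    (K * eLpNorm (F κ) p (weightMeasure w))
  rw [hK] at h3
  simp only [hA, hK, hρ]
  refine le_trans (le_of_eq ?_) (h3.trans (le_of_eq ?_)) <;> ring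

end

end ExpBesov

end

/-! ### The equivalence of the quasinorms. -/

theorem mainTheorem5 {d : ℕ} (p q : ℝ≥0∞) (hp : 1 ≤ p) (hq : 1 ≤ q)
    (w : (Fin d → ℝ) → ℝ) (cw : ℝ) (hw : ExpBesov.IsExpWeight w cw)
    (δ : Seminorm ℝ (Fin d → ℝ)) (hδ : ∀ x, δ x = 0 → x = 0)
    (L : ℕ) (hL : ∀ j : Fin d → ℕ, j ≠ 0 → δ (fun i => (j i : ℝ)) < L * ∑ i, (j i : ℝ))
    (b b' : ℝ) (hb'pos : 0 < b') (hb'b : b' < b) (hcw : cw * (p⁻¹).toReal < b')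
    (φ₀ : Fin d → ℝ → ℂ)
    (hX : ∀ i, ExpBesov.MemX1 b (L + 1) (φ₀ i))
    (hint : ∀ i, ∫ x, convolution (φ₀ i) (φ₀ i) (ContinuousLinearMap.mul ℝ ℂ) volume x = 1)
    (hmom : ∀ i, ∀ s ≤ L, iteratedDeriv s (𝓕 (ExpBesov.diffFun (φ₀ i))) 0 = 0) :
    ∃ c C : ℝ, 0 < c ∧ 0 < C ∧ ∀ f : ExpBesov.XDual b (fun _ : Fin d => L + 1),
      ENNReal.ofReal c * ExpBesov.vbNorm p q w δ φ₀ f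
          ≤ ExpBesov.vbPeetreNorm p q w δ φ₀ b' (L + 1) f ∧
      ExpBesov.vbPeetreNorm p q w δ φ₀ b' (L + 1) f
          ≤ ENNReal.ofReal C * ExpBesov.vbNorm p q w δ φ₀ f := by
  open ExpBesov ExpBesov.AlgA in
  have hb : 0 < b := hb'pos.trans hb'b
  have hn : 1 ≤ L + 1 := Nat.le_add_left 1 L
  choose U hU hU0 using fun i => (hX i).exists_chain hb
  obtain ⟨g, hg⟩ : ∃ g : Fin d → AlgA b (L + 1) hb hn, ∀ i, (g i).fn = φ₀ i :=
    ⟨fun i => AlgA.mk (φ₀ i) (hU0 i ▸ (hU i).inA 0 (Nat.zero_le _)), fun i => rfl⟩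
  have hgs : ∀ i, (g i).Smooth := fun i => ⟨U i, hU i, (hU0 i).trans (hg i).symm⟩
  -- The normalisation of φ₀ * φ₀ fixes ∫ φ₀ only up to a square root of 1, which is why σ enters P.
  have hσ2 : ∀ i, (∫ t, (g i).fn t) ^ 2 = 1 := fun i => by
    rw [sq, ← integral_cv (g i).integrable (g i).integrable, cv_eq_convolution, hg]
    exact hint i
  have hgm : ∀ i, HasMom L (∫ t, (g i).fn t) (g i).fn := fun i =>
    hasMom_of_iteratedDeriv_fourier hb (g i).inA.dec (by rw [hg]; exact hmom i)
  choose D hD hDk using fun i =>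
    exists_norm_Phi_mul_Psi_le (hgs i) (hgm i) (hσ2 i) hb'pos.le hb'b
  -- Only the unit multi-indices matter; subadditivity of δ covers the others.
  have hL' : ∀ i, δ (Pi.single i 1) < L := fun i => by
    have h := hL (Pi.single i 1) (by simp)
    have e : (fun k => ((Pi.single i 1 : Fin d → ℕ) k : ℝ)) = Pi.single i 1 := by
      ext k; simp [Pi.single_apply]
    rw [e] at h
    simpa [Pi.single_apply] using h
  obtain ⟨C, hC, hmax⟩ := exists_lqNorm_peetre_le hp hq hw δ hL' hcw hD (L + 1)
  have htens : ∀ j, tensor φ₀ j = tens fun i => (Phi (g i) (j i)).fn := fun j => by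
    ext x
    simp [tensor, tens, fn_Phi, hg]
  -- Adding 1 guarantees a positive constant even if `C` is 0.
  refine ⟨1, C.toReal + 1, one_pos, by positivity, fun f => ⟨?_, ?_⟩⟩
  · rw [ENNReal.ofReal_one, one_mul]
    refine lqNorm_mono fun j => mul_le_mul_right (eLpNorm_mono_enorm fun x => ?_) _
    exact norm_le_peetre _ _ _ _ _
  · refine (hmax (fun j => conv (tensor φ₀ j) f) (fun κ => ?_) fun j x => ?_).trans ?_
    · rw [htens]
      exact continuous_conv_tens f fun i => (hgs i).Phi _
    · simp_rw [htens]
      refine (enorm_conv_tens_Phi_le f hgs (fun i => rfl) hσ2 j x).trans ?_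
      refine ENNReal.tsum_le_tsum fun κ => lintegral_mono fun z => mul_le_mul_left ?_ _
      rw [← ofReal_norm, tens, norm_prod]
      exact ENNReal.ofReal_le_ofReal (Finset.prod_le_prod (fun i _ => norm_nonneg _)
        fun i _ => hDk i _ _ _)
    · refine mul_le_mul_left ?_ _
      rw [ENNReal.ofReal_add ENNReal.toReal_nonneg zero_le_one, ENNReal.ofReal_toReal hC]
      exact le_self_add
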